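/- **Setting.** Let $n\ge 2$, $m\ge 1$, $d\ge 1$. Worker $i\in\{1,\dots,n\}$ holds $f_i=\frac1m\sum_{j=1}^m f_{i,j}$ on $\mathbb R^d$, where each $f_{i,j}$ is differentiable and $L_i$-smooth and $\mu_i$-strongly convex, $\mu_i>0$, that is, $\langle\nabla f_{i,j}(x),y-x\rangle+\frac{\mu_i}2\|y-x\|^2\le f_{i,j}(y)-f_{i,j}(x)\le\langle\nabla f_{i,j}(x),y-x\rangle+\frac{L_i}2\|y-x\|^2$. Let $W\in\mathbb R^{n\times n}$ be symmetric with $U=I-W$ positive semidefinite, $\mathrm{null}(U)=\mathrm{span}\{\mathbf 1\}$, and, for $i\neq j$, $W_{ij}\ne0$ iff $(i,j)$ is an edge of the network. Let $\sigma_1\ge\dots\ge\sigma_{n-1}>\sigma_n=0$ be the eigenvalues of $U$. Put $\zeta(U)=\sigma_{n-1}/\sigma_1$, $\mu_{\min}=\min_i\mu_i$, $L_{\max}=\max_iL_i$, $\kappa_{\max}=\max_iL_i/\mu_i$, $\kappa_F=L_{\max}/\mu_{\min}$, $\kappa=\kappa_F/\zeta(U)$, $\beta=\sigma_1/\mu_{\min}$,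 $\alpha=\sigma_{n-1}/L_{\max}$. Norms of matrices are Frobenius norms. For $\Theta=(\theta_1,\dots,\theta_n)\in\mathbb R^{d\times n}$ let $F(\Theta)=\sum_if_i(\theta_i)$, let $F^*$ be its conjugate, $G(\xi)=F^*(\xi\sqrt U)$, and let $\xi^\star$ be the minimizer of $G$ with $\xi^\star\mathbf 1=0$ (it exists). **DLAG** (parameters $D\in\mathbb N$, $\gamma,c,\eta,s$). Start with $x^0=y^0=0$, $\hat\Theta^0=\Theta^0=\nabla F^*(0)$, ages $d^0_i=0$. For $k\ge0$, $$y^{k+1}=x^k-\eta\hat\Theta^kU,\qquad x^{k+1}=y^{k+1}+\tfrac{\sqrt{s\kappa}-1}{\sqrt{s\kappa}+1}(y^{k+1}-y^k).$$ For $k\ge1$, $\theta_i^k$ is the last snapshot of the variance-reduced method Katyusha (epoch length $2m$), started at $\theta_i^{k-1}$ and run on $\min_\theta\frac1m\sum_j(f_{i,j}(\theta)-\langle\theta,x_i^k\rangle)$ with the term $\frac{\mu_i}2\|\theta\|^2-\langle\theta,x_i^k\rangle$ treated as the proximal term; all indices sampled (over all iterations, workers and steps) are independent and uniform. If $$\|\hat\theta_i^{k-1}-\theta_i^k\|^2\le\frac3{\mu_{\min}^2}\Big(\sum_{j=0}^{k-D-1}c^{k-D-j}\delta_j+\sum_{j=0}^{k-1}c^{k-j}\delta_j+\sum_{j=k-D}^{k-1}(c+\gamma)\delta_j\Big),\quad\delta_j=\|x^j_i-x^{j+1}_i\|^2$$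 (with $\delta_j=0$ for $j<0$) and $d_i^{k-1}\neq D$, then $\hat\theta_i^k=\hat\theta_i^{k-1}$ and $d_i^k=d_i^{k-1}+1$; otherwise $\hat\theta_i^k=\theta_i^k$ and $d_i^k=0$. In every call, Katyusha is run for the same number $\lceil C_0(1+\sqrt{\kappa_{\max}/m})\log(2\kappa_{\max}/c)\rceil$ of epochs, each of which evaluates $5m$ gradients of single functions $f_{i,j}$ ("stochastic gradients"). Let $\lambda^0=\xi^0=0$, $\lambda^{k+1}=\xi^k-\eta\hat\Theta^k\sqrt U$, $\xi^{k+1}=\lambda^{k+1}+\frac{\sqrt{s\kappa}-1}{\sqrt{s\kappa}+1}(\lambda^{k+1}-\lambda^k)$, $v^k=(1+\sqrt{s\kappa})\xi^k-\sqrt{s\kappa}\lambda^k$, $\xi^j=\xi^0$ for $j<0$, and $$L^k=2\eta s\kappa\big(G(\lambda^k)-G(\xi^\star)\big)+\|v^k-\xi^\star\|^2+\sum_{e=1}^Dc_e\|\xi^{k+1-e}-\xi^{k-e}\|^2+\sum_{e=1}^k\tilde c_e\|\xi^{k+1-e}-\xi^{k-e}\|^2 .$$ With $r=1-\frac1{\sqrt{s\kappa}}$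 and a number $\rho$ given below, the weights are $$c_e=\sum_{j=e}^Dr^{e-j-1}q,\qquad q=\frac{18\rho\eta\|\sqrt U\|^4}{\alpha\mu_{\min}^2}\sqrt{s\kappa}\,\gamma,\qquad \tilde c_e=\sum_{l\ge0}\frac{w_{e+l}}{r^{l+1}},$$ where $w_e=\frac{3\rho\sqrt{s\kappa}\,\eta}{\alpha}\frac{\|\sqrt U\|^4}{\mu_{\min}^2}\cdot(6c+8c^e)$ for $e\le D$ and $w_e=\frac{3\rho\sqrt{s\kappa}\,\eta}{\alpha}\frac{\|\sqrt U\|^4}{\mu_{\min}^2}\cdot(6c^{e-D}+8c^e)$ for $e>D$. **Theorem.** There are absolute constants $C_0,C_1>0$ (independent of $n,m,d$, of the functions, of the network and of all parameters) such that the conclusions (i)–(iv) below hold in each of the following two cases. (A) $D\ge1$ and $$\gamma=\frac{\alpha\beta\mu_{\min}^2}{288D\|\sqrt U\|^4}e^{-2D/\sqrt\kappa},\quad c=\frac{\alpha\beta\mu_{\min}^2}{1200D\|\sqrt U\|^4}e^{-2(D+1)/\sqrt\kappa},\quad \eta=\frac2{15\beta},\quad s=10,\quad\rho=4;$$ in this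 case moreover $0<c<1$ and $\gamma>0$. (B) $D\ge2$, $\kappa>2$, $\gamma,c>0$, and $a,b$ are any numbers with $a\ge\frac{6\|\sqrt U\|^4}{\alpha\beta\mu_{\min}^2}\gamma De^{2D/\sqrt\kappa}$ and $b\ge\frac{25\|\sqrt U\|^4}{\alpha\beta\mu_{\min}^2}cDe^{2D/\sqrt\kappa}$ such that, with $R=\sqrt{2+\frac1{12(a+b)}}$ and $$\eta=\frac R{1+R}\cdot\frac1{1+24(a+b)(2+R)}\cdot\frac1\beta,\qquad s=\frac{2+R}R\big(1+24(a+b)(2+R)\big),\qquad\rho=2+R,$$ one has $c\le\frac12\big(1-\frac1{\sqrt{s\kappa}}\big)$. Conclusions: (i) $\xi^k\mathbf 1=\lambda^k\mathbf 1=0$, $x^k=\xi^k\sqrt U$, $y^k=\lambda^k\sqrt U$ for all $k$, the weights $c_e$ ($1\le e\le D$) and $\tilde c_e$ ($e\ge1$) are positive, $L^k$ is integrable, and $\mathbb E[L^{k+1}]\le\big(1-\frac1{\sqrt{s\kappa}}\big)\mathbb E[L^k]$ for all $k\ge0$ (in case (A): $\mathbb E[L^{k+1}]\le(1-\frac1{\sqrt{10\kappa}})\mathbb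 E[L^k]$). (ii) For $\varepsilon>0$ put $I(\varepsilon)=\sqrt{s\kappa}\,\log^+\!\frac{2(G(0)-G(\xi^\star))}{\varepsilon}$, where $\log^+t=\max(0,\log t)$ and $\log^+0=0$. For every integer $K\ge I(\varepsilon)$, $G(\lambda^K)$ is integrable and $\mathbb E[G(\lambda^K)]-G(\xi^\star)\le\varepsilon$. So the iteration complexity is $O(\sqrt{s\kappa}\log\frac1\varepsilon)$, in case (A) $O(\sqrt\kappa\log\frac1\varepsilon)$. (iii) Every call of Katyusha evaluates at most $C_1B$ stochastic gradients, where $B=(m+\sqrt{m\kappa_{\max}})\log\frac{2\kappa_{\max}}c$. (iv) To produce $y^K$ with $K=\lceil I(\varepsilon)\rceil$, each worker evaluates at most $C_1B\,I(\varepsilon)$ stochastic gradients, and all workers together at most $C_1\,nB\,I(\varepsilon)$ (the exact dual gradient at the start is not counted). So, when the factor $\log(2\kappa_{\max}/c)$ is regarded as a constant, the total is $O\big(n(m+\sqrt{m\kappa_{\max}})\sqrt{s\kappa}\log\frac1\varepsilon\big)$, with $s=10$ in case (A). -/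

import Mathlib

open MeasureTheory ProbabilityTheory
open scoped BigOperators Gradient

noncomputable section

namespace DLAG

/-- The space `ℝ^d` with its Euclidean norm. -/
abbrev Vec (d : ℕ) := EuclideanSpace ℝ (Fin d)

/-- The space `ℝ^{d × n}` of blocks `Θ = (θ_1, …, θ_n)` with columns `θ_i ∈ ℝ^d`; its norm is the
Frobenius norm and its inner product the Frobenius inner product. -/
abbrev Blk (n d : ℕ) := PiLp 2 (fun _ : Fin n => Vec d)

/-- The matrix product `Θ A` of a `d × n` block with an `n × n` matrix, columnwise. -/
def rightMul {n d : ℕ} (Θ : Blk n d) (A : Matrix (Fin n) (Fin n) ℝ) : Blk n d :=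
  WithLp.toLp 2 (fun i => ∑ j, A j i • Θ j)

/-- The subspace `S = {ξ : ξ 𝟏 = 0}` of `ℝ^{d × n}`. -/
def MeanZero {n d : ℕ} (ξ : Blk n d) : Prop := ∑ i, ξ i = 0

/-- Frobenius norm of a real matrix. -/
def frobNorm {n : ℕ} (A : Matrix (Fin n) (Fin n) ℝ) : ℝ := Real.sqrt (∑ i, ∑ j, A i j ^ 2)

/-- The convex conjugate `φ*(y) = sup_x {⟨y, x⟩ - φ(x)}`. -/
def conjugate {E : Type*} [NormedAddCommGroup E] [InnerProductSpace ℝ E] (φ : E → ℝ) (y : E) : ℝ :=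
  ⨆ x : E, (inner ℝ y x - φ x)

/-- `φ` is `L`-smooth. -/
def LSmooth {d : ℕ} (L : ℝ) (φ : Vec d → ℝ) : Prop :=
  Differentiable ℝ φ ∧
    ∀ x y, φ y ≤ φ x + inner ℝ (∇ φ x) (y - x) + L / 2 * ‖y - x‖ ^ 2

/-- The differentiable function `φ` is `μ`-strongly convex. -/
def StronglyConvex {d : ℕ} (μ : ℝ) (φ : Vec d → ℝ) : Prop :=
  ∀ x y, φ x + inner ℝ (∇ φ x) (y - x) + μ / 2 * ‖y - x‖ ^ 2 ≤ φ y

/-- A decentralized finite-sum problem: `n` workers, `m` functions on `ℝ^d` per worker, and a gossip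
matrix `U = I - W` on a graph. The condition that the support of `W` is the edge set concerns the
off-diagonal entries. -/
structure Problem (n m d : ℕ) where
  f : Fin n → Fin m → Vec d → ℝ
  L : Fin n → ℝ
  μ : Fin n → ℝ
  μ_pos : ∀ i, 0 < μ i
  smooth : ∀ i j, LSmooth (L i) (f i j)
  strong : ∀ i j, StronglyConvex (μ i) (f i j)
  graph : SimpleGraph (Fin n)
  W : Matrix (Fin n) (Fin n) ℝ
  W_symm : W.IsSymm
  U_psd : (1 - W).PosSemidef
  W_support : ∀ i j, i ≠ j → (W i j ≠ 0 ↔ graph.Adj i j)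
  U_ker : LinearMap.ker (1 - W).mulVecLin = Submodule.span ℝ {fun _ : Fin n => (1 : ℝ)}

namespace Problem

variable {n m d : ℕ} (Q : Problem n m d)

/-- `f_i = (1/m) ∑_j f_{i,j}`. -/
def localObj (i : Fin n) (θ : Vec d) : ℝ := (1 / (m : ℝ)) * ∑ j, Q.f i j θ

/-- `F(Θ) = ∑_i f_i(θ_i)`. -/
def F (Θ : Blk n d) : ℝ := ∑ i, Q.localObj i (Θ i)

/-- The gossip matrix `U = I - W`. -/
def U : Matrix (Fin n) (Fin n) ℝ := 1 - Q.W

/-- `√U`, the square root taken on the eigenvalues in an eigendecomposition of `U`. -/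
def sqrtU : Matrix (Fin n) (Fin n) ℝ := Q.U_psd.isHermitian.cfc Real.sqrt

/-- The eigenvalues of `U` with multiplicity in decreasing order, with indices `0, …, n - 1`:
`σ k` is `σ_{k+1}(U)`. -/
def σ (k : ℕ) : ℝ :=
  if h : k < Fintype.card (Fin n) then Q.U_psd.isHermitian.eigenvalues₀ ⟨k, h⟩ else 0

/-- The largest eigenvalue `σ_1(U)`. -/
def σMax : ℝ := Q.σ 0

/-- The smallest nonzero eigenvalue `σ_{n-1}(U)`. -/
def σMin : ℝ := Q.σ (n - 2)

/-- The normalized eigengap `ζ(U)`. -/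
def ζ : ℝ := Q.σMin / Q.σMax

def μMin : ℝ := ⨅ i, Q.μ i

def LMax : ℝ := ⨆ i, Q.L i

/-- `κ_max = max_i L_i / μ_i`. -/
def κMax : ℝ := ⨆ i, Q.L i / Q.μ i

def κF : ℝ := Q.LMax / Q.μMin

/-- `κ = κ_F / ζ(U)`. -/
def κ : ℝ := Q.κF / Q.ζ

/-- `β = σ_1(U) / μ_min`. -/
def β : ℝ := Q.σMax / Q.μMin

/-- `α = σ_{n-1}(U) / L_max`. -/
def α : ℝ := Q.σMin / Q.LMax

/-- The dual objective `G(ξ) = F*(ξ √U)`. -/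
def G (ξ : Blk n d) : ℝ := conjugate Q.F (rightMul ξ Q.sqrtU)

/-- `ξ` is a minimizer of `G` lying in `S`. -/
def IsDualMin (ξ : Blk n d) : Prop := MeanZero ξ ∧ ∀ ξ', Q.G ξ ≤ Q.G ξ'

end Problem

/-! ### Katyusha

Katyusha on `ℝ^d` for the problem `min_θ (1/m) ∑_j h_j(θ) + ψ(θ)`, where the `h_j` are convex and
`L`-smooth and `ψ` is `μ`-strongly convex. It is applied to
`min_θ (1/m) ∑_j (f_j(θ) - ⟨θ, x⟩)` with
`h_j(θ) = f_j(θ) - (μ/2) ‖θ‖²` and `ψ(θ) = (μ/2) ‖θ‖² - ⟨θ, x⟩`. -/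

/-- The state of Katyusha: the sequences `y`, `z`, the snapshot, the full gradient at the snapshot,
the running weighted sum of the `y`'s of the epoch, and the number of evaluations of gradients of
single functions `f_j` so far. -/
structure KState (d : ℕ) where
  y : Vec d
  z : Vec d
  snap : Vec d
  full : Vec d
  acc : Vec d
  evals : ℕ

namespace Katyusha

variable {m d : ℕ}

/-- The gradient of `h_j`. -/
def hGrad (f : Fin m → Vec d → ℝ) (μ : ℝ) (j : Fin m) (θ : Vec d) : Vec d := ∇ (f j) θ - μ • θ

/-- `τ₁ = min {√(M μ / (3 L)), 1/2}` with the epoch length `M = 2m`. -/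
def τ₁ (m : ℕ) (L μ : ℝ) : ℝ := min (Real.sqrt (2 * (m : ℝ) * μ / (3 * L))) (1 / 2)

/-- The step size `1 / (3 τ₁ L)`. -/
def step (m : ℕ) (L μ : ℝ) : ℝ := 1 / (3 * τ₁ m L μ * L)

/-- The proximal step `argmin_w {‖w - z‖² / (2a) + ⟨v, w⟩ + ψ(w)}` for
`ψ(w) = (μ/2) ‖w‖² - ⟨w, x⟩`. -/
def prox (a μ : ℝ) (x z v : Vec d) : Vec d := (1 + a * μ)⁻¹ • (z - a • (v - x))

/-- `prox` is the minimizer it is meant to be. -/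
theorem prox_isMin (a μ : ℝ) (ha : 0 < a) (hμ : 0 ≤ μ) (x z v w : Vec d) :
    1 / (2 * a) * ‖prox a μ x z v - z‖ ^ 2 + inner ℝ v (prox a μ x z v)
        + (μ / 2 * ‖prox a μ x z v‖ ^ 2 - inner ℝ (prox a μ x z v) x)
      ≤ 1 / (2 * a) * ‖w - z‖ ^ 2 + inner ℝ v w + (μ / 2 * ‖w‖ ^ 2 - inner ℝ w x) := by
  have hpos : 0 < 1 + a * μ := by positivity
  set p := prox a μ x z v with hp
  have hz : z = (1 + a * μ) • p + a • (v - x) := by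
    rw [hp, prox, smul_smul, mul_inv_cancel₀ hpos.ne', one_smul]; abel
  have key : 1 / (2 * a) * ‖w - z‖ ^ 2 + inner ℝ v w + (μ / 2 * ‖w‖ ^ 2 - inner ℝ w x)
      - (1 / (2 * a) * ‖p - z‖ ^ 2 + inner ℝ v p + (μ / 2 * ‖p‖ ^ 2 - inner ℝ p x))
      = (1 / (2 * a) + μ / 2) * ‖w - p‖ ^ 2 := by
    clear_value p
    subst hz
    simp only [← real_inner_self_eq_norm_sq, inner_sub_left, inner_sub_right, inner_add_left,
      inner_add_right, real_inner_smul_left, real_inner_smul_right]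
    rw [real_inner_comm w p, real_inner_comm w v, real_inner_comm w x, real_inner_comm p v,
      real_inner_comm p x, real_inner_comm v x]
    field_simp
    ring
  have : 0 ≤ (1 / (2 * a) + μ / 2) * ‖w - p‖ ^ 2 := by positivity
  linarith

variable (f : Fin m → Vec d → ℝ) (L μ : ℝ) (x : Vec d)

/-- The `j`-th inner step of an epoch, with sampled index `i`. It evaluates `∇ f_i` at the current
extrapolated point and at the snapshot. -/
def innerStep (j : ℕ) (i : Fin m) (st : KState d) : KState d :=
  let p := τ₁ m L μ • st.z + (1 / 2 : ℝ) • st.snap + (1 - τ₁ m L μ - 1 / 2) • st.y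
  let v := st.full + (hGrad f μ i p - hGrad f μ i st.snap)
  let z' := prox (step m L μ) μ x st.z v
  let y' := p + τ₁ m L μ • (z' - st.z)
  { y := y'
    z := z'
    snap := st.snap
    full := st.full
    acc := st.acc + (1 + step m L μ * μ) ^ j • y'
    evals := st.evals + 2 }

/-- The first `j` inner steps of an epoch, with sampled indices `idx 0, …, idx (j - 1)`. -/
def innerLoop (idx : ℕ → Fin m) (st : KState d) : ℕ → KState d
  | 0 => st
  | j + 1 => innerStep f L μ x j (idx j) (innerLoop idx st j)

/-- One epoch: the full gradient at the snapshot (`m` evaluations), `2m` inner steps, and the new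
snapshot, a weighted average of the `y`'s of the epoch. -/
def epoch (idx : ℕ → Fin m) (st : KState d) : KState d :=
  let st₀ : KState d :=
    { y := st.y
      z := st.z
      snap := st.snap
      full := (1 / (m : ℝ)) • ∑ j, hGrad f μ j st.snap
      acc := 0
      evals := st.evals + m }
  let st₁ := innerLoop f L μ x idx st₀ (2 * m)
  { y := st₁.y
    z := st₁.z
    snap := (∑ j ∈ Finset.range (2 * m), (1 + step m L μ * μ) ^ j)⁻¹ • st₁.acc
    full := st₁.full
    acc := st₁.acc
    evals := st₁.evals }

/-- Katyusha for `s` epochs, started at `θ₀`; its output is the last snapshot. Epoch `s` uses the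
sampled indices `idx (2 m s), …, idx (2 m s + 2 m - 1)`. -/
def run (idx : ℕ → Fin m) (θ₀ : Vec d) : ℕ → KState d
  | 0 => { y := θ₀, z := θ₀, snap := θ₀, full := 0, acc := 0, evals := 0 }
  | s + 1 => epoch f L μ x (fun j => idx (2 * m * s + j)) (run idx θ₀ s)

end Katyusha

/-! ### DLAG -/

/-- Parameters of DLAG: maximal delay `D`, staleness and inexactness parameters `γ`, `c`, step size
`η`, momentum parameter `s`, the number of Katyusha epochs per iteration, and the number `ρ`, which
enters only the weights of the Lyapunov function. -/
structure Params where
  D : ℕ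
  γ : ℝ
  c : ℝ
  η : ℝ
  s : ℝ
  ρ : ℝ
  epochs : ℕ

/-- The state of DLAG once the dual gradients of iteration `k` are available: `Θ^k`, `Θ̂^k`, the
ages `d^k_i`, the history `x^0, …, x^k`, the point `y^k`, and for each worker the number of
evaluations of gradients of its functions `f_{i,j}` so far. -/
structure State (n d : ℕ) where
  Θ : Blk n d
  Θhat : Blk n d
  age : Fin n → ℕ
  xs : ℕ → Blk n d
  y : Blk n d
  evals : Fin n → ℕ

section Algorithm

variable {n m d : ℕ} (Q : Problem n m d) (p : Params)

/-- The momentum coefficient `(√(sκ) - 1) / (√(sκ) + 1)`. -/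
def momentum : ℝ := (Real.sqrt (p.s * Q.κ) - 1) / (Real.sqrt (p.s * Q.κ) + 1)

/-- The lazy condition of worker `i` at iteration `k`, for the history `xs`, the cached vector
`old = θ̂^{k-1}_i` and the new vector `new = θ^k_i`. Sums over `j` run over nonnegative `j` only:
`k - D` is truncated at `0`. -/
def LazyCond (xs : ℕ → Blk n d) (k : ℕ) (i : Fin n) (old new : Vec d) : Prop :=
  ‖old - new‖ ^ 2 ≤
    3 * ∑ j ∈ Finset.range (k - p.D), p.c ^ (k - p.D - j) / Q.μMin ^ 2 * ‖xs j i - xs (j + 1) i‖ ^ 2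
    + 3 * ∑ j ∈ Finset.range k, p.c ^ (k - j) / Q.μMin ^ 2 * ‖xs j i - xs (j + 1) i‖ ^ 2
    + 3 * ∑ j ∈ Finset.Ico (k - p.D) k, p.c / Q.μMin ^ 2 * ‖xs j i - xs (j + 1) i‖ ^ 2
    + 3 * ∑ j ∈ Finset.Ico (k - p.D) k, p.γ / Q.μMin ^ 2 * ‖xs j i - xs (j + 1) i‖ ^ 2

/-- Initialization: `x^0 = y^0 = 0` and `Θ̂^0 = Θ^0 = ∇F*(x^0)`. The exact dual gradient at the start
is not counted. -/
def init : State n d :=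
  { Θ := WithLp.toLp 2 (fun i => ∇ (conjugate (Q.localObj i)) 0)
    Θhat := WithLp.toLp 2 (fun i => ∇ (conjugate (Q.localObj i)) 0)
    age := fun _ => 0
    xs := fun _ => 0
    y := 0
    evals := fun _ => 0 }

open Classical in
/-- From iteration `k` to iteration `k + 1`: the updates of `y` and `x`, then for each worker
Katyusha warm-started at its previous approximate dual gradient, with sampled indices `idx i`, and
the communication rule. -/
def next (k : ℕ) (idx : Fin n → ℕ → Fin m) (st : State n d) : State n d :=
  let y' := st.xs k - p.η • rightMul st.Θhat Q.U
  let x' := y' + momentum Q p • (y' - st.y)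
  let xs' := Function.update st.xs (k + 1) x'
  let out : Fin n → KState d := fun i =>
    Katyusha.run (Q.f i) (Q.L i) (Q.μ i) (x' i) (idx i) (st.Θ i) p.epochs
  let send : Fin n → Prop := fun i =>
    ¬ LazyCond Q p xs' (k + 1) i (st.Θhat i) (out i).snap ∨ st.age i = p.D
  { Θ := WithLp.toLp 2 (fun i => (out i).snap)
    Θhat := WithLp.toLp 2 (fun i => if send i then (out i).snap else st.Θhat i)
    age := fun i => if send i then 0 else st.age i + 1
    xs := xs'
    y := y'
    evals := fun i => st.evals i + (out i).evals }

/-- The state of DLAG at iteration `k`, where `idx k i t` is the `t`-th index that worker `i`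
samples at iteration `k`. -/
def state (idx : ℕ → Fin n → ℕ → Fin m) : ℕ → State n d
  | 0 => init Q
  | k + 1 => next Q p k (idx (k + 1)) (state idx k)

/-- The sequence `x^k`. -/
def xSeq (idx : ℕ → Fin n → ℕ → Fin m) (k : ℕ) : Blk n d := (state Q p idx k).xs k

/-- The sequence `y^k`. -/
def ySeq (idx : ℕ → Fin n → ℕ → Fin m) (k : ℕ) : Blk n d := (state Q p idx k).y

/-- The pair `(λ^k, ξ^k)`: `λ^0 = ξ^0 = 0`, `λ^{k+1} = ξ^k - η Θ̂^k √U`, and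
`ξ^{k+1} = λ^{k+1} + ((√(sκ) - 1) / (√(sκ) + 1)) (λ^{k+1} - λ^k)`. -/
def dualPair (idx : ℕ → Fin n → ℕ → Fin m) : ℕ → Blk n d × Blk n d
  | 0 => (0, 0)
  | k + 1 =>
    let q := dualPair idx k
    let l' := q.2 - p.η • rightMul (state Q p idx k).Θhat Q.sqrtU
    (l', l' + momentum Q p • (l' - q.1))

def lamSeq (idx : ℕ → Fin n → ℕ → Fin m) (k : ℕ) : Blk n d := (dualPair Q p idx k).1

def xiSeq (idx : ℕ → Fin n → ℕ → Fin m) (k : ℕ) : Blk n d := (dualPair Q p idx k).2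

/-- `v^k = (1 + √(sκ)) ξ^k - √(sκ) λ^k`. -/
def vSeq (idx : ℕ → Fin n → ℕ → Fin m) (k : ℕ) : Blk n d :=
  (1 + Real.sqrt (p.s * Q.κ)) • xiSeq Q p idx k - Real.sqrt (p.s * Q.κ) • lamSeq Q p idx k

/-- The number of stochastic gradients that worker `i` evaluates to produce `y^k` (equivalently
`λ^k`), which for `k ≥ 1` is made from `Θ̂^0, …, Θ̂^{k-1}`. -/
def workerEvals (idx : ℕ → Fin n → ℕ → Fin m) (k : ℕ) (i : Fin n) : ℕ :=
  (state Q p idx (k - 1)).evals i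

/-- The contraction factor `1 - 1/√(sκ)`. -/
def rate : ℝ := 1 - 1 / Real.sqrt (p.s * Q.κ)

/-- `q = (18 ρ η ‖√U‖⁴ / (α μ_min²)) √(sκ) γ`. -/
def qConst : ℝ :=
  18 * p.ρ * p.η * frobNorm Q.sqrtU ^ 4 / (Q.α * Q.μMin ^ 2) * Real.sqrt (p.s * Q.κ) * p.γ

/-- The weights `c_d = ∑_{j=d}^D r^{d-j-1} q` with `r = 1 - 1/√(sκ)`. -/
def cWeight (e : ℕ) : ℝ :=
  ∑ j ∈ Finset.Icc e p.D, rate Q p ^ ((e : ℤ) - (j : ℤ) - 1) * qConst Q p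

/-- `w_d = (3 ρ √(sκ) η / α) (‖√U‖⁴ / μ_min²) (6 c + 8 c^d)` for `d ≤ D`, with `c^{d-D}` in place of
the first `c` for `d > D`. -/
def wWeight (e : ℕ) : ℝ :=
  3 * p.ρ * Real.sqrt (p.s * Q.κ) * p.η / Q.α * (frobNorm Q.sqrtU ^ 4 / Q.μMin ^ 2) *
    (6 * (if e ≤ p.D then p.c else p.c ^ (e - p.D)) + 8 * p.c ^ e)

/-- The weights `c̃_d = ∑_{l ≥ 0} w_{d+l} / r^{l+1}`, the positive solution of
`c̃_{d+1} = r c̃_d - w_d` with `c̃_1 / r = ∑_{d ≥ 1} w_d / r^{d+1}`. -/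
def cTilde (e : ℕ) : ℝ := ∑' l : ℕ, wWeight Q p (e + l) / rate Q p ^ (l + 1)

/-- The Lyapunov function `L^k`. With truncated subtraction of natural numbers, `ξ^j` stands for
`ξ^0` when `j < 0`. -/
def lyapunov (ξstar : Blk n d) (idx : ℕ → Fin n → ℕ → Fin m) (k : ℕ) : ℝ :=
  2 * p.η * p.s * Q.κ * (Q.G (lamSeq Q p idx k) - Q.G ξstar)
    + ‖vSeq Q p idx k - ξstar‖ ^ 2
    + ∑ e ∈ Finset.Icc 1 p.D,
        cWeight Q p e * ‖xiSeq Q p idx (k + 1 - e) - xiSeq Q p idx (k - e)‖ ^ 2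
    + ∑ e ∈ Finset.Icc 1 k,
        cTilde Q p e * ‖xiSeq Q p idx (k + 1 - e) - xiSeq Q p idx (k - e)‖ ^ 2

/-- The number of Katyusha epochs per iteration,
`⌈C₀ (1 + √(κ_max / m)) log (2 κ_max / c)⌉`; an epoch takes `5m` stochastic gradients. -/
def epochCount (C₀ c : ℝ) : ℕ :=
  ⌈C₀ * (1 + Real.sqrt (Q.κMax / m)) * Real.log (2 * Q.κMax / c)⌉₊

/-- The budget `(m + √(m κ_max)) log (2 κ_max / c)` of stochastic gradients per call of Katyusha, up
to a constant factor. -/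
def katyushaBudget (c : ℝ) : ℝ :=
  ((m : ℝ) + Real.sqrt (m * Q.κMax)) * Real.log (2 * Q.κMax / c)

/-- `√(sκ) log⁺(2 (G(ξ^0) - G(ξ*)) / ε)`, where `ξ^0 = 0` and `log⁺ t = max (0, log t)`. -/
def iterBound (ξstar : Blk n d) (ε : ℝ) : ℝ :=
  Real.sqrt (p.s * Q.κ) * max 0 (Real.log (2 * (Q.G 0 - Q.G ξstar) / ε))

end Algorithm

/-- The sampling model: the indices `J k i t` (iteration `k`, worker `i`, draw `t`) are independent
and uniform on `Fin m`. -/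
structure Sampling {n m : ℕ} {Ω : Type*} [MeasurableSpace Ω] (P : Measure Ω)
    (J : ℕ → Fin n → ℕ → Ω → Fin m) : Prop where
  measurable : ∀ k i t, Measurable (J k i t)
  uniform : ∀ k i t j, P.real {ω | J k i t ω = j} = 1 / (m : ℝ)
  indep : iIndepFun (fun q : ℕ × Fin n × ℕ => J q.1 q.2.1 q.2.2) P

/-- The sample path of indices at `ω`. -/
def path {n m : ℕ} {Ω : Type*} (J : ℕ → Fin n → ℕ → Ω → Fin m) (ω : Ω) :
    ℕ → Fin n → ℕ → Fin m := fun k i t => J k i t ω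

/-- The performance guarantee of DLAG with parameters `p`, where `C₁` is the constant in the bounds
on the number of stochastic gradients. -/
structure Guarantee {n m d : ℕ} {Ω : Type*} [MeasurableSpace Ω] (C₁ : ℝ) (Q : Problem n m d)
    (p : Params) (P : Measure Ω) (J : ℕ → Fin n → ℕ → Ω → Fin m) (ξstar : Blk n d) : Prop where
  /-- The sequences `ξ^k`, `λ^k` lie in `S` and represent the iterates of DLAG. -/
  lift : ∀ k ω,
    MeanZero (xiSeq Q p (path J ω) k) ∧ MeanZero (lamSeq Q p (path J ω) k) ∧
    xSeq Q p (path J ω) k = rightMul (xiSeq Q p (path J ω) k) Q.sqrtU ∧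
    ySeq Q p (path J ω) k = rightMul (lamSeq Q p (path J ω) k) Q.sqrtU
  /-- The weights of the Lyapunov function are positive. -/
  weights_pos : (∀ e ∈ Finset.Icc 1 p.D, 0 < cWeight Q p e) ∧ ∀ e, 1 ≤ e → 0 < cTilde Q p e
  integrable : ∀ k, Integrable (fun ω => lyapunov Q p ξstar (path J ω) k) P
  /-- `E[L^{k+1}] ≤ (1 - 1/√(sκ)) E[L^k]`. -/
  contraction : ∀ k,
    ∫ ω, lyapunov Q p ξstar (path J ω) (k + 1) ∂P
      ≤ (1 - 1 / Real.sqrt (p.s * Q.κ)) * ∫ ω, lyapunov Q p ξstar (path J ω) k ∂P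
  /-- Iteration complexity: after `√(sκ) log⁺(2 (G(ξ^0) - G(ξ*)) / ε)` iterations the expected dual
  suboptimality is at most `ε`. -/
  iterations : ∀ ε : ℝ, 0 < ε → ∀ K : ℕ, iterBound Q p ξstar ε ≤ K →
    Integrable (fun ω => Q.G (lamSeq Q p (path J ω) K)) P ∧
    ∫ ω, Q.G (lamSeq Q p (path J ω) K) ∂P - Q.G ξstar ≤ ε
  /-- Each call of Katyusha takes at most `C₁ (m + √(m κ_max)) log (2 κ_max / c)` stochastic
  gradients. -/
  per_call : ∀ k ω i,
    ((state Q p (path J ω) (k + 1)).evals i : ℝ)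
      ≤ (state Q p (path J ω) k).evals i + C₁ * katyushaBudget Q p.c
  /-- Stochastic gradient complexity, per worker and in total, at the first iteration for which the
  iteration bound guarantees an expected dual suboptimality of at most `ε`. -/
  gradients : ∀ ε : ℝ, 0 < ε → ∀ ω,
    (∀ i, (workerEvals Q p (path J ω) ⌈iterBound Q p ξstar ε⌉₊ i : ℝ)
      ≤ C₁ * katyushaBudget Q p.c * iterBound Q p ξstar ε) ∧
    ∑ i, (workerEvals Q p (path J ω) ⌈iterBound Q p ξstar ε⌉₊ i : ℝ)
      ≤ C₁ * (n * katyushaBudget Q p.c * iterBound Q p ξstar ε)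

section Choices

variable {n m d : ℕ} (Q : Problem n m d)

/-- The choice `γ = (α β μ_min² / (288 D ‖√U‖⁴)) e^{-2D/√κ}`. -/
def γChoice (D : ℕ) : ℝ :=
  Q.α * Q.β * Q.μMin ^ 2 / (288 * D * frobNorm Q.sqrtU ^ 4) *
    Real.exp (-(2 * D / Real.sqrt Q.κ))

/-- The choice `c = (α β μ_min² / (1200 D ‖√U‖⁴)) e^{-2(D+1)/√κ}`. -/
def cChoice (D : ℕ) : ℝ :=
  Q.α * Q.β * Q.μMin ^ 2 / (1200 * D * frobNorm Q.sqrtU ^ 4) *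
    Real.exp (-(2 * (D + 1) / Real.sqrt Q.κ))

/-- The parameters with the choices of `γ` and `c` above, `η = 2/(15β)` and `s = 10`; here `ρ = 4`. -/
def mainParams (C₀ : ℝ) (D : ℕ) : Params :=
  { D := D
    γ := γChoice Q D
    c := cChoice Q D
    η := 2 / 15 * (1 / Q.β)
    s := 10
    ρ := 4
    epochs := epochCount Q C₀ (cChoice Q D) }

/-- `√(2 + 1/(12(a+b)))`. -/
def rootConst (a b : ℝ) : ℝ := Real.sqrt (2 + 1 / (12 * (a + b)))

/-- The general parameters, with
`s = ((2 + R)/R) (1 + 24(a+b)(2 + R))`, `η = (R/(1 + R)) (1/(1 + 24(a+b)(2 + R))) (1/β)` and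
`ρ = 2 + R` for `R = √(2 + 1/(12(a+b)))`. -/
def generalParams (C₀ : ℝ) (D : ℕ) (γ c a b : ℝ) : Params :=
  { D := D
    γ := γ
    c := c
    η := rootConst a b / (1 + rootConst a b) *
      (1 / (1 + 24 * (a + b) * (2 + rootConst a b))) * (1 / Q.β)
    s := (2 + rootConst a b) / rootConst a b * (1 + 24 * (a + b) * (2 + rootConst a b))
    ρ := 2 + rootConst a b
    epochs := epochCount Q C₀ c }

end Choices

end DLAG

end

/-!
The dual objective `G(ξ) = F*(ξ√U)` is `β`-smooth and, on the mean-zero subspace `S`, `α`-strongly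
convex with `κ = β/α` (`G_le`, `G_ge_of_meanZero`). DLAG is Nesterov's accelerated gradient method
for `G` on `S`, seen through `x = ξ√U`, `y = λ√U` (`meanZero_lift`), where the gradient `∇F*(x)√U` is
replaced by the cached approximation `Θ̂√U`.

One accelerated step with an inexact gradient decreases
`2ηsκ(G(λ) - G(ξ*)) + ‖v - ξ*‖²` by the factor `1 - 1/√(sκ)`, up to a multiple of the squared gradient
error, and leaves a negative multiple of `‖ξ^{k+1} - ξ^k‖²` to spare (`accelerated_step_le`). The
gradient error has two sources. The staleness of a cached vector is bounded pathwise by the lazy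
condition, hence by earlier steps `‖ξ^{j+1} - ξ^j‖²` with the coefficients `γ`, `c` and powers of `c`
(`norm_Θhat_sub_sq_le`). The inexactness of the fresh vector is bounded in expectation: Katyusha
converges linearly from any start that is independent of the new samples (`integral_run_snap_le`),
and the warm start at the previous output lets the error be unrolled into a sum of earlier steps
with geometrically decaying coefficients (`integral_Θ_error_le`). The weights `c_e`, `c̃_e` of the
Lyapunov function solve recursions whose defects are exactly these coefficients (`cWeight_rec`,
`cTilde_rec`, `errorCoeff_eq`), so that all earlier steps telescope and only
`(c_1 + c̃_1)‖ξ^{k+1} - ξ^k‖²` remains (`integral_lyapunov_succ_le`). The negative term pays for it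
as soon as `c_1 + c̃_1 ≤ 3ρ√(sκ)ηβA`; for the prescribed parameters this is a comparison of geometric
sums with `e^{2/√κ} ≥ 1/(1 - 1/√(sκ))` (`weights_le`, `geometric_bound`).

The contraction together with the quadratic growth of `G` on `S` gives the iteration complexity
(`integral_G_sub_le`), and each call of Katyusha takes `5m` gradients in each of its epochs
(`run_evals`), whose number is `⌈12(1 + √(κ_max/m)) log(2κ_max/c)⌉`.
-/

noncomputable section

/-! ### Convex conjugates of smooth strongly convex functions -/

section Conjugate

variable {E : Type*} [NormedAddCommGroup E] [InnerProductSpace ℝ E]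

/-- A function on a closed set of a finite-dimensional space that dominates a quadratic with
positive leading coefficient attains its minimum there. -/
theorem exists_isMinOn_of_quadratic_le [FiniteDimensional ℝ E] {S : Set E} (hS : IsClosed S)
    {g : E → ℝ} (hg : ContinuousOn g S) {x₀ b : E} (hx₀ : x₀ ∈ S) {A μ : ℝ} (hμ : 0 < μ)
    (h : ∀ x ∈ S, A + inner ℝ b x + μ / 2 * ‖x‖ ^ 2 ≤ g x) :
    ∃ x ∈ S, ∀ y ∈ S, g x ≤ g y := by
  have : ProperSpace E := FiniteDimensional.proper ℝ E
  have hlim : Filter.Tendsto (fun x : E => A + ‖x‖ * (μ / 2 * ‖x‖ - ‖b‖)) (Filter.cocompact E)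
      Filter.atTop := by
    refine Filter.tendsto_atTop_add_const_left _ _ ?_
    have h1 : Filter.Tendsto (fun x : E => ‖x‖) (Filter.cocompact E) Filter.atTop :=
      tendsto_norm_cocompact_atTop
    refine h1.atTop_mul_atTop₀ ?_
    exact Filter.tendsto_atTop_add_const_right _ _ (h1.const_mul_atTop (by positivity))
  obtain ⟨x, hx, hmin⟩ := hg.exists_isMinOn' hS hx₀ (by
    rw [Filter.eventually_inf_principal]
    filter_upwards [hlim.eventually_ge_atTop (g x₀)] with x hx hxS
    have h2 := h x hxS
    have h3 : -(‖b‖ * ‖x‖) ≤ inner ℝ b x := (abs_le.1 (abs_real_inner_le_norm b x)).1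
    nlinarith)
  exact ⟨x, hx, fun y hy => hmin hy⟩

/-- An affine minorant of `φ` with slope `y` touching at `p` makes `p` a maximizer in the
definition of `φ*(y)`. -/
theorem conjugate_eq_of_subgradient {φ : E → ℝ} {y p : E}
    (h : ∀ x, φ p + inner ℝ y (x - p) ≤ φ x) :
    DLAG.conjugate φ y = inner ℝ y p - φ p := by
  have hb : ∀ x, inner ℝ y x - φ x ≤ inner ℝ y p - φ p := fun x => by
    have := h x
    rw [inner_sub_right] at this
    linarith
  exact le_antisymm (ciSup_le hb) 
    (le_ciSup (f := fun x => inner ℝ y x - φ x) ⟨_, by rintro _ ⟨x, rfl⟩; exact hb x⟩ p)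

/-- Strong convexity of `φ` gives smoothness of its conjugate. -/
theorem conjugate_le_add_quadratic {φ : E → ℝ} {μ : ℝ} (hμ : 0 < μ) {y p : E}
    (h : ∀ x, φ p + inner ℝ y (x - p) + μ / 2 * ‖x - p‖ ^ 2 ≤ φ x) (y' : E) :
    DLAG.conjugate φ y' ≤
      DLAG.conjugate φ y + inner ℝ p (y' - y) + 1 / (2 * μ) * ‖y' - y‖ ^ 2 := by
  rw [conjugate_eq_of_subgradient (y := y) (p := p) fun x =>
    le_trans (le_add_of_nonneg_right (by positivity)) (h x)]
  refine ciSup_le fun x => ?_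
  have h1 := h x
  have h2 : inner ℝ (y' - y) (x - p) ≤ 1 / (2 * μ) * ‖y' - y‖ ^ 2 + μ / 2 * ‖x - p‖ ^ 2 := by
    refine (real_inner_le_norm _ _).trans ?_
    have h3 : 0 ≤ (‖y' - y‖ - μ * ‖x - p‖) ^ 2 / (2 * μ) := by positivity
    have h4 : (‖y' - y‖ - μ * ‖x - p‖) ^ 2 / (2 * μ)
        = 1 / (2 * μ) * ‖y' - y‖ ^ 2 + μ / 2 * ‖x - p‖ ^ 2 - ‖y' - y‖ * ‖x - p‖ := by
      field_simp; ring
    linarith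
  simp only [inner_sub_left, inner_sub_right] at h1 h2 ⊢
  rw [real_inner_comm y' p, real_inner_comm y p]
  linarith

/-- Smoothness of `φ` gives strong convexity of its conjugate, at a point `y'` where the supremum is
finite. -/
theorem add_quadratic_le_conjugate {φ : E → ℝ} {L : ℝ} (hL : 0 < L) {y p y' p' : E}
    (h : ∀ x, φ p + inner ℝ y (x - p) ≤ φ x)
    (hs : ∀ x, φ x ≤ φ p + inner ℝ y (x - p) + L / 2 * ‖x - p‖ ^ 2)
    (h' : ∀ x, φ p' + inner ℝ y' (x - p') ≤ φ x) :
    DLAG.conjugate φ y + inner ℝ p (y' - y) + 1 / (2 * L) * ‖y' - y‖ ^ 2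
      ≤ DLAG.conjugate φ y' := by
  rw [conjugate_eq_of_subgradient h, conjugate_eq_of_subgradient h']
  -- the maximizer of the concave quadratic minorant of `⟨y', ·⟩ - φ`
  have h1 := hs (p + L⁻¹ • (y' - y))
  have h2 := h' (p + L⁻¹ • (y' - y))
  rw [add_sub_cancel_left, norm_smul, mul_pow, norm_inv, Real.norm_of_nonneg hL.le] at h1
  have h3 : L / 2 * (L⁻¹ ^ 2 * ‖y' - y‖ ^ 2) = 1 / (2 * L) * ‖y' - y‖ ^ 2 := by field_simp
  have h4 : inner ℝ (y' - y) (L⁻¹ • (y' - y)) = 2 * (1 / (2 * L) * ‖y' - y‖ ^ 2) := by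
    rw [real_inner_smul_right, real_inner_self_eq_norm_sq]; field_simp
  rw [h3] at h1
  have h5 : inner ℝ y' (p + L⁻¹ • (y' - y) - p')
      = inner ℝ y' p - inner ℝ y' p' + inner ℝ y' (L⁻¹ • (y' - y)) := by
    rw [inner_sub_right, inner_add_right]; ring
  rw [inner_sub_left] at h4
  rw [h5] at h2
  have h6 : inner ℝ p (y' - y) = inner ℝ y' p - inner ℝ y p := by
    rw [inner_sub_right, real_inner_comm y', real_inner_comm y]
  linarith

/-- Maximizers in the definition of the conjugate of a strongly convex function depend Lipschitz
continuously on the dual variable. -/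
theorem norm_sub_le_of_strong {φ : E → ℝ} {μ : ℝ} {y p y' p' : E}
    (h : ∀ x, φ p + inner ℝ y (x - p) + μ / 2 * ‖x - p‖ ^ 2 ≤ φ x)
    (h' : ∀ x, φ p' + inner ℝ y' (x - p') + μ / 2 * ‖x - p'‖ ^ 2 ≤ φ x) :
    μ * ‖p - p'‖ ≤ ‖y - y'‖ := by
  have h1 := h p'
  have h2 := h' p
  have h3 : μ * ‖p - p'‖ ^ 2 ≤ inner ℝ (y - y') (p - p') := by
    rw [norm_sub_rev p' p] at h1
    rw [← neg_sub p p', inner_neg_right] at h1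
    rw [inner_sub_left]
    linarith
  have h4 := h3.trans (real_inner_le_norm _ _)
  rcases (norm_nonneg (p - p')).eq_or_lt with h0 | h0
  · rw [← h0]; simp
  · nlinarith

/-- A function squeezed between its tangent plane and a quadratic is differentiable. -/
theorem hasGradientAt_of_quadratic_bounds [CompleteSpace E] {φ : E → ℝ} {y p : E} {C : ℝ}
    (hlow : ∀ z, φ y + inner ℝ p (z - y) ≤ φ z)
    (hup : ∀ z, φ z ≤ φ y + inner ℝ p (z - y) + C * ‖z - y‖ ^ 2) : HasGradientAt φ p y := by
  rw [hasGradientAt_iff_isLittleO]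
  have hO : (fun z => φ z - φ y - inner ℝ p (z - y)) =O[nhds y] fun z => ‖z - y‖ ^ 2 := by
    refine Asymptotics.IsBigO.of_bound C (Filter.Eventually.of_forall fun z => ?_)
    have h1 := hlow z
    have h2 := hup z
    rw [Real.norm_of_nonneg (by linarith), Real.norm_of_nonneg (by positivity)]
    linarith
  refine hO.trans_isLittleO ?_
  have := Asymptotics.isLittleO_norm_pow_id (E' := E) one_lt_two
  have h2 : Filter.Tendsto (fun z => z - y) (nhds y) (nhds 0) := by
    have : Filter.Tendsto (fun z => z - y) (nhds y) (nhds (y - y)) := by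
      exact (continuous_id.sub continuous_const).tendsto y
    simpa using this
  exact this.comp_tendsto h2

theorem continuous_of_quadratic_bounds [CompleteSpace E] {φ : E → ℝ} {g : E → E} {C : ℝ}
    (hlow : ∀ y z, φ y + inner ℝ (g y) (z - y) ≤ φ z)
    (hup : ∀ y z, φ z ≤ φ y + inner ℝ (g y) (z - y) + C * ‖z - y‖ ^ 2) : Continuous φ :=
  continuous_iff_continuousAt.2 fun y =>
    (hasGradientAt_of_quadratic_bounds (hlow y) (hup y)).differentiableAt.continuousAt

end Conjugate

namespace DLAG

/-- A differentiable strongly convex function on `ℝ^d` has a surjective gradient. -/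
theorem StronglyConvex.exists_gradient_eq {d : ℕ} {μ : ℝ} (hμ : 0 < μ) {φ : Vec d → ℝ}
    (hd : Differentiable ℝ φ) (h : StronglyConvex μ φ) (y : Vec d) : ∃ p, ∇ φ p = y := by
  obtain ⟨p, -, hp⟩ := exists_isMinOn_of_quadratic_le (S := Set.univ) isClosed_univ
    (g := fun x => φ x - inner ℝ y x) (x₀ := 0) (b := ∇ φ 0 - y) (A := φ 0)
    (hd.continuous.sub (continuous_const.inner continuous_id)).continuousOn (Set.mem_univ _) hμ
    (fun x _ => by
      have := h 0 x
      rw [sub_zero] at this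
      rw [inner_sub_left]
      linarith)
  refine ⟨p, ?_⟩
  have hloc : IsLocalMin (fun x => φ x - inner ℝ y x) p :=
    Filter.Eventually.of_forall fun z => hp z (Set.mem_univ _)
  have h1 : HasFDerivAt (fun x => φ x - inner ℝ y x) (fderiv ℝ φ p - innerSL ℝ y) p :=
    (hd p).hasFDerivAt.sub (innerSL ℝ y).hasFDerivAt
  have h2 := hloc.hasFDerivAt_eq_zero h1
  refine ext_inner_right ℝ fun z => ?_
  rw [inner_gradient_left]
  have h3 := congrArg (fun l => l z) h2
  simpa [sub_eq_zero] using h3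

/-- The smoothness constant dominates the strong convexity constant. -/
theorem StronglyConvex.le_of_smooth {d : ℕ} (hd : 1 ≤ d) {μ L : ℝ} {φ : Vec d → ℝ}
    (hs : LSmooth L φ) (h : StronglyConvex μ φ) : μ ≤ L := by
  have h1 := h 0 (EuclideanSpace.single ⟨0, hd⟩ 1)
  have h2 := hs.2 0 (EuclideanSpace.single ⟨0, hd⟩ 1)
  simp only [sub_zero, PiLp.norm_single, norm_one, one_pow, mul_one] at h1 h2
  linarith

end DLAG

/-! ### The spectrum of the gossip matrix -/

namespace Matrix.IsHermitian

variable {ι : Type*} [Fintype ι] [DecidableEq ι] {A : Matrix ι ι ℝ} (hA : A.IsHermitian)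

theorem dotProduct_mulVec_eq_sum (v : ι → ℝ) :
    v ⬝ᵥ A.mulVec v
      = ∑ i, hA.eigenvalues i * inner ℝ (hA.eigenvectorBasis i) (WithLp.toLp 2 v) ^ 2 := by
  set b := hA.eigenvectorBasis
  have h1 : v ⬝ᵥ A.mulVec v = inner ℝ (WithLp.toLp 2 v) (WithLp.toLp 2 (A.mulVec v)) := by
    simp [PiLp.inner_apply, dotProduct, mul_comm]
  rw [h1, ← b.sum_inner_mul_inner]
  refine Finset.sum_congr rfl fun i _ => ?_
  have h2 : inner ℝ (b i) (WithLp.toLp 2 (A.mulVec v))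
      = hA.eigenvalues i * inner ℝ (b i) (WithLp.toLp 2 v) := by
    have h3 : inner ℝ (b i) (WithLp.toLp 2 (A.mulVec v)) = (A.mulVec v) ⬝ᵥ (b i).ofLp := by
      simp [PiLp.inner_apply, dotProduct]
    have h4 : inner ℝ (b i) (WithLp.toLp 2 v) = (b i).ofLp ⬝ᵥ v := by
      simp [PiLp.inner_apply, dotProduct, mul_comm]
    rw [h3, h4, dotProduct_comm, Matrix.dotProduct_mulVec, ← Matrix.mulVec_transpose]
    rw [show Aᵀ = A from hA.eq, hA.mulVec_eigenvectorBasis i, smul_dotProduct, smul_eq_mul]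
  rw [h2, real_inner_comm (b i)]
  ring

theorem dotProduct_self_eq_sum (v : ι → ℝ) :
    v ⬝ᵥ v = ∑ i, inner ℝ (hA.eigenvectorBasis i) (WithLp.toLp 2 v) ^ 2 := by
  have h1 : v ⬝ᵥ v = inner ℝ (WithLp.toLp 2 v) (WithLp.toLp 2 v) := by
    rw [PiLp.inner_apply]
    simp [dotProduct, sq]
  rw [h1, ← hA.eigenvectorBasis.sum_inner_mul_inner]
  refine Finset.sum_congr rfl fun i _ => ?_
  rw [real_inner_comm (hA.eigenvectorBasis i)]
  ring

end Matrix.IsHermitian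

namespace DLAG.Problem

variable {n m d : ℕ} (Q : Problem n m d)

/-- The position in decreasing order of an eigenvalue of `U` with a given label. -/
def rank (i : Fin n) : Fin (Fintype.card (Fin n)) :=
  (Fintype.equivOfCardEq (Fintype.card_fin _)).symm i

theorem eigenvalues_eq_σ (i : Fin n) :
    Q.U_psd.isHermitian.eigenvalues i = Q.σ (rank i) := by
  rw [σ, dif_pos (rank i).2]
  rfl

theorem rank_lt (i : Fin n) : (rank i : ℕ) < n := (rank i).2.trans_eq (Fintype.card_fin n)

theorem rank_surjective : Function.Surjective (rank (n := n)) := Equiv.surjective _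

theorem σ_antitone {k l : ℕ} (hkl : k ≤ l) (hl : l < n) : Q.σ l ≤ Q.σ k := by
  have hl' : l < Fintype.card (Fin n) := by simpa using hl
  rw [σ, σ, dif_pos hl', dif_pos (hkl.trans_lt hl')]
  exact Q.U_psd.isHermitian.eigenvalues₀_antitone hkl

theorem exists_rank_eq {k : ℕ} (hk : k < n) : ∃ i : Fin n, (rank i : ℕ) = k := by
  obtain ⟨i, hi⟩ := rank_surjective (n := n) ⟨k, by simpa using hk⟩
  exact ⟨i, by rw [hi]⟩

theorem U_mulVec_eq_zero_iff (v : Fin n → ℝ) :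
    Q.U.mulVec v = 0 ↔ ∃ t : ℝ, v = fun _ => t := by
  have h1 : Q.U.mulVec v = 0 ↔ v ∈ LinearMap.ker (1 - Q.W).mulVecLin := by
    rw [LinearMap.mem_ker, Matrix.mulVecLin_apply, U]
  rw [h1, Q.U_ker, Submodule.mem_span_singleton]
  constructor
  · rintro ⟨t, rfl⟩
    exact ⟨t, by ext; simp⟩
  · rintro ⟨t, rfl⟩
    exact ⟨t, by ext; simp⟩

theorem U_mulVec_basis (i : Fin n) :
    Q.U.mulVec (Q.U_psd.isHermitian.eigenvectorBasis i).ofLp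
      = Q.σ (rank i) • (Q.U_psd.isHermitian.eigenvectorBasis i).ofLp := by
  rw [← eigenvalues_eq_σ]
  exact Q.U_psd.isHermitian.mulVec_eigenvectorBasis i

theorem σ_nonneg (k : ℕ) : 0 ≤ Q.σ k := by
  by_cases hk : k < n
  · obtain ⟨i, rfl⟩ := exists_rank_eq hk
    rw [← eigenvalues_eq_σ]
    exact Q.U_psd.eigenvalues_nonneg i
  · rw [σ, dif_neg (by simpa using hk)]

/-- An eigenvector of `U` for the eigenvalue `0` is constant, so two orthonormal ones cannot
exist. -/
theorem rank_eq_of_σ_eq_zero {i j : Fin n} (hi : Q.σ (rank i) = 0) (hj : Q.σ (rank j) = 0) :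
    i = j := by
  by_contra hij
  have h1 := Q.U_mulVec_basis i
  have h2 := Q.U_mulVec_basis j
  rw [hi, zero_smul, U_mulVec_eq_zero_iff] at h1
  rw [hj, zero_smul, U_mulVec_eq_zero_iff] at h2
  obtain ⟨s, hs⟩ := h1
  obtain ⟨t, ht⟩ := h2
  have hii := Q.U_psd.isHermitian.eigenvectorBasis.inner_eq_one i
  have hjj := Q.U_psd.isHermitian.eigenvectorBasis.inner_eq_one j
  have hh := Q.U_psd.isHermitian.eigenvectorBasis.inner_eq_zero hij
  simp only [PiLp.inner_apply, hs, ht] at hii hjj hh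
  simp at hii hjj hh
  rcases hh with h | h | h
  · subst h; exact i.elim0
  · subst h; simp at hjj
  · subst h; simp at hii

theorem σ_last_eq_zero (hn : 2 ≤ n) : Q.σ (n - 1) = 0 := by
  by_contra h
  have h0 : 0 < Q.σ (n - 1) := lt_of_le_of_ne (Q.σ_nonneg _) (Ne.symm h)
  have hone : Q.U.mulVec (fun _ => (1 : ℝ)) = 0 := (Q.U_mulVec_eq_zero_iff _).2 ⟨1, rfl⟩
  have h1 := Q.U_psd.isHermitian.dotProduct_mulVec_eq_sum (fun _ => (1 : ℝ))
  have h2 := Q.U_psd.isHermitian.dotProduct_self_eq_sum (fun _ => (1 : ℝ))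
  rw [show (1 - Q.W).mulVec (fun _ => (1 : ℝ)) = 0 from hone, dotProduct_zero] at h1
  have h3 : ∀ i ∈ Finset.univ, Q.U_psd.isHermitian.eigenvalues i
      * inner ℝ (Q.U_psd.isHermitian.eigenvectorBasis i)
        (WithLp.toLp 2 (fun _ => (1 : ℝ)) : EuclideanSpace ℝ (Fin n)) ^ 2 = 0 :=
    (Finset.sum_eq_zero_iff_of_nonneg fun i _ =>
      mul_nonneg (Q.U_psd.eigenvalues_nonneg i) (sq_nonneg _)).1 h1.symm
  rw [Finset.sum_eq_zero] at h2
  · simp [dotProduct] at h2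
    omega
  · intro i hi
    have h4 := h3 i hi
    rw [eigenvalues_eq_σ] at h4
    have h5 : Q.σ (n - 1) ≤ Q.σ (rank i) := by
      have := rank_lt i
      exact Q.σ_antitone (by omega) (by omega)
    exact (mul_eq_zero.1 h4).resolve_left (by linarith)

theorem σMin_pos (hn : 2 ≤ n) : 0 < Q.σMin := by
  refine lt_of_le_of_ne (Q.σ_nonneg _) fun h => ?_
  obtain ⟨i, hi⟩ := exists_rank_eq (n := n) (k := n - 2) (by omega)
  obtain ⟨j, hj⟩ := exists_rank_eq (n := n) (k := n - 1) (by omega)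
  have := Q.rank_eq_of_σ_eq_zero (i := i) (j := j) (by rw [hi]; exact h.symm)
    (by rw [hj]; exact Q.σ_last_eq_zero hn)
  subst this
  omega

theorem σMin_le_σMax (hn : 2 ≤ n) : Q.σMin ≤ Q.σMax := Q.σ_antitone (by omega) (by omega)

theorem dotProduct_U_le (v : Fin n → ℝ) : v ⬝ᵥ Q.U.mulVec v ≤ Q.σMax * (v ⬝ᵥ v) := by
  rw [U, Q.U_psd.isHermitian.dotProduct_mulVec_eq_sum, Q.U_psd.isHermitian.dotProduct_self_eq_sum,
    Finset.mul_sum]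
  refine Finset.sum_le_sum fun i _ => mul_le_mul_of_nonneg_right ?_ (sq_nonneg _)
  rw [eigenvalues_eq_σ]
  exact Q.σ_antitone (Nat.zero_le _) (rank_lt i)

/-- On vectors orthogonal to the kernel of `U` the quadratic form is at least the smallest nonzero
eigenvalue. -/
theorem le_dotProduct_U (hn : 2 ≤ n) (v : Fin n → ℝ) (hv : ∑ i, v i = 0) :
    Q.σMin * (v ⬝ᵥ v) ≤ v ⬝ᵥ Q.U.mulVec v := by
  rw [U, Q.U_psd.isHermitian.dotProduct_mulVec_eq_sum, Q.U_psd.isHermitian.dotProduct_self_eq_sum,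
    Finset.mul_sum]
  refine Finset.sum_le_sum fun i _ => ?_
  rw [eigenvalues_eq_σ]
  have hlt := rank_lt i
  by_cases hi : (rank i : ℕ) ≤ n - 2
  · exact mul_le_mul_of_nonneg_right (Q.σ_antitone hi (by omega)) (sq_nonneg _)
  · -- the last eigenvector is constant, so its inner product with `v` vanishes
    have h0 : Q.σ (rank i) = 0 := by
      rw [show (rank i : ℕ) = n - 1 by omega]; exact Q.σ_last_eq_zero hn
    have h1 := Q.U_mulVec_basis i
    rw [h0, zero_smul, U_mulVec_eq_zero_iff] at h1
    obtain ⟨t, ht⟩ := h1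
    have h2 : inner ℝ (Q.U_psd.isHermitian.eigenvectorBasis i) (WithLp.toLp 2 v) = 0 := by
      simp only [PiLp.inner_apply, ht]
      simp [← Finset.sum_mul, hv]
    rw [h2]; simp

theorem sqrtU_mul_self : Q.sqrtU * Q.sqrtU = Q.U := by
  have h := Q.U_psd.isHermitian.spectral_theorem
  rw [U]
  conv_rhs => rw [h]
  rw [sqrtU, Matrix.IsHermitian.cfc, ← map_mul, Matrix.diagonal_mul_diagonal]
  congr 2
  ext i
  exact Real.mul_self_sqrt (Q.U_psd.eigenvalues_nonneg i)

theorem sqrtU_transpose : Q.sqrtU.transpose = Q.sqrtU := by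
  have h : star Q.sqrtU = Q.sqrtU := by
    rw [sqrtU, Matrix.IsHermitian.cfc, ← map_star]
    congr 1
    simp [Matrix.star_eq_conjTranspose]
  rwa [Matrix.star_eq_conjTranspose, Matrix.conjTranspose_eq_transpose_of_trivial] at h

theorem sqrtU_symm (i j : Fin n) : Q.sqrtU i j = Q.sqrtU j i :=
  congrFun (congrFun Q.sqrtU_transpose j) i

theorem _root_.DLAG.frobNorm_sq (A : Matrix (Fin n) (Fin n) ℝ) :
    frobNorm A ^ 2 = ∑ i, ∑ j, A i j ^ 2 :=
  Real.sq_sqrt (Finset.sum_nonneg fun _ _ => Finset.sum_nonneg fun _ _ => sq_nonneg _)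

/-- The squared Frobenius norm of `√U` is the trace of `U`. -/
theorem frobNorm_sqrtU_sq : frobNorm Q.sqrtU ^ 2 = Q.U.trace := by
  rw [frobNorm_sq, ← sqrtU_mul_self, Matrix.trace]
  refine Finset.sum_congr rfl fun i _ => ?_
  rw [Matrix.diag_apply, Matrix.mul_apply]
  refine Finset.sum_congr rfl fun j _ => ?_
  rw [Q.sqrtU_symm j i]; ring

theorem σMax_le_frobNorm_sq (hn : 2 ≤ n) : Q.σMax ≤ frobNorm Q.sqrtU ^ 2 := by
  rw [frobNorm_sqrtU_sq, U, Q.U_psd.isHermitian.trace_eq_sum_eigenvalues]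
  obtain ⟨i, hi⟩ := exists_rank_eq (n := n) (k := 0) (by omega)
  have h := Finset.single_le_sum (f := fun i => Q.U_psd.isHermitian.eigenvalues i)
    (fun i _ => Q.U_psd.eigenvalues_nonneg i) (Finset.mem_univ i)
  refine le_trans (le_of_eq ?_) h
  rw [eigenvalues_eq_σ, hi]; rfl

theorem sum_sqrtU_row (i : Fin n) : ∑ j, Q.sqrtU i j = 0 := by
  set w : Fin n → ℝ := Q.sqrtU.mulVec fun _ => 1 with hw
  have h1 : w ⬝ᵥ w = 0 := by
    have hone : Q.U.mulVec (fun _ => (1 : ℝ)) = 0 := (Q.U_mulVec_eq_zero_iff _).2 ⟨1, rfl⟩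
    rw [← sqrtU_mul_self, ← Matrix.mulVec_mulVec] at hone
    have h2 : w ⬝ᵥ w = Q.sqrtU.mulVec w ⬝ᵥ (fun _ => (1 : ℝ)) := by
      conv_lhs => rw [hw]
      rw [Matrix.dotProduct_mulVec, ← Matrix.mulVec_transpose, sqrtU_transpose]
    rw [h2, hw, hone, zero_dotProduct]
  have h2 := dotProduct_self_eq_zero.1 h1
  have h3 := congrFun h2 i
  simpa [hw, Matrix.mulVec, dotProduct] using h3

end DLAG.Problem

/-! ### Blocks -/

namespace DLAG

variable {n d : ℕ}

theorem rightMul_apply (Θ : Blk n d) (A : Matrix (Fin n) (Fin n) ℝ) (i : Fin n) :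
    rightMul Θ A i = ∑ j, A j i • Θ j := rfl

theorem rightMul_add (Θ Ξ : Blk n d) (A : Matrix (Fin n) (Fin n) ℝ) :
    rightMul (Θ + Ξ) A = rightMul Θ A + rightMul Ξ A := by
  ext1 i
  simp [rightMul_apply, Finset.sum_add_distrib]

theorem rightMul_smul (t : ℝ) (Θ : Blk n d) (A : Matrix (Fin n) (Fin n) ℝ) :
    rightMul (t • Θ) A = t • rightMul Θ A := by
  ext1 i
  simp [rightMul_apply, Finset.smul_sum, smul_comm t]

theorem rightMul_zero (A : Matrix (Fin n) (Fin n) ℝ) : rightMul (0 : Blk n d) A = 0 := by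
  ext1 i
  simp [rightMul_apply]

theorem rightMul_sub (Θ Ξ : Blk n d) (A : Matrix (Fin n) (Fin n) ℝ) :
    rightMul (Θ - Ξ) A = rightMul Θ A - rightMul Ξ A := by
  ext1 i
  simp [rightMul_apply, smul_sub]

theorem rightMul_mul (Θ : Blk n d) (A B : Matrix (Fin n) (Fin n) ℝ) :
    rightMul (rightMul Θ A) B = rightMul Θ (A * B) := by
  ext1 i
  simp only [rightMul_apply, Matrix.mul_apply, Finset.sum_smul, Finset.smul_sum, smul_smul]
  rw [Finset.sum_comm]
  simp only [mul_comm]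

theorem inner_rightMul (Θ Ξ : Blk n d) (A : Matrix (Fin n) (Fin n) ℝ) :
    inner ℝ (rightMul Θ A) Ξ = inner ℝ Θ (rightMul Ξ A.transpose) := by
  simp only [PiLp.inner_apply (𝕜 := ℝ) (f := fun _ : Fin n => Vec d), rightMul_apply, sum_inner, inner_sum, real_inner_smul_left, real_inner_smul_right,
    Matrix.transpose_apply]
  rw [Finset.sum_comm]

theorem norm_rightMul_le (Θ : Blk n d) (A : Matrix (Fin n) (Fin n) ℝ) :
    ‖rightMul Θ A‖ ≤ frobNorm A * ‖Θ‖ := by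
  refine le_of_sq_le_sq ?_ (mul_nonneg (Real.sqrt_nonneg _) (norm_nonneg _))
  rw [mul_pow, frobNorm_sq,
    PiLp.norm_sq_eq_of_L2, PiLp.norm_sq_eq_of_L2, Finset.sum_comm, Finset.sum_mul]
  refine Finset.sum_le_sum fun i _ => ?_
  rw [rightMul_apply]
  calc ‖∑ j, A j i • Θ j‖ ^ 2 ≤ (∑ j, |A j i| * ‖Θ j‖) ^ 2 := by
        gcongr
        refine (norm_sum_le _ _).trans (le_of_eq ?_)
        simp [norm_smul]
    _ ≤ (∑ j, |A j i| ^ 2) * ∑ j, ‖Θ j‖ ^ 2 := Finset.sum_mul_sq_le_sq_mul_sq _ _ _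
    _ = _ := by simp

/-- The row of a block formed by one coordinate of all columns. -/
def row (ξ : Blk n d) (a : Fin d) : Fin n → ℝ := fun i => ξ i a

theorem norm_sq_eq_sum_row (ξ : Blk n d) : ‖ξ‖ ^ 2 = ∑ a, row ξ a ⬝ᵥ row ξ a := by
  rw [PiLp.norm_sq_eq_of_L2]
  simp only [EuclideanSpace.norm_sq_eq, dotProduct, row]
  rw [Finset.sum_comm]
  simp [sq]

theorem inner_rightMul_eq_sum_row (ξ : Blk n d) (A : Matrix (Fin n) (Fin n) ℝ) :
    inner ℝ ξ (rightMul ξ A.transpose) = ∑ a, row ξ a ⬝ᵥ A.mulVec (row ξ a) := by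
  rw [PiLp.inner_apply (𝕜 := ℝ) (f := fun _ : Fin n => Vec d)]
  simp only [rightMul_apply, inner_sum, Matrix.transpose_apply, dotProduct, Matrix.mulVec, row,
    Finset.mul_sum, PiLp.inner_apply]
  symm
  rw [Finset.sum_comm]
  refine Finset.sum_congr rfl fun i _ => ?_
  rw [Finset.sum_comm]
  refine Finset.sum_congr rfl fun j _ => Finset.sum_congr rfl fun a _ => ?_
  simp
  ring

theorem MeanZero.add {ξ χ : Blk n d} (h : MeanZero ξ) (h' : MeanZero χ) : MeanZero (ξ + χ) := by
  simp only [MeanZero, PiLp.add_apply, Finset.sum_add_distrib] at *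
  rw [h, h', add_zero]

theorem MeanZero.smul {ξ : Blk n d} (h : MeanZero ξ) (t : ℝ) : MeanZero (t • ξ) := by
  simp only [MeanZero, PiLp.smul_apply, ← Finset.smul_sum] at *
  rw [h, smul_zero]

theorem MeanZero.sub {ξ χ : Blk n d} (h : MeanZero ξ) (h' : MeanZero χ) : MeanZero (ξ - χ) := by
  simp only [MeanZero, PiLp.sub_apply, Finset.sum_sub_distrib] at *
  rw [h, h', sub_zero]

theorem meanZero_zero : MeanZero (0 : Blk n d) := by simp [MeanZero]

theorem meanZero_row {ξ : Blk n d} (h : MeanZero ξ) (a : Fin d) : ∑ i, row ξ a i = 0 := by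
  have := congrArg (fun v : Vec d => v a) h
  simpa [row] using this

namespace Problem

variable {m : ℕ} (Q : Problem n m d)

theorem meanZero_rightMul_sqrtU (Θ : Blk n d) : MeanZero (rightMul Θ Q.sqrtU) := by
  simp only [MeanZero, rightMul_apply]
  rw [Finset.sum_comm]
  simp [← Finset.sum_smul, Q.sum_sqrtU_row]

theorem inner_rightMul_sqrtU (Θ Ξ : Blk n d) :
    inner ℝ (rightMul Θ Q.sqrtU) Ξ = inner ℝ Θ (rightMul Ξ Q.sqrtU) := by
  rw [inner_rightMul, sqrtU_transpose]

theorem norm_rightMul_sqrtU_sq (ξ : Blk n d) :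
    ‖rightMul ξ Q.sqrtU‖ ^ 2 = ∑ a, row ξ a ⬝ᵥ Q.U.mulVec (row ξ a) := by
  rw [← inner_rightMul_eq_sum_row, ← real_inner_self_eq_norm_sq, inner_rightMul_sqrtU, rightMul_mul,
    ← sqrtU_mul_self, Matrix.transpose_mul, sqrtU_transpose]

theorem norm_rightMul_sqrtU_sq_le (ξ : Blk n d) :
    ‖rightMul ξ Q.sqrtU‖ ^ 2 ≤ Q.σMax * ‖ξ‖ ^ 2 := by
  rw [norm_rightMul_sqrtU_sq, norm_sq_eq_sum_row, Finset.mul_sum]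
  exact Finset.sum_le_sum fun a _ => Q.dotProduct_U_le _

theorem le_norm_rightMul_sqrtU_sq (hn : 2 ≤ n) {ξ : Blk n d} (hξ : MeanZero ξ) :
    Q.σMin * ‖ξ‖ ^ 2 ≤ ‖rightMul ξ Q.sqrtU‖ ^ 2 := by
  rw [norm_rightMul_sqrtU_sq, norm_sq_eq_sum_row, Finset.mul_sum]
  exact Finset.sum_le_sum fun a _ => Q.le_dotProduct_U hn _ (meanZero_row hξ a)

end Problem

end DLAG

/-! ### The dual objective -/

namespace DLAG.Problem

variable {n m d : ℕ} (Q : Problem n m d)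

theorem μMin_le (i : Fin n) : Q.μMin ≤ Q.μ i := ciInf_le (Set.finite_range _).bddBelow i

theorem le_LMax (i : Fin n) : Q.L i ≤ Q.LMax := le_ciSup (Set.finite_range _).bddAbove i

theorem le_κMax (i : Fin n) : Q.L i / Q.μ i ≤ Q.κMax :=
  le_ciSup (f := fun i => Q.L i / Q.μ i) (Set.finite_range _).bddAbove i

theorem μMin_pos (hn : 2 ≤ n) : 0 < Q.μMin := by
  have : Nonempty (Fin n) := ⟨⟨0, by omega⟩⟩
  obtain ⟨i, hi⟩ := exists_eq_ciInf_of_finite (f := Q.μ)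
  rw [μMin, ← hi]
  exact Q.μ_pos i

theorem μ_le_L (hm : 1 ≤ m) (hd : 1 ≤ d) (i : Fin n) : Q.μ i ≤ Q.L i :=
  (Q.strong i ⟨0, hm⟩).le_of_smooth hd (Q.smooth i ⟨0, hm⟩)

theorem μMin_le_LMax (hn : 2 ≤ n) (hm : 1 ≤ m) (hd : 1 ≤ d) : Q.μMin ≤ Q.LMax :=
  ((Q.μMin_le ⟨0, by omega⟩).trans (Q.μ_le_L hm hd _)).trans (Q.le_LMax _)

theorem LMax_pos (hn : 2 ≤ n) (hm : 1 ≤ m) (hd : 1 ≤ d) : 0 < Q.LMax :=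
  (Q.μMin_pos hn).trans_le (Q.μMin_le_LMax hn hm hd)

theorem one_le_κMax (hn : 2 ≤ n) (hm : 1 ≤ m) (hd : 1 ≤ d) : 1 ≤ Q.κMax :=
  ((one_le_div (Q.μ_pos ⟨0, by omega⟩)).2 (Q.μ_le_L hm hd _)).trans (Q.le_κMax _)

theorem σMax_pos (hn : 2 ≤ n) : 0 < Q.σMax := (Q.σMin_pos hn).trans_le (Q.σMin_le_σMax hn)

theorem β_pos (hn : 2 ≤ n) : 0 < Q.β := div_pos (Q.σMax_pos hn) (Q.μMin_pos hn)

theorem α_pos (hn : 2 ≤ n) (hm : 1 ≤ m) (hd : 1 ≤ d) : 0 < Q.α :=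
  div_pos (Q.σMin_pos hn) (Q.LMax_pos hn hm hd)

/-- `κ` is the condition number of the dual objective on the mean-zero subspace. -/
theorem κ_eq (hn : 2 ≤ n) (hm : 1 ≤ m) (hd : 1 ≤ d) : Q.κ = Q.β / Q.α := by
  have := (Q.σMin_pos hn).ne'
  have := (Q.σMax_pos hn).ne'
  have := (Q.LMax_pos hn hm hd).ne'
  have := (Q.μMin_pos hn).ne'
  rw [κ, κF, ζ, β, α]
  field_simp

theorem α_le_β (hn : 2 ≤ n) (hm : 1 ≤ m) (hd : 1 ≤ d) : Q.α ≤ Q.β :=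
  div_le_div₀ (Q.σMax_pos hn).le (Q.σMin_le_σMax hn) (Q.μMin_pos hn) (Q.μMin_le_LMax hn hm hd)

theorem one_le_κ (hn : 2 ≤ n) (hm : 1 ≤ m) (hd : 1 ≤ d) : 1 ≤ Q.κ := by
  rw [Q.κ_eq hn hm hd, one_le_div (Q.α_pos hn hm hd)]
  exact Q.α_le_β hn hm hd

theorem frobNorm_pos (hn : 2 ≤ n) : 0 < frobNorm Q.sqrtU := by
  have h1 := (Q.σMax_pos hn).trans_le (Q.σMax_le_frobNorm_sq hn)
  exact lt_of_le_of_ne (Real.sqrt_nonneg _) fun h => by rw [← h] at h1; simp at h1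

theorem αβ_le_frobNorm (hn : 2 ≤ n) (hm : 1 ≤ m) (hd : 1 ≤ d) :
    Q.α * Q.β * Q.μMin ^ 2 ≤ frobNorm Q.sqrtU ^ 4 := by
  have h1 := Q.σMax_le_frobNorm_sq hn
  have hμ := Q.μMin_pos hn
  have hL := Q.LMax_pos hn hm hd
  have h2 : Q.α * Q.β * Q.μMin ^ 2 = Q.σMin * Q.σMax * (Q.μMin / Q.LMax) := by
    rw [α, β]; field_simp
  have h3 : Q.μMin / Q.LMax ≤ 1 := (div_le_one hL).2 (Q.μMin_le_LMax hn hm hd)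
  have h4 := Q.σMin_le_σMax hn
  have h5 := Q.σMin_pos hn
  have h6 := Q.σMax_pos hn
  rw [h2]
  calc Q.σMin * Q.σMax * (Q.μMin / Q.LMax) ≤ Q.σMin * Q.σMax * 1 := by gcongr
    _ ≤ (frobNorm Q.sqrtU ^ 2) * frobNorm Q.sqrtU ^ 2 := by
      rw [mul_one]
      exact mul_le_mul (h4.trans h1) h1 h6.le (sq_nonneg _)
    _ = _ := by ring

/-- The gradient of `f_i`. -/
def localGrad (i : Fin n) (θ : Vec d) : Vec d := (1 / (m : ℝ)) • ∑ j, ∇ (Q.f i j) θ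

theorem hasGradientAt_localObj (i : Fin n) (θ : Vec d) :
    HasGradientAt (Q.localObj i) (Q.localGrad i θ) θ := by
  rw [hasGradientAt_iff_hasFDerivAt, localGrad, map_smul, map_sum]
  have h : HasFDerivAt (fun θ => ∑ j, Q.f i j θ)
      (∑ j, (InnerProductSpace.toDual ℝ (Vec d)) (∇ (Q.f i j) θ)) θ :=
    HasFDerivAt.fun_sum fun j _ => ((Q.smooth i j).1 θ).hasGradientAt.hasFDerivAt
  exact h.const_mul _

theorem average_eq (hm : 1 ≤ m) (x : ℝ) : 1 / (m : ℝ) * ∑ _j : Fin m, x = x := by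
  have : (m : ℝ) ≠ 0 := by positivity
  simp
  field_simp

theorem localObj_lower (hm : 1 ≤ m) (i : Fin n) (x y : Vec d) :
    Q.localObj i x + inner ℝ (Q.localGrad i x) (y - x) + Q.μ i / 2 * ‖y - x‖ ^ 2
      ≤ Q.localObj i y := by
  rw [localObj, localObj, localGrad, real_inner_smul_left, sum_inner,
    ← average_eq hm (Q.μ i / 2 * ‖y - x‖ ^ 2), ← mul_add, ← mul_add, ← Finset.sum_add_distrib,
    ← Finset.sum_add_distrib]
  gcongr with j
  exact Q.strong i j x y

theorem localObj_upper (hm : 1 ≤ m) (i : Fin n) (x y : Vec d) :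
    Q.localObj i y ≤
      Q.localObj i x + inner ℝ (Q.localGrad i x) (y - x) + Q.L i / 2 * ‖y - x‖ ^ 2 := by
  rw [localObj, localObj, localGrad, real_inner_smul_left, sum_inner,
    ← average_eq hm (Q.L i / 2 * ‖y - x‖ ^ 2), ← mul_add, ← mul_add, ← Finset.sum_add_distrib,
    ← Finset.sum_add_distrib]
  gcongr with j
  exact (Q.smooth i j).2 x y

theorem exists_localGrad_eq (hm : 1 ≤ m) (i : Fin n) (y : Vec d) :
    ∃ p, Q.localGrad i p = y := by
  have hg : ∀ θ, ∇ (Q.localObj i) θ = Q.localGrad i θ := fun θ =>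
    (Q.hasGradientAt_localObj i θ).gradient
  obtain ⟨p, hp⟩ := StronglyConvex.exists_gradient_eq (Q.μ_pos i)
    (fun θ => (Q.hasGradientAt_localObj i θ).differentiableAt)
    (fun x y => by rw [hg]; exact Q.localObj_lower hm i x y) y
  exact ⟨p, (hg p).symm.trans hp⟩

open Classical in
/-- The point where `∇f_i` takes the value `y`, which is `∇f_i*(y)`. -/
def dualPoint (i : Fin n) (y : Vec d) : Vec d :=
  if h : ∃ p, Q.localGrad i p = y then h.choose else 0

theorem localGrad_dualPoint (hm : 1 ≤ m) (i : Fin n) (y : Vec d) :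
    Q.localGrad i (Q.dualPoint i y) = y := by
  have h := Q.exists_localGrad_eq hm i y
  rw [dualPoint, dif_pos h]
  exact h.choose_spec

theorem dualPoint_lower (hm : 1 ≤ m) (i : Fin n) (y θ : Vec d) :
    Q.localObj i (Q.dualPoint i y) + inner ℝ y (θ - Q.dualPoint i y)
      + Q.μ i / 2 * ‖θ - Q.dualPoint i y‖ ^ 2 ≤ Q.localObj i θ := by
  have := Q.localObj_lower hm i (Q.dualPoint i y) θ
  rwa [Q.localGrad_dualPoint hm] at this

theorem dualPoint_upper (hm : 1 ≤ m) (i : Fin n) (y θ : Vec d) :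
    Q.localObj i θ ≤ Q.localObj i (Q.dualPoint i y) + inner ℝ y (θ - Q.dualPoint i y)
      + Q.L i / 2 * ‖θ - Q.dualPoint i y‖ ^ 2 := by
  have := Q.localObj_upper hm i (Q.dualPoint i y) θ
  rwa [Q.localGrad_dualPoint hm] at this

theorem norm_dualPoint_sub_le (hm : 1 ≤ m) (i : Fin n) (y y' : Vec d) :
    Q.μ i * ‖Q.dualPoint i y - Q.dualPoint i y'‖ ≤ ‖y - y'‖ :=
  norm_sub_le_of_strong (Q.dualPoint_lower hm i y) (Q.dualPoint_lower hm i y')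

theorem gradient_conjugate (hm : 1 ≤ m) (i : Fin n) (y : Vec d) :
    ∇ (conjugate (Q.localObj i)) y = Q.dualPoint i y := by
  have hμ := Q.μ_pos i
  have hle : ∀ y θ, Q.localObj i (Q.dualPoint i y) + inner ℝ y (θ - Q.dualPoint i y)
      ≤ Q.localObj i θ := fun y θ =>
    le_trans (le_add_of_nonneg_right (by positivity)) (Q.dualPoint_lower hm i y θ)
  refine (hasGradientAt_of_quadratic_bounds (fun z => ?_)
    (conjugate_le_add_quadratic hμ (Q.dualPoint_lower hm i y))).gradient
  rw [conjugate_eq_of_subgradient (hle y), conjugate_eq_of_subgradient (hle z)]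
  have := hle z (Q.dualPoint i y)
  rw [inner_sub_right] at this ⊢
  rw [real_inner_comm z, real_inner_comm y]
  linarith

/-- The block `∇F*(X)`. -/
def dualBlk (X : Blk n d) : Blk n d := WithLp.toLp 2 fun i => Q.dualPoint i (X i)

theorem dualBlk_apply (X : Blk n d) (i : Fin n) : Q.dualBlk X i = Q.dualPoint i (X i) := rfl

theorem dualBlk_lower (hm : 1 ≤ m) (X Θ : Blk n d) :
    Q.F (Q.dualBlk X) + inner ℝ X (Θ - Q.dualBlk X) + Q.μMin / 2 * ‖Θ - Q.dualBlk X‖ ^ 2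
      ≤ Q.F Θ := by
  rw [F, F, PiLp.inner_apply (𝕜 := ℝ) (f := fun _ : Fin n => Vec d), PiLp.norm_sq_eq_of_L2,
    Finset.mul_sum, ← Finset.sum_add_distrib, ← Finset.sum_add_distrib]
  refine Finset.sum_le_sum fun i _ => le_trans ?_ (Q.dualPoint_lower hm i (X i) (Θ i))
  simp only [PiLp.sub_apply, dualBlk_apply]
  gcongr
  exact Q.μMin_le i

theorem dualBlk_upper (hm : 1 ≤ m) (X Θ : Blk n d) :
    Q.F Θ ≤ Q.F (Q.dualBlk X) + inner ℝ X (Θ - Q.dualBlk X)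
      + Q.LMax / 2 * ‖Θ - Q.dualBlk X‖ ^ 2 := by
  rw [F, F, PiLp.inner_apply (𝕜 := ℝ) (f := fun _ : Fin n => Vec d), PiLp.norm_sq_eq_of_L2,
    Finset.mul_sum, ← Finset.sum_add_distrib, ← Finset.sum_add_distrib]
  refine Finset.sum_le_sum fun i _ => le_trans (Q.dualPoint_upper hm i (X i) (Θ i)) ?_
  simp only [PiLp.sub_apply, dualBlk_apply]
  gcongr
  exact Q.le_LMax i

/-- The gradient of the dual objective `G`. -/
def gradG (ξ : Blk n d) : Blk n d := rightMul (Q.dualBlk (rightMul ξ Q.sqrtU)) Q.sqrtU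

theorem inner_gradG (ξ χ ψ : Blk n d) :
    inner ℝ (Q.gradG ξ) (χ - ψ) = inner ℝ (Q.dualBlk (rightMul ξ Q.sqrtU))
      (rightMul χ Q.sqrtU - rightMul ψ Q.sqrtU) := by
  rw [gradG, inner_rightMul_sqrtU, rightMul_sub]

/-- `G` is `β`-smooth. -/
theorem G_le (hn : 2 ≤ n) (hm : 1 ≤ m) (ξ χ : Blk n d) :
    Q.G χ ≤ Q.G ξ + inner ℝ (Q.gradG ξ) (χ - ξ) + Q.β / 2 * ‖χ - ξ‖ ^ 2 := by
  have hμ := Q.μMin_pos hn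
  have h1 := conjugate_le_add_quadratic hμ (Q.dualBlk_lower hm (rightMul ξ Q.sqrtU))
    (rightMul χ Q.sqrtU)
  rw [inner_gradG]
  refine h1.trans ?_
  have h2 := Q.norm_rightMul_sqrtU_sq_le (χ - ξ)
  rw [← rightMul_sub]
  have h3 : 1 / (2 * Q.μMin) * ‖rightMul (χ - ξ) Q.sqrtU‖ ^ 2 ≤ Q.β / 2 * ‖χ - ξ‖ ^ 2 := by
    calc _ ≤ 1 / (2 * Q.μMin) * (Q.σMax * ‖χ - ξ‖ ^ 2) := by gcongr
      _ = _ := by rw [β]; field_simp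
  unfold G
  linarith

theorem G_ge_quadratic (hn : 2 ≤ n) (hm : 1 ≤ m) (hd : 1 ≤ d) (ξ χ : Blk n d) :
    Q.G ξ + inner ℝ (Q.gradG ξ) (χ - ξ) + 1 / (2 * Q.LMax) * ‖rightMul (χ - ξ) Q.sqrtU‖ ^ 2
      ≤ Q.G χ := by
  have hμ := Q.μMin_pos hn
  have hle : ∀ X Θ, Q.F (Q.dualBlk X) + inner ℝ X (Θ - Q.dualBlk X) ≤ Q.F Θ := fun X Θ =>
    le_trans (le_add_of_nonneg_right (by positivity)) (Q.dualBlk_lower hm X Θ)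
  rw [inner_gradG, rightMul_sub]
  exact add_quadratic_le_conjugate (Q.LMax_pos hn hm hd) (hle _) (Q.dualBlk_upper hm _) (hle _)

/-- `G` is convex. -/
theorem G_ge (hn : 2 ≤ n) (hm : 1 ≤ m) (hd : 1 ≤ d) (ξ χ : Blk n d) :
    Q.G ξ + inner ℝ (Q.gradG ξ) (χ - ξ) ≤ Q.G χ := by
  have hL := Q.LMax_pos hn hm hd
  exact le_trans (le_add_of_nonneg_right (by positivity)) (Q.G_ge_quadratic hn hm hd ξ χ)

/-- `G` is `α`-strongly convex on the mean-zero subspace. -/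
theorem G_ge_of_meanZero (hn : 2 ≤ n) (hm : 1 ≤ m) (hd : 1 ≤ d) {ξ χ : Blk n d}
    (hξ : MeanZero ξ) (hχ : MeanZero χ) :
    Q.G ξ + inner ℝ (Q.gradG ξ) (χ - ξ) + Q.α / 2 * ‖χ - ξ‖ ^ 2 ≤ Q.G χ := by
  have hL := Q.LMax_pos hn hm hd
  refine le_trans ?_ (Q.G_ge_quadratic hn hm hd ξ χ)
  have h2 := Q.le_norm_rightMul_sqrtU_sq hn (hχ.sub hξ)
  have h3 : Q.α / 2 * ‖χ - ξ‖ ^ 2 ≤ 1 / (2 * Q.LMax) * ‖rightMul (χ - ξ) Q.sqrtU‖ ^ 2 := by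
    calc _ = 1 / (2 * Q.LMax) * (Q.σMin * ‖χ - ξ‖ ^ 2) := by rw [α]; field_simp
      _ ≤ _ := by gcongr
  linarith

theorem continuous_G (hn : 2 ≤ n) (hm : 1 ≤ m) (hd : 1 ≤ d) : Continuous Q.G :=
  continuous_of_quadratic_bounds (g := Q.gradG) (C := Q.β / 2) (Q.G_ge hn hm hd) (Q.G_le hn hm)

/-- The orthogonal projection onto the mean-zero subspace does not change `ξ√U`. -/
theorem exists_meanZero_rightMul_eq (hn : 2 ≤ n) (ξ : Blk n d) :
    ∃ χ : Blk n d, MeanZero χ ∧ rightMul χ Q.sqrtU = rightMul ξ Q.sqrtU := by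
  have hn0 : (n : ℝ) ≠ 0 := by positivity
  set b : Vec d := (n : ℝ)⁻¹ • ∑ i, ξ i
  refine ⟨ξ - WithLp.toLp 2 fun _ => b, ?_, ?_⟩
  · simp only [MeanZero, PiLp.sub_apply, Finset.sum_sub_distrib]
    simp [b, ← Nat.cast_smul_eq_nsmul ℝ, smul_smul, hn0]
  · rw [rightMul_sub, sub_eq_self]
    ext1 i
    rw [rightMul_apply]
    simp only [← Finset.sum_smul]
    rw [show ∑ j, Q.sqrtU j i = 0 by simpa only [Q.sqrtU_symm _ i] using Q.sum_sqrtU_row i]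
    simp

theorem exists_isDualMin (hn : 2 ≤ n) (hm : 1 ≤ m) (hd : 1 ≤ d) : ∃ ξ, Q.IsDualMin ξ := by
  have hclosed : IsClosed {ξ : Blk n d | MeanZero ξ} :=
    isClosed_eq (continuous_finsetSum _ fun i _ => PiLp.continuous_apply 2 _ i) continuous_const
  obtain ⟨x, hx, hmin⟩ := exists_isMinOn_of_quadratic_le hclosed (g := Q.G)
    (Q.continuous_G hn hm hd).continuousOn (x₀ := 0) (b := Q.gradG 0) meanZero_zero
    (Q.α_pos hn hm hd) (A := Q.G 0) (fun x hx => by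
      simpa using Q.G_ge_of_meanZero hn hm hd meanZero_zero hx)
  refine ⟨x, hx, fun ξ' => ?_⟩
  obtain ⟨χ, hχ, he⟩ := Q.exists_meanZero_rightMul_eq hn ξ'
  have h2 := hmin χ hχ
  rwa [G, G, he] at h2

theorem IsDualMin.gradG_eq_zero {Q : Problem n m d} (hn : 2 ≤ n) (hm : 1 ≤ m)
    {ξ : Blk n d} (h : Q.IsDualMin ξ) : Q.gradG ξ = 0 := by
  have hβ := Q.β_pos hn
  have h1 := h.2 (ξ - Q.β⁻¹ • Q.gradG ξ)
  have h2 := Q.G_le hn hm ξ (ξ - Q.β⁻¹ • Q.gradG ξ)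
  rw [sub_sub_cancel_left, inner_neg_right, norm_neg, real_inner_smul_right, norm_smul, mul_pow,
    real_inner_self_eq_norm_sq, norm_inv, Real.norm_of_nonneg hβ.le] at h2
  have h3 : Q.β / 2 * (Q.β⁻¹ ^ 2 * ‖Q.gradG ξ‖ ^ 2) = Q.β⁻¹ * ‖Q.gradG ξ‖ ^ 2 / 2 := by
    field_simp
  have h4 : Q.β⁻¹ * ‖Q.gradG ξ‖ ^ 2 ≤ 0 := by linarith
  have h5 : ‖Q.gradG ξ‖ ^ 2 ≤ 0 := by
    have : 0 < Q.β⁻¹ := inv_pos.2 hβ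
    by_contra! h6
    nlinarith [mul_pos this h6]
  exact norm_eq_zero.1 (pow_eq_zero_iff two_ne_zero |>.1 (le_antisymm h5 (sq_nonneg _)))

/-- Quadratic growth of `G` around its minimizer. -/
theorem IsDualMin.norm_sub_sq_le {Q : Problem n m d} (hn : 2 ≤ n) (hm : 1 ≤ m) (hd : 1 ≤ d)
    {ξ χ : Blk n d} (h : Q.IsDualMin ξ) (hχ : MeanZero χ) :
    Q.α / 2 * ‖χ - ξ‖ ^ 2 ≤ Q.G χ - Q.G ξ := by
  have := Q.G_ge_of_meanZero hn hm hd h.1 hχ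
  rw [h.gradG_eq_zero hn hm, inner_zero_left] at this
  linarith

end DLAG.Problem

/-! ### One step of Katyusha -/

namespace DLAG.Katyusha

variable {m d : ℕ}

/-- The smooth convex part `h_j = f_j - (μ/2) ‖·‖²` of a component. -/
def smoothPart (f : Fin m → Vec d → ℝ) (μ : ℝ) (j : Fin m) (θ : Vec d) : ℝ :=
  f j θ - μ / 2 * ‖θ‖ ^ 2

/-- The average of the smooth convex parts. -/
def meanSmooth (f : Fin m → Vec d → ℝ) (μ : ℝ) (θ : Vec d) : ℝ :=
  1 / (m : ℝ) * ∑ j, smoothPart f μ j θ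

/-- The average of the gradients of the smooth convex parts. -/
def meanGrad (f : Fin m → Vec d → ℝ) (μ : ℝ) (θ : Vec d) : Vec d :=
  (1 / (m : ℝ)) • ∑ j, hGrad f μ j θ

/-- The proximal part `ψ(θ) = (μ/2) ‖θ‖² - ⟨θ, x⟩`. -/
def proxPart (μ : ℝ) (x θ : Vec d) : ℝ := μ / 2 * ‖θ‖ ^ 2 - inner ℝ θ x

/-- The objective `(1/m) ∑_j f_j(θ) - ⟨θ, x⟩` that Katyusha minimizes. -/
def objective (f : Fin m → Vec d → ℝ) (x θ : Vec d) : ℝ :=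
  1 / (m : ℝ) * ∑ j, f j θ - inner ℝ θ x

variable {f : Fin m → Vec d → ℝ} {L μ : ℝ}

theorem objective_eq (hm : 1 ≤ m) (μ : ℝ) (x θ : Vec d) :
    objective f x θ = meanSmooth f μ θ + proxPart μ x θ := by
  have : (m : ℝ) ≠ 0 := by positivity
  simp only [objective, meanSmooth, smoothPart, proxPart, Finset.sum_sub_distrib,
    Finset.sum_const, Finset.card_univ, Fintype.card_fin, nsmul_eq_mul]
  field_simp
  ring

theorem smoothPart_lower (hc : ∀ j, StronglyConvex μ (f j)) (j : Fin m) (x y : Vec d) :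
    smoothPart f μ j x + inner ℝ (hGrad f μ j x) (y - x) ≤ smoothPart f μ j y := by
  have h := hc j x y
  rw [← real_inner_self_eq_norm_sq] at h
  simp only [smoothPart, hGrad, ← real_inner_self_eq_norm_sq, inner_sub_left, inner_sub_right,
    real_inner_smul_left] at h ⊢
  rw [real_inner_comm x y] at h
  linarith

theorem smoothPart_upper (hμ : 0 ≤ μ) (hs : ∀ j, LSmooth L (f j)) (j : Fin m) (x y : Vec d) :
    smoothPart f μ j y ≤
      smoothPart f μ j x + inner ℝ (hGrad f μ j x) (y - x) + L / 2 * ‖y - x‖ ^ 2 := by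
  have h := (hs j).2 x y
  have h2 : μ / 2 * ‖x‖ ^ 2 + μ * inner ℝ x (y - x) ≤ μ / 2 * ‖y‖ ^ 2 := by
    have h3 : 0 ≤ μ / 2 * ‖y - x‖ ^ 2 := by positivity
    simp only [← real_inner_self_eq_norm_sq, inner_sub_left, inner_sub_right] at h3 ⊢
    rw [real_inner_comm x y] at h3
    linarith
  rw [smoothPart, smoothPart, hGrad, inner_sub_left, real_inner_smul_left]
  linarith

/-- Convexity and smoothness bound the variation of the gradient by the Bregman divergence. -/
theorem norm_hGrad_sub_sq_le (hL : 0 < L) (hμ : 0 ≤ μ) (hs : ∀ j, LSmooth L (f j))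
    (hc : ∀ j, StronglyConvex μ (f j)) (j : Fin m) (x y : Vec d) :
    ‖hGrad f μ j y - hGrad f μ j x‖ ^ 2
      ≤ 2 * L * (smoothPart f μ j y - smoothPart f μ j x - inner ℝ (hGrad f μ j x) (y - x)) := by
  set g := hGrad f μ j y - hGrad f μ j x with hg
  -- a gradient step from `y` for the function `h_j - ⟨∇h_j(x), ·⟩`, which is minimal at `x`
  have h1 := smoothPart_lower hc j x (y - L⁻¹ • g)
  have h2 := smoothPart_upper hμ hs j y (y - L⁻¹ • g)
  rw [sub_sub_cancel_left, inner_neg_right, norm_neg, real_inner_smul_right, norm_smul, mul_pow,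
    norm_inv, Real.norm_of_nonneg hL.le] at h2
  rw [sub_right_comm, inner_sub_right, real_inner_smul_right] at h1
  have h3 : inner ℝ (hGrad f μ j y) g - inner ℝ (hGrad f μ j x) g = ‖g‖ ^ 2 := by
    rw [← inner_sub_left, ← hg, real_inner_self_eq_norm_sq]
  have h4 : L / 2 * (L⁻¹ ^ 2 * ‖g‖ ^ 2) = L⁻¹ * ‖g‖ ^ 2 / 2 := by field_simp
  have h5 : L⁻¹ * inner ℝ (hGrad f μ j y) g - L⁻¹ * inner ℝ (hGrad f μ j x) g
      = L⁻¹ * ‖g‖ ^ 2 := by rw [← h3]; ring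
  have h6 : L⁻¹ * ‖g‖ ^ 2 / 2
      ≤ smoothPart f μ j y - smoothPart f μ j x - inner ℝ (hGrad f μ j x) (y - x) := by linarith
  calc ‖g‖ ^ 2 = 2 * L * (L⁻¹ * ‖g‖ ^ 2 / 2) := by field_simp
    _ ≤ _ := by gcongr

theorem mean_const (hm : 1 ≤ m) (t : ℝ) : 1 / (m : ℝ) * ∑ _j : Fin m, t = t := by
  have : (m : ℝ) ≠ 0 := by positivity
  simp
  field_simp

theorem inner_meanGrad (x y : Vec d) :
    inner ℝ (meanGrad f μ x) y = 1 / (m : ℝ) * ∑ j, inner ℝ (hGrad f μ j x) y := by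
  rw [meanGrad, real_inner_smul_left, sum_inner]

theorem meanSmooth_lower (hc : ∀ j, StronglyConvex μ (f j)) (x y : Vec d) :
    meanSmooth f μ x + inner ℝ (meanGrad f μ x) (y - x) ≤ meanSmooth f μ y := by
  rw [inner_meanGrad, meanSmooth, meanSmooth, ← mul_add, ← Finset.sum_add_distrib]
  gcongr with j
  exact smoothPart_lower hc j x y

theorem meanSmooth_upper (hm : 1 ≤ m) (hμ : 0 ≤ μ) (hs : ∀ j, LSmooth L (f j)) (x y : Vec d) :
    meanSmooth f μ y ≤
      meanSmooth f μ x + inner ℝ (meanGrad f μ x) (y - x) + L / 2 * ‖y - x‖ ^ 2 := by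
  rw [inner_meanGrad, meanSmooth, meanSmooth, ← mean_const hm (L / 2 * ‖y - x‖ ^ 2), ← mul_add,
    ← mul_add, ← Finset.sum_add_distrib, ← Finset.sum_add_distrib]
  gcongr with j
  exact smoothPart_upper hμ hs j x y

/-- The proximal step in terms of distances to an arbitrary point `u`. -/
theorem prox_three_point {a : ℝ} (ha : 0 < a) (hμ : 0 ≤ μ) (x z v u : Vec d) :
    inner ℝ v (prox a μ x z v - u) + proxPart μ x (prox a μ x z v) - proxPart μ x u
      = 1 / (2 * a) * (‖z - u‖ ^ 2 - ‖prox a μ x z v - z‖ ^ 2 - ‖prox a μ x z v - u‖ ^ 2)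
        - μ / 2 * ‖prox a μ x z v - u‖ ^ 2 := by
  have hpos : 0 < 1 + a * μ := by positivity
  set p := prox a μ x z v with hp
  have hz : z = (1 + a * μ) • p + a • (v - x) := by
    rw [hp, prox, smul_smul, mul_inv_cancel₀ hpos.ne', one_smul]; abel
  clear_value p
  subst hz
  simp only [proxPart, ← real_inner_self_eq_norm_sq, inner_sub_left, inner_sub_right,
    inner_add_left, inner_add_right, real_inner_smul_left, real_inner_smul_right]
  rw [real_inner_comm u p, real_inner_comm u v, real_inner_comm u x, real_inner_comm p v,
    real_inner_comm p x, real_inner_comm v x]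
  field_simp
  ring

theorem norm_sq_convexComb_le {τ : ℝ} (h0 : 0 ≤ τ) (h1 : τ ≤ 1 / 2) (z s y : Vec d) :
    ‖τ • z + (1 / 2 : ℝ) • s + (1 / 2 - τ) • y‖ ^ 2
      ≤ τ * ‖z‖ ^ 2 + 1 / 2 * ‖s‖ ^ 2 + (1 / 2 - τ) * ‖y‖ ^ 2 := by
  have h2 : τ * ‖z‖ ^ 2 + 1 / 2 * ‖s‖ ^ 2 + (1 / 2 - τ) * ‖y‖ ^ 2
      - ‖τ • z + (1 / 2 : ℝ) • s + (1 / 2 - τ) • y‖ ^ 2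
      = τ * (1 / 2) * ‖z - s‖ ^ 2 + τ * (1 / 2 - τ) * ‖z - y‖ ^ 2
        + 1 / 2 * (1 / 2 - τ) * ‖s - y‖ ^ 2 := by
    simp only [← real_inner_self_eq_norm_sq, inner_sub_left, inner_sub_right,
      inner_add_left, inner_add_right, real_inner_smul_left, real_inner_smul_right]
    rw [real_inner_comm s z, real_inner_comm y z, real_inner_comm y s]
    ring
  have h3 : 0 ≤ 1 / 2 - τ := by linarith
  have h4 : 0 ≤ τ * (1 / 2) * ‖z - s‖ ^ 2 + τ * (1 / 2 - τ) * ‖z - y‖ ^ 2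
        + 1 / 2 * (1 / 2 - τ) * ‖s - y‖ ^ 2 := by positivity
  linarith

theorem proxPart_convexComb_le {τ : ℝ} (h0 : 0 ≤ τ) (h1 : τ ≤ 1 / 2) (hμ : 0 ≤ μ)
    (x z s y : Vec d) :
    proxPart μ x (τ • z + (1 / 2 : ℝ) • s + (1 / 2 - τ) • y)
      ≤ τ * proxPart μ x z + 1 / 2 * proxPart μ x s + (1 / 2 - τ) * proxPart μ x y := by
  have h := mul_le_mul_of_nonneg_left (norm_sq_convexComb_le h0 h1 z s y) (by positivity : 0 ≤ μ / 2)
  simp only [proxPart, inner_add_left, real_inner_smul_left]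
  linarith

theorem τ₁_pos (hm : 1 ≤ m) (hL : 0 < L) (hμ : 0 < μ) : 0 < τ₁ m L μ := by
  rw [τ₁]
  have : (0 : ℝ) < m := by positivity
  exact lt_min (Real.sqrt_pos.2 (by positivity)) (by norm_num)

theorem τ₁_le_half : τ₁ m L μ ≤ 1 / 2 := min_le_right _ _

theorem step_pos (hm : 1 ≤ m) (hL : 0 < L) (hμ : 0 < μ) : 0 < step m L μ := by
  have := τ₁_pos hm hL hμ
  rw [step]; positivity

/-- The weight `τ₁ / (2a) = (3/2) τ₁² L` of the distance to the minimizer, for the step size `a`. -/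
def distWeight (m : ℕ) (L μ : ℝ) : ℝ := 3 / 2 * τ₁ m L μ ^ 2 * L

theorem distWeight_eq (hm : 1 ≤ m) (hL : 0 < L) (hμ : 0 < μ) :
    distWeight m L μ = τ₁ m L μ * (1 / (2 * step m L μ)) := by
  have := τ₁_pos hm hL hμ
  rw [distWeight, step]
  field_simp

/-- The bound on the objective after an inner step before averaging over the sampled index. -/
theorem objective_innerStep_le (hm : 1 ≤ m) (hL : 0 < L) (hμ : 0 < μ)
    (hs : ∀ j, LSmooth L (f j)) (x u : Vec d) (t : ℕ) (i : Fin m) (st : KState d)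
    {p v : Vec d}
    (hp : p = τ₁ m L μ • st.z + (1 / 2 : ℝ) • st.snap + (1 - τ₁ m L μ - 1 / 2) • st.y)
    (hv : v = st.full + (hGrad f μ i p - hGrad f μ i st.snap)) :
    objective f x (innerStep f L μ x t i st).y
        + distWeight m L μ * (1 + step m L μ * μ) * ‖(innerStep f L μ x t i st).z - u‖ ^ 2
      ≤ meanSmooth f μ p + τ₁ m L μ * inner ℝ v (u - st.z)
        + 1 / (4 * L) * ‖meanGrad f μ p - v‖ ^ 2 + τ₁ m L μ * proxPart μ x u
        + 1 / 2 * proxPart μ x st.snap + (1 / 2 - τ₁ m L μ) * proxPart μ x st.y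
        + distWeight m L μ * ‖st.z - u‖ ^ 2 := by
  have hτ := τ₁_pos hm hL hμ
  have hτ2 : τ₁ m L μ ≤ 1 / 2 := τ₁_le_half
  have ha := step_pos hm hL hμ
  have hT := distWeight_eq hm hL hμ
  have hz : (innerStep f L μ x t i st).z = prox (step m L μ) μ x st.z v := by
    rw [hv, hp]; rfl
  have hy : (innerStep f L μ x t i st).y
      = p + τ₁ m L μ • (prox (step m L μ) μ x st.z v - st.z) := by
    rw [hv, hp]; rfl
  rw [hz, hy]
  have hprox := prox_three_point ha hμ.le x st.z v u
  set τ := τ₁ m L μ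
  set a := step m L μ
  set T := distWeight m L μ with hTdef
  set z' := prox a μ x st.z v
  have hA := meanSmooth_upper hm hμ.le hs p (p + τ • (z' - st.z))
  rw [add_sub_cancel_left, real_inner_smul_right, norm_smul, mul_pow, Real.norm_of_nonneg hτ.le]
    at hA
  -- Young's inequality, with the constant that yields the variance bound `1/(4L)`
  have hB : τ * inner ℝ (meanGrad f μ p - v) (z' - st.z)
      ≤ 1 / (4 * L) * ‖meanGrad f μ p - v‖ ^ 2 + L * τ ^ 2 * ‖z' - st.z‖ ^ 2 := by
    have h1 := mul_le_mul_of_nonneg_left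
      (real_inner_le_norm (meanGrad f μ p - v) (z' - st.z)) hτ.le
    have h2 : 0 ≤ 1 / (4 * L) * (‖meanGrad f μ p - v‖ - 2 * L * τ * ‖z' - st.z‖) ^ 2 := by
      positivity
    have h3 : 1 / (4 * L) * (‖meanGrad f μ p - v‖ - 2 * L * τ * ‖z' - st.z‖) ^ 2
        = 1 / (4 * L) * ‖meanGrad f μ p - v‖ ^ 2 + L * τ ^ 2 * ‖z' - st.z‖ ^ 2
          - τ * (‖meanGrad f μ p - v‖ * ‖z' - st.z‖) := by
      field_simp; ring
    linarith
  -- the new `y` is the convex combination of `z'`, the snapshot and the old `y`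
  have hC : proxPart μ x (p + τ • (z' - st.z))
      ≤ τ * proxPart μ x z' + 1 / 2 * proxPart μ x st.snap
        + (1 / 2 - τ) * proxPart μ x st.y := by
    have he : p + τ • (z' - st.z) = τ • z' + (1 / 2 : ℝ) • st.snap + (1 / 2 - τ) • st.y := by
      rw [hp]; module
    rw [he]
    exact proxPart_convexComb_le hτ.le hτ2 hμ.le x z' st.snap st.y
  have hT2 : T = 3 / 2 * τ ^ 2 * L := rfl
  have hTa : T * (a * μ) = τ * μ / 2 := by rw [hT]; field_simp
  rw [objective_eq hm μ]
  have hD : τ * (inner ℝ v (z' - u) + proxPart μ x z' - proxPart μ x u)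
      = T * (‖st.z - u‖ ^ 2 - ‖z' - st.z‖ ^ 2 - ‖z' - u‖ ^ 2) - T * (a * μ) * ‖z' - u‖ ^ 2 := by
    rw [hprox, hTa, hT]; ring
  have hsplit : inner ℝ v (z' - u) = inner ℝ v (z' - st.z) - inner ℝ v (u - st.z) := by
    rw [← inner_sub_right]; congr 1; abel
  rw [inner_sub_left] at hB
  rw [hsplit] at hD
  -- the two quadratic terms, `L/2` from smoothness and `L` from Young's inequality, use up `T`
  have hTz : T * ‖z' - st.z‖ ^ 2
      = L / 2 * (τ ^ 2 * ‖z' - st.z‖ ^ 2) + L * τ ^ 2 * ‖z' - st.z‖ ^ 2 := by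
    rw [hT2]; ring
  linarith

/-- The variance of the gradient estimate is controlled by the Bregman divergence between the
snapshot `s` and the current point `p`. -/
theorem mean_norm_sub_sq_le (hm : 1 ≤ m) (hL : 0 < L) (hμ : 0 < μ)
    (hs : ∀ j, LSmooth L (f j)) (hc : ∀ j, StronglyConvex μ (f j)) (p s : Vec d) :
    1 / (m : ℝ) * ∑ i, ‖meanGrad f μ p - (meanGrad f μ s + (hGrad f μ i p - hGrad f μ i s))‖ ^ 2
      ≤ 2 * L * (meanSmooth f μ s - meanSmooth f μ p - inner ℝ (meanGrad f μ p) (s - p)) := by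
  have hm0 : (m : ℝ) ≠ 0 := by positivity
  set w : Fin m → Vec d := fun i => hGrad f μ i p - hGrad f μ i s with hw
  set b : Vec d := meanGrad f μ p - meanGrad f μ s with hb
  have hsum : ∑ i, w i = (m : ℝ) • b := by
    simp only [hw, hb, meanGrad, Finset.sum_sub_distrib, smul_sub, smul_smul]
    rw [mul_one_div_cancel hm0, one_smul, one_smul]
  -- the variance is the second moment minus the squared mean
  have h1 : ∑ i, ‖meanGrad f μ p - (meanGrad f μ s + w i)‖ ^ 2
      = ∑ i, ‖w i‖ ^ 2 - m * ‖b‖ ^ 2 := by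
    have h2 : ∀ i, ‖meanGrad f μ p - (meanGrad f μ s + w i)‖ ^ 2
        = ‖b‖ ^ 2 - 2 * inner ℝ b (w i) + ‖w i‖ ^ 2 := fun i => by
      rw [← norm_sub_sq_real, hb]; congr 2; abel
    simp only [h2, Finset.sum_add_distrib, Finset.sum_sub_distrib, ← Finset.mul_sum, ← inner_sum,
      hsum, real_inner_smul_right, real_inner_self_eq_norm_sq]
    simp
    ring
  rw [h1]
  calc 1 / (m : ℝ) * (∑ i, ‖w i‖ ^ 2 - m * ‖b‖ ^ 2) ≤ 1 / (m : ℝ) * ∑ i, ‖w i‖ ^ 2 := by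
        gcongr
        have : 0 ≤ (m : ℝ) * ‖b‖ ^ 2 := by positivity
        linarith
    _ ≤ 1 / (m : ℝ) * ∑ i, 2 * L * (smoothPart f μ i s - smoothPart f μ i p
          - inner ℝ (hGrad f μ i p) (s - p)) := by
        gcongr with i
        rw [hw]
        dsimp only
        rw [norm_sub_rev]
        exact norm_hGrad_sub_sq_le hL hμ.le hs hc i p s
    _ = _ := by
        rw [inner_meanGrad, meanSmooth, meanSmooth, ← Finset.mul_sum, Finset.sum_sub_distrib,
          Finset.sum_sub_distrib]
        ring

/-- The expected progress of an inner step of Katyusha, the expectation being over the sampled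
index. -/
theorem mean_innerStep_le (hm : 1 ≤ m) (hL : 0 < L) (hμ : 0 < μ)
    (hs : ∀ j, LSmooth L (f j)) (hc : ∀ j, StronglyConvex μ (f j)) (x u : Vec d) (t : ℕ)
    (st : KState d) (hfull : st.full = meanGrad f μ st.snap) :
    1 / (m : ℝ) * ∑ i, (objective f x (innerStep f L μ x t i st).y
        + distWeight m L μ * (1 + step m L μ * μ) * ‖(innerStep f L μ x t i st).z - u‖ ^ 2)
      ≤ τ₁ m L μ * objective f x u + 1 / 2 * objective f x st.snap
        + (1 / 2 - τ₁ m L μ) * objective f x st.y + distWeight m L μ * ‖st.z - u‖ ^ 2 := by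
  have hm0 : (m : ℝ) ≠ 0 := by positivity
  have hτ := τ₁_pos hm hL hμ
  have hτ2 : τ₁ m L μ ≤ 1 / 2 := τ₁_le_half
  set p : Vec d := τ₁ m L μ • st.z + (1 / 2 : ℝ) • st.snap + (1 - τ₁ m L μ - 1 / 2) • st.y with hp
  set v : Fin m → Vec d := fun i => st.full + (hGrad f μ i p - hGrad f μ i st.snap) with hv
  -- the gradient estimate is unbiased
  have hvmean : ∑ i, v i = (m : ℝ) • meanGrad f μ p := by
    simp only [hv, hfull, Finset.sum_add_distrib, Finset.sum_sub_distrib, meanGrad,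
      Finset.sum_const, Finset.card_univ, Fintype.card_fin, smul_smul,
      ← Nat.cast_smul_eq_nsmul ℝ]
    rw [mul_one_div_cancel hm0, one_smul, one_smul]
    abel
  have h1 := fun i => objective_innerStep_le hm hL hμ hs x u t i st hp (v := v i) rfl
  have hvar := mean_norm_sub_sq_le hm hL hμ hs hc p st.snap
  rw [← hfull] at hvar
  have hvar2 : 1 / (4 * L) * (1 / (m : ℝ) * ∑ i, ‖meanGrad f μ p - v i‖ ^ 2)
      ≤ 1 / 2 * (meanSmooth f μ st.snap - meanSmooth f μ p
        - inner ℝ (meanGrad f μ p) (st.snap - p)) := by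
    calc _ ≤ 1 / (4 * L) * (2 * L * (meanSmooth f μ st.snap - meanSmooth f μ p
            - inner ℝ (meanGrad f μ p) (st.snap - p))) := by gcongr
      _ = _ := by field_simp; ring
  have h2 : 1 / (m : ℝ) * ∑ i, (objective f x (innerStep f L μ x t i st).y
        + distWeight m L μ * (1 + step m L μ * μ) * ‖(innerStep f L μ x t i st).z - u‖ ^ 2)
      ≤ meanSmooth f μ p + τ₁ m L μ * inner ℝ (meanGrad f μ p) (u - st.z)
        + 1 / (4 * L) * (1 / (m : ℝ) * ∑ i, ‖meanGrad f μ p - v i‖ ^ 2)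
        + τ₁ m L μ * proxPart μ x u
        + 1 / 2 * proxPart μ x st.snap + (1 / 2 - τ₁ m L μ) * proxPart μ x st.y
        + distWeight m L μ * ‖st.z - u‖ ^ 2 := by
    refine (mul_le_mul_of_nonneg_left (Finset.sum_le_sum fun i _ => h1 i)
      (by positivity)).trans (le_of_eq ?_)
    simp only [Finset.sum_add_distrib, ← Finset.mul_sum, ← sum_inner, hvmean,
      real_inner_smul_left]
    simp only [Finset.sum_const, Finset.card_univ, Fintype.card_fin, nsmul_eq_mul]
    field_simp
  refine h2.trans ?_
  have hu := meanSmooth_lower hc p u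
  have hy := meanSmooth_lower hc p st.y
  -- by the definition of `p`, which makes the inner products at the snapshot cancel against those
  -- in the variance bound
  have hlin : τ₁ m L μ * inner ℝ (meanGrad f μ p) (u - st.z)
      = τ₁ m L μ * inner ℝ (meanGrad f μ p) (u - p)
        + 1 / 2 * inner ℝ (meanGrad f μ p) (st.snap - p)
        + (1 / 2 - τ₁ m L μ) * inner ℝ (meanGrad f μ p) (st.y - p) := by
    simp only [← real_inner_smul_right, ← inner_add_right]
    congr 1
    rw [hp]
    module
  rw [objective_eq hm μ, objective_eq hm μ, objective_eq hm μ]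
  have hu' := mul_le_mul_of_nonneg_left hu hτ.le
  have hy' := mul_le_mul_of_nonneg_left hy (sub_nonneg.2 hτ2)
  linarith

end DLAG.Katyusha

/-! ### Functions of finitely many sampled indices -/

namespace DLAG

variable {n m : ℕ}

/-- `X` depends on the sampled indices only through the draws `(k, i, t) ∈ S`. -/
def DependsOnDraws {A : Type*} (S : Finset (ℕ × Fin n × ℕ))
    (X : (ℕ → Fin n → ℕ → Fin m) → A) : Prop :=
  ∀ u v, (∀ q ∈ S, u q.1 q.2.1 q.2.2 = v q.1 q.2.1 q.2.2) → X u = X v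

theorem DependsOnDraws.mono {A : Type*} {S T : Finset (ℕ × Fin n × ℕ)}
    {X : (ℕ → Fin n → ℕ → Fin m) → A} (h : DependsOnDraws S X) (hST : S ⊆ T) :
    DependsOnDraws T X := fun u v huv => h u v fun q hq => huv q (hST hq)

theorem DependsOnDraws.comp {A B : Type*} {S : Finset (ℕ × Fin n × ℕ)}
    {X : (ℕ → Fin n → ℕ → Fin m) → A} (h : DependsOnDraws S X) (g : A → B) :
    DependsOnDraws S (fun u => g (X u)) := fun u v huv => congrArg g (h u v huv)

theorem DependsOnDraws.comp₂ {A B C : Type*} {S : Finset (ℕ × Fin n × ℕ)}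
    {X : (ℕ → Fin n → ℕ → Fin m) → A} {Y : (ℕ → Fin n → ℕ → Fin m) → B}
    (hX : DependsOnDraws S X) (hY : DependsOnDraws S Y) (g : A → B → C) :
    DependsOnDraws S (fun u => g (X u) (Y u)) := fun u v huv =>
  congrArg₂ g (hX u v huv) (hY u v huv)

open Classical in
/-- A function of the draws in `S` factors through the restriction to `S`. -/
theorem DependsOnDraws.exists_factor {A : Type*} {S : Finset (ℕ × Fin n × ℕ)}
    {X : (ℕ → Fin n → ℕ → Fin m) → A} (hm : 1 ≤ m) (h : DependsOnDraws S X) :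
    ∃ g : (S → Fin m) → A, ∀ u, X u = g fun q => u q.1.1 q.1.2.1 q.1.2.2 := by
  refine ⟨fun w => X fun k i t => if hq : (k, i, t) ∈ S then w ⟨(k, i, t), hq⟩ else ⟨0, hm⟩,
    fun u => h _ _ fun q hq => ?_⟩
  rw [dif_pos hq]

variable {Ω : Type*} [MeasurableSpace Ω] {P : Measure Ω} [IsProbabilityMeasure P]
  {J : ℕ → Fin n → ℕ → Ω → Fin m}

theorem Sampling.integrable (hJ : Sampling P J) (hm : 1 ≤ m) {S : Finset (ℕ × Fin n × ℕ)}
    {Φ : (ℕ → Fin n → ℕ → Fin m) → ℝ} (hΦ : DependsOnDraws S Φ) :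
    Integrable (fun ω => Φ (path J ω)) P := by
  obtain ⟨g, hg⟩ := hΦ.exists_factor hm
  have hmeas : Measurable fun ω => fun q : S => J q.1.1 q.1.2.1 q.1.2.2 ω :=
    measurable_pi_lambda _ fun q => hJ.measurable _ _ _
  have h1 : Integrable g (P.map fun ω => fun q : S => J q.1.1 q.1.2.1 q.1.2.2 ω) := by
    have := Measure.isProbabilityMeasure_map (μ := P) hmeas.aemeasurable
    exact Integrable.of_finite
  have h2 := h1.comp_measurable hmeas
  refine h2.congr (Filter.Eventually.of_forall fun ω => ?_)
  simp only [Function.comp_apply, hg]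
  rfl

/-- A draw outside of the draws on which `X` depends is independent of `X`, so it may be averaged
out in an expectation. -/
theorem Sampling.integral_fresh (hJ : Sampling P J) (hm : 1 ≤ m) {S : Finset (ℕ × Fin n × ℕ)}
    {A : Type*} {X : (ℕ → Fin n → ℕ → Fin m) → A} (hX : DependsOnDraws S X)
    {k : ℕ} {i : Fin n} {t : ℕ} (hq : (k, i, t) ∉ S) (ψ : A → Fin m → ℝ) :
    ∫ ω, ψ (X (path J ω)) (path J ω k i t) ∂P
      = ∫ ω, 1 / (m : ℝ) * ∑ j, ψ (X (path J ω)) j ∂P := by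
  obtain ⟨g, hg⟩ := hX.exists_factor hm
  have hmS : Measurable fun ω => fun q : S => J q.1.1 q.1.2.1 q.1.2.2 ω :=
    measurable_pi_lambda _ fun q => hJ.measurable _ _ _
  have hindep := hJ.indep.indepFun_finset S {(k, i, t)} (by simpa using hq)
    fun q => hJ.measurable _ _ _
  -- the value at each fixed index is independent of the event that this index is drawn
  have hind : ∀ j, IndepFun (fun ω => ψ (X (path J ω)) j)
      (fun ω => if path J ω k i t = j then (1 : ℝ) else 0) P := fun j => by
    have := hindep.comp (φ := fun w => ψ (g w) j)
      (ψ := fun w : ({(k, i, t)} : Finset (ℕ × Fin n × ℕ)) → Fin m =>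
        if w ⟨(k, i, t), by simp⟩ = j then (1 : ℝ) else 0)
      (measurable_of_finite _) (measurable_of_finite _)
    convert this using 1
    · funext ω
      simp only [Function.comp_apply, hg]
      rfl
    · rfl
  have hint : ∀ j, Integrable (fun ω => ψ (X (path J ω)) j) P := fun j =>
    hJ.integrable hm (hX.comp fun a => ψ a j)
  have hmeas : ∀ j, MeasurableSet {ω | J k i t ω = j} := fun j =>
    hJ.measurable k i t (measurableSet_singleton j)
  have hint2 : ∀ j, Integrable (fun ω => if path J ω k i t = j then (1 : ℝ) else 0) P := fun j =>
    hJ.integrable hm (S := {(k, i, t)}) (Φ := fun u => if u k i t = j then (1 : ℝ) else 0)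
      fun u v huv => by
        have : u k i t = v k i t := huv (k, i, t) (by simp)
        simp only [this]
  have hunif : ∀ j, ∫ ω, (if path J ω k i t = j then (1 : ℝ) else 0) ∂P = 1 / (m : ℝ) := by
    intro j
    rw [← hJ.uniform k i t j, ← integral_indicator_one (hmeas j)]
    refine integral_congr_ae (Filter.Eventually.of_forall fun ω => ?_)
    by_cases h : J k i t ω = j <;> simp [path, h]
  have hsum : ∀ ω, ψ (X (path J ω)) (path J ω k i t)
      = ∑ j, ψ (X (path J ω)) j * (if path J ω k i t = j then (1 : ℝ) else 0) := fun ω => by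
    simp
  simp only [hsum]
  rw [integral_finsetSum _ fun j _ => ?_, integral_const_mul,
    integral_finsetSum _ fun j _ => hint j, Finset.mul_sum]
  · refine Finset.sum_congr rfl fun j _ => ?_
    rw [(hind j).integral_fun_mul_eq_mul_integral (hint j).aestronglyMeasurable
      (hint2 j).aestronglyMeasurable, hunif, mul_comm]
  · exact (hind j).integrable_mul (hint j) (hint2 j)

end DLAG

/-! ### Linear convergence of Katyusha in expectation -/

namespace DLAG.Katyusha

variable {m d : ℕ} {f : Fin m → Vec d → ℝ} {L μ : ℝ}

/-- The growth factor `1 + aμ` of the weights within an epoch, for the step size `a`. -/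
def growth (m : ℕ) (L μ : ℝ) : ℝ := 1 + step m L μ * μ

/-- The total weight of an epoch. -/
def epochWeight (m : ℕ) (L μ : ℝ) : ℝ := ∑ j ∈ Finset.range (2 * m), growth m L μ ^ j

theorem one_le_growth (hm : 1 ≤ m) (hL : 0 < L) (hμ : 0 < μ) : 1 ≤ growth m L μ := by
  have := step_pos hm hL hμ
  rw [growth]
  nlinarith

theorem two_mul_le_epochWeight (hm : 1 ≤ m) (hL : 0 < L) (hμ : 0 < μ) :
    2 * (m : ℝ) ≤ epochWeight m L μ := by
  have h := Finset.card_nsmul_le_sum (Finset.range (2 * m)) (fun j => growth m L μ ^ j) 1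
    fun j _ => one_le_pow₀ (one_le_growth hm hL hμ)
  simpa [epochWeight] using h

theorem τ₁_sq_le (hL : 0 < L) (hμ : 0 < μ) :
    τ₁ m L μ ^ 2 ≤ 2 * (m : ℝ) * μ / (3 * L) := by
  have h0 : 0 ≤ 2 * (m : ℝ) * μ / (3 * L) := by positivity
  have h1 : 0 ≤ τ₁ m L μ := le_min (Real.sqrt_nonneg _) (by norm_num)
  calc τ₁ m L μ ^ 2 ≤ Real.sqrt (2 * (m : ℝ) * μ / (3 * L)) ^ 2 :=
        pow_le_pow_left₀ h1 (min_le_left _ _) 2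
    _ = _ := Real.sq_sqrt h0

/-- By Bernoulli's inequality and the choice of `τ₁`, the weights of an epoch grow at least by
`1 + τ₁`. -/
theorem one_add_τ₁_le_growth_pow (hm : 1 ≤ m) (hL : 0 < L) (hμ : 0 < μ) :
    1 + τ₁ m L μ ≤ growth m L μ ^ (2 * m) := by
  have hτ := τ₁_pos hm hL hμ
  have ha := step_pos hm hL hμ
  have h1 := one_add_mul_le_pow (a := step m L μ * μ)
    (by nlinarith [mul_pos ha hμ]) (2 * m)
  refine le_trans ?_ h1
  have h2 := τ₁_sq_le (m := m) hL hμ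
  have h3 : ((2 * m : ℕ) : ℝ) * (step m L μ * μ)
      = 2 * (m : ℝ) * μ / (3 * L) / τ₁ m L μ := by
    rw [step]; push_cast; field_simp
  rw [h3]
  gcongr
  rw [le_div_iff₀ hτ]
  linarith [sq (τ₁ m L μ)]

theorem snap_coeff_ge (hm : 1 ≤ m) (hL : 0 < L) (hμ : 0 < μ) :
    (1 + τ₁ m L μ) / 2 ≤ 1 - (1 / 2 - τ₁ m L μ) * growth m L μ := by
  have hτ := τ₁_pos hm hL hμ
  have hm1 : (1 : ℝ) ≤ m := by exact_mod_cast hm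
  rcases le_or_gt (1 / 2) (Real.sqrt (2 * (m : ℝ) * μ / (3 * L))) with h | h
  · have : τ₁ m L μ = 1 / 2 := min_eq_right h
    rw [this]; norm_num
  · have h1 : τ₁ m L μ = Real.sqrt (2 * (m : ℝ) * μ / (3 * L)) := min_eq_left h.le
    have h2 : τ₁ m L μ ^ 2 = 2 * (m : ℝ) * μ / (3 * L) := by
      rw [h1]; exact Real.sq_sqrt (by positivity)
    have h3 : step m L μ * μ = τ₁ m L μ / (2 * m) := by
      have h4 : μ / (3 * L) = τ₁ m L μ ^ 2 / (2 * m) := by rw [h2]; field_simp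
      calc step m L μ * μ = μ / (3 * L) / τ₁ m L μ := by rw [step]; field_simp
        _ = _ := by rw [h4]; field_simp
    have h5 : τ₁ m L μ / (2 * m) ≤ τ₁ m L μ := div_le_self hτ.le (by linarith)
    have h6 : 0 ≤ τ₁ m L μ / (2 * m) := by positivity
    rw [growth, h3]
    nlinarith [mul_nonneg hτ.le h6]

/-- Summing the progress of the inner steps of an epoch with geometric weights. -/
theorem weighted_sum_le {w τ T Dt : ℝ} {D Z : ℕ → ℝ} (hw : 0 ≤ w)
    (h : ∀ j, D (j + 1) + T * w * Z (j + 1) ≤ 1 / 2 * Dt + (1 / 2 - τ) * D j + T * Z j) (M : ℕ) :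
    (1 - (1 / 2 - τ) * w) * ∑ j ∈ Finset.range M, w ^ j * D (j + 1)
        + (1 / 2 - τ) * w ^ M * D M + T * w ^ M * Z M
      ≤ 1 / 2 * Dt * ∑ j ∈ Finset.range M, w ^ j + (1 / 2 - τ) * D 0 + T * Z 0 := by
  induction M with
  | zero => simp
  | succ M ih =>
    have h1 := mul_le_mul_of_nonneg_left (h M) (pow_nonneg hw M)
    rw [Finset.sum_range_succ, Finset.sum_range_succ, pow_succ]
    nlinarith

theorem innerLoop_congr {idx idx' : ℕ → Fin m} {x : Vec d} {st : KState d} {N : ℕ}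
    (h : ∀ t < N, idx t = idx' t) :
    innerLoop f L μ x idx st N = innerLoop f L μ x idx' st N := by
  induction N with
  | zero => rfl
  | succ N ih =>
    rw [innerLoop, innerLoop, ih fun t ht => h t (by omega), h N (by omega)]

theorem run_congr {idx idx' : ℕ → Fin m} {x θ₀ : Vec d} {s : ℕ}
    (h : ∀ t < 2 * m * s, idx t = idx' t) :
    run f L μ x idx θ₀ s = run f L μ x idx' θ₀ s := by
  induction s with
  | zero => rfl
  | succ s ih =>
    have hlt : 2 * m * (s + 1) = 2 * m * s + 2 * m := by ring
    rw [run, run, ih fun t ht => h t (by omega), epoch, epoch]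
    simp only [innerLoop_congr (f := f) (L := L) (μ := μ) (x := x)
      (idx := fun j => idx (2 * m * s + j)) (idx' := fun j => idx' (2 * m * s + j)) (N := 2 * m)
      fun t ht => h (2 * m * s + t) (by omega)]

/-- The state at the start of an epoch, with the full gradient at the snapshot. -/
def epochStart (f : Fin m → Vec d → ℝ) (μ : ℝ) (st : KState d) : KState d :=
  { y := st.y
    z := st.z
    snap := st.snap
    full := meanGrad f μ st.snap
    acc := 0
    evals := st.evals + m }

variable (f L μ) in
/-- The state after `j` inner steps of epoch `s`. -/
def innerState (x : Vec d) (idx : ℕ → Fin m) (θ₀ : Vec d) (s j : ℕ) : KState d :=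
  innerLoop f L μ x (fun j => idx (2 * m * s + j)) (epochStart f μ (run f L μ x idx θ₀ s)) j

section innerState

variable (x : Vec d) (idx : ℕ → Fin m) (θ₀ : Vec d) (s : ℕ)

theorem innerState_succ (j : ℕ) :
    innerState f L μ x idx θ₀ s (j + 1)
      = innerStep f L μ x j (idx (2 * m * s + j)) (innerState f L μ x idx θ₀ s j) := rfl

theorem innerState_snap (j : ℕ) :
    (innerState f L μ x idx θ₀ s j).snap = (run f L μ x idx θ₀ s).snap := by
  induction j with
  | zero => rfl
  | succ j ih => rw [innerState_succ]; exact ih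

theorem innerState_full (j : ℕ) :
    (innerState f L μ x idx θ₀ s j).full
      = meanGrad f μ (innerState f L μ x idx θ₀ s j).snap := by
  induction j with
  | zero => rfl
  | succ j ih => rw [innerState_succ]; exact ih

theorem innerState_acc (j : ℕ) :
    (innerState f L μ x idx θ₀ s j).acc
      = ∑ l ∈ Finset.range j, growth m L μ ^ l • (innerState f L μ x idx θ₀ s (l + 1)).y := by
  induction j with
  | zero => rfl
  | succ j ih => rw [Finset.sum_range_succ, ← ih]; rfl

theorem innerState_evals (j : ℕ) :
    (innerState f L μ x idx θ₀ s j).evals = (run f L μ x idx θ₀ s).evals + m + 2 * j := by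
  induction j with
  | zero => rfl
  | succ j ih =>
    rw [innerState_succ]
    change (innerState f L μ x idx θ₀ s j).evals + 2 = _
    rw [ih]; ring

theorem run_succ_y :
    (run f L μ x idx θ₀ (s + 1)).y = (innerState f L μ x idx θ₀ s (2 * m)).y := rfl

theorem run_succ_z :
    (run f L μ x idx θ₀ (s + 1)).z = (innerState f L μ x idx θ₀ s (2 * m)).z := rfl

theorem run_succ_snap :
    (run f L μ x idx θ₀ (s + 1)).snap
      = (epochWeight m L μ)⁻¹ • (innerState f L μ x idx θ₀ s (2 * m)).acc := rfl

/-- An epoch takes `5m` gradients of single functions. -/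
theorem run_evals : (run f L μ x idx θ₀ s).evals = 5 * m * s := by
  induction s with
  | zero => rfl
  | succ s ih =>
    change (innerState f L μ x idx θ₀ s (2 * m)).evals = _
    rw [innerState_evals, ih]; ring

theorem innerState_congr {x θ₀ : Vec d} {idx idx' : ℕ → Fin m} {s j : ℕ}
    (h : ∀ t < 2 * m * s + j, idx t = idx' t) :
    innerState f L μ x idx θ₀ s j = innerState f L μ x idx' θ₀ s j := by
  rw [innerState, innerState, run_congr fun t ht => h t (by omega)]
  exact innerLoop_congr fun t ht => h _ (by omega)

end innerState

theorem exists_objective_subgradient (hm : 1 ≤ m) (hμ : 0 < μ)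
    (hc : ∀ j, StronglyConvex μ (f j)) (x p : Vec d) :
    ∃ g : Vec d, ∀ θ, objective f x p + inner ℝ g (θ - p) ≤ objective f x θ := by
  refine ⟨meanGrad f μ p + μ • p - x, fun θ => ?_⟩
  rw [objective_eq hm μ, objective_eq hm μ]
  have h1 := meanSmooth_lower hc p θ
  have h2 : proxPart μ x p + inner ℝ (μ • p - x) (θ - p) ≤ proxPart μ x θ := by
    have h3 : 0 ≤ μ / 2 * ‖θ - p‖ ^ 2 := by positivity
    simp only [proxPart, ← real_inner_self_eq_norm_sq, inner_sub_left, inner_sub_right,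
      real_inner_smul_left] at h3 ⊢
    rw [real_inner_comm p θ] at h3
    rw [real_inner_comm θ x, real_inner_comm p x]
    linarith
  have h3 : inner ℝ (meanGrad f μ p + μ • p - x) (θ - p)
      = inner ℝ (meanGrad f μ p) (θ - p) + inner ℝ (μ • p - x) (θ - p) := by
    rw [← inner_add_left]; congr 1; abel
  linarith

/-- Jensen's inequality for the snapshot of the next epoch. -/
theorem epochWeight_mul_objective_le (hm : 1 ≤ m) (hL : 0 < L) (hμ : 0 < μ)
    (hc : ∀ j, StronglyConvex μ (f j)) (x : Vec d) (idx : ℕ → Fin m) (θ₀ : Vec d) (s : ℕ)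
    (b : ℝ) :
    epochWeight m L μ * (objective f x (run f L μ x idx θ₀ (s + 1)).snap - b)
      ≤ ∑ j ∈ Finset.range (2 * m), growth m L μ ^ j
          * (objective f x (innerState f L μ x idx θ₀ s (j + 1)).y - b) := by
  have hW : 0 < epochWeight m L μ :=
    lt_of_lt_of_le (by positivity) (two_mul_le_epochWeight hm hL hμ)
  have hg1 := one_le_growth hm hL hμ
  set p := (run f L μ x idx θ₀ (s + 1)).snap with hp
  obtain ⟨g, hg⟩ := exists_objective_subgradient hm hμ hc x p
  have hsum : ∑ j ∈ Finset.range (2 * m),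
      growth m L μ ^ j • (innerState f L μ x idx θ₀ s (j + 1)).y = epochWeight m L μ • p := by
    rw [← innerState_acc, hp, run_succ_snap, smul_smul, mul_inv_cancel₀ hW.ne', one_smul]
  have h0 : ∑ j ∈ Finset.range (2 * m), growth m L μ ^ j
      * inner ℝ g ((innerState f L μ x idx θ₀ s (j + 1)).y - p) = 0 := by
    simp only [← real_inner_smul_right, ← inner_sum, smul_sub, Finset.sum_sub_distrib, hsum,
      ← Finset.sum_smul]
    rw [← epochWeight, sub_self, inner_zero_right]
  calc epochWeight m L μ * (objective f x p - b)
      = ∑ j ∈ Finset.range (2 * m), growth m L μ ^ j * (objective f x p - b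
          + inner ℝ g ((innerState f L μ x idx θ₀ s (j + 1)).y - p)) := by
        simp only [mul_add, Finset.sum_add_distrib, h0, add_zero, ← Finset.sum_mul]
        rfl
    _ ≤ _ := by
        refine Finset.sum_le_sum fun j _ => mul_le_mul_of_nonneg_left ?_ (by positivity)
        linarith [hg (innerState f L μ x idx θ₀ s (j + 1)).y]

theorem integral_linComb {Ω : Type*} [MeasurableSpace Ω] {P : Measure Ω} {X Y Z : Ω → ℝ}
    (hX : Integrable X P) (hY : Integrable Y P) (hZ : Integrable Z P) (a b c : ℝ) :
    ∫ ω, (a * X ω + b * Y ω + c * Z ω) ∂P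
      = a * ∫ ω, X ω ∂P + b * ∫ ω, Y ω ∂P + c * ∫ ω, Z ω ∂P := by
  have h1 : Integrable (fun ω => a * X ω + b * Y ω) P := (hX.const_mul a).add (hY.const_mul b)
  rw [integral_add h1 (hZ.const_mul c), integral_add (hX.const_mul a) (hY.const_mul b),
    integral_const_mul, integral_const_mul, integral_const_mul]

section Expectation

variable {n : ℕ} {Ω : Type*} [MeasurableSpace Ω] {P : Measure Ω} [IsProbabilityMeasure P]
  {J : ℕ → Fin n → ℕ → Ω → Fin m}

/-- The draws in `S` together with the first `N` draws of worker `i` at iteration `k`. -/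
def extendDraws (S : Finset (ℕ × Fin n × ℕ)) (k : ℕ) (i : Fin n) (N : ℕ) :
    Finset (ℕ × Fin n × ℕ) :=
  S ∪ (Finset.range N).image fun t => (k, i, t)

theorem mem_extendDraws {S : Finset (ℕ × Fin n × ℕ)} {k : ℕ} {i : Fin n} {N t : ℕ}
    (ht : t < N) : (k, i, t) ∈ extendDraws S k i N :=
  Finset.mem_union_right _ (Finset.mem_image_of_mem _ (Finset.mem_range.2 ht))

theorem notMem_extendDraws {S : Finset (ℕ × Fin n × ℕ)} {k : ℕ} {i : Fin n} {N : ℕ}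
    (h : ∀ t, (k, i, t) ∉ S) : (k, i, N) ∉ extendDraws S k i N := by
  simp [extendDraws, h]

variable {S : Finset (ℕ × Fin n × ℕ)} {k : ℕ} {i : Fin n}
  {x θ₀ : (ℕ → Fin n → ℕ → Fin m) → Vec d}

theorem dependsOnDraws_innerState (hx : DependsOnDraws S x) (hθ : DependsOnDraws S θ₀)
    (s j : ℕ) : DependsOnDraws (extendDraws S k i (2 * m * s + j))
      fun u => (x u, innerState f L μ (x u) (u k i) (θ₀ u) s j) := by
  intro u v huv
  have h1 := hx u v fun q hq => huv q (Finset.mem_union_left _ hq)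
  have h2 := hθ u v fun q hq => huv q (Finset.mem_union_left _ hq)
  simp only [h1, h2]
  congr 1
  exact innerState_congr fun t ht => huv _ (mem_extendDraws ht)

theorem dependsOnDraws_run (hx : DependsOnDraws S x) (hθ : DependsOnDraws S θ₀)
    (s : ℕ) : DependsOnDraws (extendDraws S k i (2 * m * s))
      fun u => (x u, run f L μ (x u) (u k i) (θ₀ u) s) := by
  intro u v huv
  have h1 := hx u v fun q hq => huv q (Finset.mem_union_left _ hq)
  have h2 := hθ u v fun q hq => huv q (Finset.mem_union_left _ hq)
  simp only [h1, h2]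
  congr 1
  exact run_congr fun t ht => huv _ (mem_extendDraws ht)

/-- The potential of a state of Katyusha: suboptimality at the snapshot and at `y`, and the
squared distance of `z` to the minimizer `p`. -/
def potential (f : Fin m → Vec d → ℝ) (L μ : ℝ) (x p : Vec d) (st : KState d) : ℝ :=
  1 / 2 * epochWeight m L μ * (objective f x st.snap - objective f x p)
    + (1 / 2 - τ₁ m L μ) * (objective f x st.y - objective f x p)
    + distWeight m L μ * ‖st.z - p‖ ^ 2

variable {opt : Vec d → Vec d}

theorem integral_innerState_succ_le (hJ : Sampling P J) (hm : 1 ≤ m) (hL : 0 < L) (hμ : 0 < μ)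
    (hs : ∀ j, LSmooth L (f j)) (hc : ∀ j, StronglyConvex μ (f j))
    (hS : ∀ t, (k, i, t) ∉ S) (hx : DependsOnDraws S x) (hθ : DependsOnDraws S θ₀) (s j : ℕ) :
    ∫ ω, (fun u => objective f (x u) (innerState f L μ (x u) (u k i) (θ₀ u) s (j + 1)).y
          - objective f (x u) (opt (x u))
          + distWeight m L μ * growth m L μ
            * ‖(innerState f L μ (x u) (u k i) (θ₀ u) s (j + 1)).z - opt (x u)‖ ^ 2) (path J ω) ∂P
      ≤ ∫ ω, (fun u => 1 / 2 * (objective f (x u) (run f L μ (x u) (u k i) (θ₀ u) s).snap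
            - objective f (x u) (opt (x u)))
          + (1 / 2 - τ₁ m L μ)
            * (objective f (x u) (innerState f L μ (x u) (u k i) (θ₀ u) s j).y
              - objective f (x u) (opt (x u)))
          + distWeight m L μ
            * ‖(innerState f L μ (x u) (u k i) (θ₀ u) s j).z - opt (x u)‖ ^ 2) (path J ω) ∂P := by
  have hdep := dependsOnDraws_innerState (f := f) (L := L) (μ := μ) (k := k) (i := i) hx hθ s j
  have hfresh := hJ.integral_fresh hm hdep (notMem_extendDraws hS)
    (fun a l => objective f a.1 (innerStep f L μ a.1 j l a.2).y - objective f a.1 (opt a.1)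
      + distWeight m L μ * growth m L μ * ‖(innerStep f L μ a.1 j l a.2).z - opt a.1‖ ^ 2)
  simp only [innerState_succ]
  refine hfresh.trans_le (integral_mono ?_ ?_ fun ω => ?_)
  · exact hJ.integrable hm (hdep.comp fun a => 1 / (m : ℝ) * ∑ l,
      (objective f a.1 (innerStep f L μ a.1 j l a.2).y - objective f a.1 (opt a.1)
      + distWeight m L μ * growth m L μ * ‖(innerStep f L μ a.1 j l a.2).z - opt a.1‖ ^ 2))
  · simp only [← innerState_snap (f := f) (L := L) (μ := μ) _ _ _ s j]
    exact hJ.integrable hm (hdep.comp fun a =>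
      1 / 2 * (objective f a.1 a.2.snap - objective f a.1 (opt a.1))
      + (1 / 2 - τ₁ m L μ) * (objective f a.1 a.2.y - objective f a.1 (opt a.1))
      + distWeight m L μ * ‖a.2.z - opt a.1‖ ^ 2)
  · set u := path J ω
    have h1 := mean_innerStep_le hm hL hμ hs hc (x u) (opt (x u)) j
      (innerState f L μ (x u) (u k i) (θ₀ u) s j) (innerState_full _ _ _ _ _)
    rw [innerState_snap] at h1
    have h2 := Katyusha.mean_const hm (objective f (x u) (opt (x u)))
    dsimp only
    have h3 : ∀ t : Fin m → ℝ, 1 / (m : ℝ) * ∑ l, (t l - objective f (x u) (opt (x u)))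
        = 1 / (m : ℝ) * ∑ l, t l - objective f (x u) (opt (x u)) := fun t => by
      rw [Finset.sum_sub_distrib, mul_sub, h2]
    simp only [sub_add_eq_add_sub]
    rw [h3]
    rw [growth]
    linarith

/-- An epoch contracts the expected potential by the factor `1 / (1 + τ₁)`. -/
theorem integral_potential_succ_le (hJ : Sampling P J) (hm : 1 ≤ m) (hL : 0 < L) (hμ : 0 < μ)
    (hs : ∀ j, LSmooth L (f j)) (hc : ∀ j, StronglyConvex μ (f j))
    (hS : ∀ t, (k, i, t) ∉ S) (hx : DependsOnDraws S x) (hθ : DependsOnDraws S θ₀)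
    (hopt : ∀ x θ, objective f x (opt x) ≤ objective f x θ) (s : ℕ) :
    (1 + τ₁ m L μ) * ∫ ω, (fun u => potential f L μ (x u) (opt (x u))
        (run f L μ (x u) (u k i) (θ₀ u) (s + 1))) (path J ω) ∂P
      ≤ ∫ ω, (fun u => potential f L μ (x u) (opt (x u))
        (run f L μ (x u) (u k i) (θ₀ u) s)) (path J ω) ∂P := by
  have hτ := τ₁_pos hm hL hμ
  have hτ2 : τ₁ m L μ ≤ 1 / 2 := τ₁_le_half
  have hT : 0 ≤ distWeight m L μ := by rw [distWeight]; positivity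
  have hw := one_le_growth hm hL hμ
  have hW : 0 < epochWeight m L μ :=
    lt_of_lt_of_le (by positivity) (two_mul_le_epochWeight hm hL hμ)
  have hdepI := fun j =>
    dependsOnDraws_innerState (f := f) (L := L) (μ := μ) (k := k) (i := i) hx hθ s j
  have hdepR := fun s =>
    dependsOnDraws_run (f := f) (L := L) (μ := μ) (k := k) (i := i) hx hθ s
  -- expected suboptimalities and squared distances along the epoch
  set Dt : ℕ → ℝ := fun s => ∫ ω, (fun u =>
    objective f (x u) (run f L μ (x u) (u k i) (θ₀ u) s).snap
      - objective f (x u) (opt (x u))) (path J ω) ∂P with hDt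
  set D : ℕ → ℝ := fun j => ∫ ω, (fun u =>
    objective f (x u) (innerState f L μ (x u) (u k i) (θ₀ u) s j).y
      - objective f (x u) (opt (x u))) (path J ω) ∂P with hD
  set Z : ℕ → ℝ := fun j => ∫ ω, (fun u =>
    ‖(innerState f L μ (x u) (u k i) (θ₀ u) s j).z - opt (x u)‖ ^ 2) (path J ω) ∂P with hZ
  have iDt : ∀ s, Integrable (fun ω => (fun u =>
      objective f (x u) (run f L μ (x u) (u k i) (θ₀ u) s).snap
      - objective f (x u) (opt (x u))) (path J ω)) P := fun s =>
    hJ.integrable hm ((hdepR s).comp fun a => objective f a.1 a.2.snap - objective f a.1 (opt a.1))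
  have iD : ∀ j, Integrable (fun ω => (fun u =>
      objective f (x u) (innerState f L μ (x u) (u k i) (θ₀ u) s j).y
      - objective f (x u) (opt (x u))) (path J ω)) P := fun j =>
    hJ.integrable hm ((hdepI j).comp fun a => objective f a.1 a.2.y - objective f a.1 (opt a.1))
  have iZ : ∀ j, Integrable (fun ω => (fun u =>
      ‖(innerState f L μ (x u) (u k i) (θ₀ u) s j).z - opt (x u)‖ ^ 2) (path J ω)) P := fun j =>
    hJ.integrable hm ((hdepI j).comp fun a => ‖a.2.z - opt a.1‖ ^ 2)
  have hstep : ∀ j, D (j + 1) + distWeight m L μ * growth m L μ * Z (j + 1)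
      ≤ 1 / 2 * Dt s + (1 / 2 - τ₁ m L μ) * D j + distWeight m L μ * Z j := fun j => by
    have h := integral_innerState_succ_le (opt := opt) hJ hm hL hμ hs hc hS hx hθ s j
    rw [integral_add (iD (j + 1)) ((iZ (j + 1)).const_mul _), integral_const_mul] at h
    exact h.trans_eq (integral_linComb (iDt s) (iD j) (iZ j) _ _ _)
  have hsum := weighted_sum_le (by linarith) hstep (2 * m)
  have hD0 : ∀ j, 0 ≤ D j := fun j => integral_nonneg fun ω => sub_nonneg.2 (hopt _ _)
  have hDt0 : ∀ j, 0 ≤ Dt j := fun j => integral_nonneg fun ω => sub_nonneg.2 (hopt _ _)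
  have hZ0 : ∀ j, 0 ≤ Z j := fun j => integral_nonneg fun ω => sq_nonneg _
  have hjensen : epochWeight m L μ * Dt (s + 1)
      ≤ ∑ j ∈ Finset.range (2 * m), growth m L μ ^ j * D (j + 1) := by
    simp only [hDt, hD, ← integral_const_mul]
    rw [← integral_finsetSum _ fun j _ => (iD (j + 1)).const_mul _]
    exact integral_mono ((iDt (s + 1)).const_mul _)
      (integrable_finsetSum _ fun j _ => (iD (j + 1)).const_mul _)
      fun ω => epochWeight_mul_objective_le hm hL hμ hc _ _ _ _ _
  have hpot1 : ∫ ω, (fun u => potential f L μ (x u) (opt (x u))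
        (run f L μ (x u) (u k i) (θ₀ u) (s + 1))) (path J ω) ∂P
      = 1 / 2 * epochWeight m L μ * Dt (s + 1) + (1 / 2 - τ₁ m L μ) * D (2 * m)
        + distWeight m L μ * Z (2 * m) := by
    simp only [potential, run_succ_y, run_succ_z]
    exact integral_linComb (iDt (s + 1)) (iD (2 * m)) (iZ (2 * m)) _ _ _
  have hpot0 : ∫ ω, (fun u => potential f L μ (x u) (opt (x u))
        (run f L μ (x u) (u k i) (θ₀ u) s)) (path J ω) ∂P
      = 1 / 2 * epochWeight m L μ * Dt s + (1 / 2 - τ₁ m L μ) * D 0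
        + distWeight m L μ * Z 0 := by
    simp only [potential]
    exact integral_linComb (iDt s) (iD 0) (iZ 0) _ _ _
  rw [hpot1, hpot0]
  -- the three parts of the potential gain the factor `1 + τ₁` separately
  have hc1 := snap_coeff_ge hm hL hμ
  have hg := one_add_τ₁_le_growth_pow hm hL hμ
  have e1 : (1 + τ₁ m L μ) / 2 * (epochWeight m L μ * Dt (s + 1))
      ≤ (1 - (1 / 2 - τ₁ m L μ) * growth m L μ)
        * ∑ j ∈ Finset.range (2 * m), growth m L μ ^ j * D (j + 1) :=
    mul_le_mul hc1 hjensen (mul_nonneg hW.le (hDt0 _)) (by linarith)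
  have e2 : (1 + τ₁ m L μ) * ((1 / 2 - τ₁ m L μ) * D (2 * m))
      ≤ growth m L μ ^ (2 * m) * ((1 / 2 - τ₁ m L μ) * D (2 * m)) :=
    mul_le_mul_of_nonneg_right hg (mul_nonneg (by linarith) (hD0 _))
  have e3 : (1 + τ₁ m L μ) * (distWeight m L μ * Z (2 * m))
      ≤ growth m L μ ^ (2 * m) * (distWeight m L μ * Z (2 * m)) :=
    mul_le_mul_of_nonneg_right hg (mul_nonneg hT (hZ0 _))
  rw [← epochWeight] at hsum
  linarith

/-- Linear convergence of the snapshots of Katyusha in expectation. -/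
theorem integral_run_snap_le (hJ : Sampling P J) (hm : 1 ≤ m) (hL : 0 < L) (hμ : 0 < μ)
    (hs : ∀ j, LSmooth L (f j)) (hc : ∀ j, StronglyConvex μ (f j))
    (hS : ∀ t, (k, i, t) ∉ S) (hx : DependsOnDraws S x) (hθ : DependsOnDraws S θ₀)
    (hlow : ∀ x θ, objective f x (opt x) + μ / 2 * ‖θ - opt x‖ ^ 2 ≤ objective f x θ)
    (hup : ∀ x θ, objective f x θ ≤ objective f x (opt x) + L / 2 * ‖θ - opt x‖ ^ 2) (s : ℕ) :
    ∫ ω, (fun u => ‖(run f L μ (x u) (u k i) (θ₀ u) s).snap - opt (x u)‖ ^ 2) (path J ω) ∂P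
      ≤ 9 / 4 * (L / μ) * ((1 + τ₁ m L μ) ^ s)⁻¹
        * ∫ ω, (fun u => ‖θ₀ u - opt (x u)‖ ^ 2) (path J ω) ∂P := by
  have hτ := τ₁_pos hm hL hμ
  have hτ2 : τ₁ m L μ ≤ 1 / 2 := τ₁_le_half
  have hW2 := two_mul_le_epochWeight hm hL hμ
  have hm1 : (1 : ℝ) ≤ m := by exact_mod_cast hm
  have hW : 0 < epochWeight m L μ := by linarith
  have hopt : ∀ x θ, objective f x (opt x) ≤ objective f x θ := fun x θ =>
    le_trans (le_add_of_nonneg_right (by positivity)) (hlow x θ)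
  have hdepR := fun s =>
    dependsOnDraws_run (f := f) (L := L) (μ := μ) (k := k) (i := i) hx hθ s
  set Φ : ℕ → ℝ := fun s => ∫ ω, (fun u => potential f L μ (x u) (opt (x u))
        (run f L μ (x u) (u k i) (θ₀ u) s)) (path J ω) ∂P with hΦ
  have iΦ : ∀ s, Integrable (fun ω => (fun u => potential f L μ (x u) (opt (x u))
        (run f L μ (x u) (u k i) (θ₀ u) s)) (path J ω)) P := fun s =>
    hJ.integrable hm ((hdepR s).comp fun a => potential f L μ a.1 (opt a.1) a.2)
  have hT : 0 ≤ distWeight m L μ := by rw [distWeight]; positivity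
  have hT2 : distWeight m L μ ≤ 3 / 8 * L := by
    have : τ₁ m L μ ^ 2 ≤ (1 / 2) ^ 2 := pow_le_pow_left₀ hτ.le hτ2 2
    rw [distWeight]; nlinarith
  have hpow : ∀ s, (1 + τ₁ m L μ) ^ s * Φ s ≤ Φ 0 := fun s => by
    induction s with
    | zero => simp
    | succ s ih =>
      have h1 := integral_potential_succ_le hJ hm hL hμ hs hc hS hx hθ hopt s
      refine le_trans ?_ ih
      rw [pow_succ, mul_assoc]
      exact mul_le_mul_of_nonneg_left h1 (by positivity)
  have iA : Integrable (fun ω => (fun u =>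
      ‖(run f L μ (x u) (u k i) (θ₀ u) s).snap - opt (x u)‖ ^ 2) (path J ω)) P :=
    hJ.integrable hm ((hdepR s).comp fun a => ‖a.2.snap - opt a.1‖ ^ 2)
  have iB : Integrable (fun ω => (fun u => ‖θ₀ u - opt (x u)‖ ^ 2) (path J ω)) P :=
    hJ.integrable hm (hθ.comp₂ hx fun a b => ‖a - opt b‖ ^ 2)
  set A := ∫ ω, (fun u => ‖(run f L μ (x u) (u k i) (θ₀ u) s).snap - opt (x u)‖ ^ 2)
    (path J ω) ∂P
  set B := ∫ ω, (fun u => ‖θ₀ u - opt (x u)‖ ^ 2) (path J ω) ∂P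
  have hB0 : 0 ≤ B := integral_nonneg fun ω => sq_nonneg _
  -- strong convexity bounds the potential from below, smoothness bounds it from above at the start
  have hlower : epochWeight m L μ * μ / 4 * A ≤ Φ s := by
    rw [← integral_const_mul]
    refine integral_mono (iA.const_mul _) (iΦ s) fun ω => ?_
    set u := path J ω
    dsimp only [potential]
    have h1 := hlow (x u) (run f L μ (x u) (u k i) (θ₀ u) s).snap
    have h2 := hopt (x u) (run f L μ (x u) (u k i) (θ₀ u) s).y
    have h3 := mul_nonneg (sub_nonneg.2 hτ2) (sub_nonneg.2 h2)
    have h4 : 0 ≤ distWeight m L μ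
        * ‖(run f L μ (x u) (u k i) (θ₀ u) s).z - opt (x u)‖ ^ 2 := by positivity
    nlinarith
  have hupper : Φ 0 ≤ epochWeight m L μ * (9 / 16 * L) * B := by
    rw [← integral_const_mul]
    refine integral_mono (iΦ 0) (iB.const_mul _) fun ω => ?_
    set u := path J ω
    have h1 := hup (x u) (θ₀ u)
    have h2 := hopt (x u) (θ₀ u)
    change potential f L μ (x u) (opt (x u)) ⟨θ₀ u, θ₀ u, θ₀ u, 0, 0, 0⟩
      ≤ epochWeight m L μ * (9 / 16 * L) * ‖θ₀ u - opt (x u)‖ ^ 2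
    dsimp only [potential]
    set q := ‖θ₀ u - opt (x u)‖ ^ 2 with hq
    have hq0 : 0 ≤ q := sq_nonneg _
    set g := objective f (x u) (θ₀ u) - objective f (x u) (opt (x u))
    have hg : g ≤ L / 2 * q := by linarith
    have hg0 : 0 ≤ g := by linarith
    have h3 : (1 / 2 - τ₁ m L μ) * g ≤ 1 / 2 * (L / 2 * q) :=
      mul_le_mul (by linarith) hg hg0 (by norm_num)
    have h4 : 1 / 2 * epochWeight m L μ * g ≤ 1 / 2 * epochWeight m L μ * (L / 2 * q) := by gcongr
    have h5 : distWeight m L μ * q ≤ 3 / 8 * L * q := by gcongr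
    have h6 : 0 ≤ (epochWeight m L μ - 2) * (L * q) :=
      mul_nonneg (by linarith) (by positivity)
    linarith
  have hP : 0 < (1 + τ₁ m L μ) ^ s := by positivity
  have h1 := (mul_le_mul_of_nonneg_left hlower hP.le).trans ((hpow s).trans hupper)
  have h2 : A = 4 / (epochWeight m L μ * μ) * ((1 + τ₁ m L μ) ^ s)⁻¹
      * ((1 + τ₁ m L μ) ^ s * (epochWeight m L μ * μ / 4 * A)) := by field_simp
  rw [h2]
  calc _ ≤ 4 / (epochWeight m L μ * μ) * ((1 + τ₁ m L μ) ^ s)⁻¹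
        * (epochWeight m L μ * (9 / 16 * L) * B) := by gcongr
    _ = _ := by field_simp; ring

end Expectation

end DLAG.Katyusha

/-! ### One accelerated gradient step with an inexact gradient -/

namespace DLAG

section Accelerated

variable {E : Type*} [NormedAddCommGroup E] [InnerProductSpace ℝ E]

/-- Young's inequality for inner products. -/
theorem abs_two_mul_inner_le (x y : E) {t : ℝ} (ht : 0 < t) :
    |2 * inner ℝ x y| ≤ t * ‖y‖ ^ 2 + t⁻¹ * ‖x‖ ^ 2 := by
  rw [abs_mul, abs_two]
  have h1 := abs_real_inner_le_norm x y
  have h2 : 0 ≤ t * (‖y‖ - t⁻¹ * ‖x‖) ^ 2 := by positivity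
  have h3 : t * (‖y‖ - t⁻¹ * ‖x‖) ^ 2
      = t * ‖y‖ ^ 2 + t⁻¹ * ‖x‖ ^ 2 - 2 * (‖x‖ * ‖y‖) := by
    field_simp; ring
  linarith

theorem norm_sub_sq_le_two_mul (x y : E) : ‖x - y‖ ^ 2 ≤ 2 * ‖x‖ ^ 2 + 2 * ‖y‖ ^ 2 := by
  have := parallelogram_law_with_norm ℝ x y
  nlinarith [sq_nonneg ‖x + y‖]

/-- The estimate for `a = ξ - ξ*`, `b = ξ - λ`, the inexact gradient `h` and its error `e`: the
three error terms are absorbed by the negative terms, which also pay for the step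
`ξ⁺ - ξ = ((τ - 1) b - 2τη h) / (τ + 1)` with the weight `K`. -/
theorem accelerated_error_le (a b h e : E) {τ η α β ρ R A K : ℝ} (hτ : 1 < τ) (hη : 0 < η)
    (hα : 0 < α) (hβ : 0 < β) (hR : 0 < R) (hA : 0 ≤ A) (hρ : 0 < ρ)
    (h1 : τ ^ 2 * η * α * (1 + R) = ρ) (h2 : η * β * (1 + 24 * A * ρ) = R / (1 + R))
    (hK : K ≤ 3 * ρ * τ * η * β * A) :
    K * ‖(τ + 1)⁻¹ • ((τ - 1) • b - (2 * τ * η) • h)‖ ^ 2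
        - 2 * η * τ * inner ℝ e a - 2 * η * τ * (τ - 1) * inner ℝ e b
        + 2 * τ ^ 2 * η ^ 2 * inner ℝ e h
      ≤ 1 / (τ * (1 + R)) * ‖a‖ ^ 2 + (τ - 1) * ‖b‖ ^ 2
        + τ ^ 2 * η ^ 2 * (1 - η * β) * ‖h‖ ^ 2 + 3 * ρ * τ * η / α * ‖e‖ ^ 2 := by
  have hτ0 : 0 < τ := by linarith
  have hτ1 : 0 < τ - 1 := by linarith
  have hR1 : 0 < 1 + R := by linarith
  have hρα : τ ^ 2 * η * (1 + R) = ρ / α := by rw [← h1]; field_simp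
  -- the error against `a`
  have ea : -(2 * η * τ * inner ℝ e a)
      ≤ 1 / (τ * (1 + R)) * ‖a‖ ^ 2 + ρ * τ * η / α * ‖e‖ ^ 2 := by
    have ht : 0 < 1 / (η * τ ^ 2 * (1 + R)) := by positivity
    have h3 := mul_le_mul_of_nonneg_left (neg_le_of_abs_le (abs_two_mul_inner_le e a ht))
      (by positivity : 0 ≤ η * τ)
    have h4 : η * τ * (1 / (η * τ ^ 2 * (1 + R))) = 1 / (τ * (1 + R)) := by field_simp
    have h5 : η * τ * (1 / (η * τ ^ 2 * (1 + R)))⁻¹ = ρ * τ * η / α := by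
      rw [one_div, inv_inv, show η * τ * (η * τ ^ 2 * (1 + R)) = η * τ * (τ ^ 2 * η * (1 + R)) by
        ring, hρα]
      ring
    have h6 : η * τ * (-(1 / (η * τ ^ 2 * (1 + R)) * ‖a‖ ^ 2
        + (1 / (η * τ ^ 2 * (1 + R)))⁻¹ * ‖e‖ ^ 2))
        = -(1 / (τ * (1 + R)) * ‖a‖ ^ 2 + ρ * τ * η / α * ‖e‖ ^ 2) := by
      rw [← h4, ← h5]; ring
    rw [h6] at h3
    linarith
  -- the error against `b`
  have eb : -(2 * η * τ * (τ - 1) * inner ℝ e b)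
      ≤ (τ - 1) / (1 + R) * ‖b‖ ^ 2 + ρ * τ * η / α * ‖e‖ ^ 2 := by
    have ht : 0 < (τ - 1) * α / ρ := by positivity
    have h3 := mul_le_mul_of_nonneg_left (neg_le_of_abs_le (abs_two_mul_inner_le e b ht))
      (by positivity : 0 ≤ η * τ * (τ - 1))
    have h5 : η * τ * (τ - 1) * ((τ - 1) * α / ρ)⁻¹ = ρ * τ * η / α := by field_simp
    have h6 : η * τ * (τ - 1) * (-((τ - 1) * α / ρ * ‖b‖ ^ 2 + ((τ - 1) * α / ρ)⁻¹ * ‖e‖ ^ 2))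
        = -(η * τ * (τ - 1) * ((τ - 1) * α / ρ) * ‖b‖ ^ 2 + ρ * τ * η / α * ‖e‖ ^ 2) := by
      rw [← h5]; ring
    rw [h6] at h3
    have h7 : η * τ * (τ - 1) * ((τ - 1) * α / ρ) ≤ (τ - 1) / (1 + R) := by
      calc η * τ * (τ - 1) * ((τ - 1) * α / ρ) = (τ - 1) * (τ * (τ - 1) * η * α / ρ) := by ring
        _ ≤ (τ - 1) * (τ * τ * η * α / ρ) := by gcongr; linarith
        _ = (τ - 1) / (1 + R) := by rw [← h1]; field_simp
    have h8 := mul_le_mul_of_nonneg_right h7 (sq_nonneg ‖b‖)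
    linarith
  -- the error against `h`
  have eh : 2 * τ ^ 2 * η ^ 2 * inner ℝ e h
      ≤ τ ^ 2 * η ^ 2 / (1 + R) * ‖h‖ ^ 2 + ρ * τ * η / α * ‖e‖ ^ 2 := by
    have ht : 0 < 1 / (1 + R) := by positivity
    have h3 := mul_le_mul_of_nonneg_left (le_of_abs_le (abs_two_mul_inner_le e h ht))
      (by positivity : 0 ≤ τ ^ 2 * η ^ 2)
    have h5 : τ ^ 2 * η ^ 2 * (1 / (1 + R))⁻¹ ≤ ρ * τ * η / α := by
      rw [one_div, inv_inv]
      calc τ ^ 2 * η ^ 2 * (1 + R) = 1 * η * (ρ / α) := by rw [← hρα]; ring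
        _ ≤ τ * η * (ρ / α) := by gcongr
        _ = _ := by ring
    have h8 := mul_le_mul_of_nonneg_right h5 (sq_nonneg ‖e‖)
    have h6 : τ ^ 2 * η ^ 2 * (1 / (1 + R) * ‖h‖ ^ 2 + (1 / (1 + R))⁻¹ * ‖e‖ ^ 2)
        = τ ^ 2 * η ^ 2 / (1 + R) * ‖h‖ ^ 2
          + τ ^ 2 * η ^ 2 * (1 / (1 + R))⁻¹ * ‖e‖ ^ 2 := by ring
    linarith
  -- the step of `ξ`
  have hAη : 0 ≤ ρ * η * β * A := by positivity
  have eK : K * ‖(τ + 1)⁻¹ • ((τ - 1) • b - (2 * τ * η) • h)‖ ^ 2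
      ≤ 6 * (ρ * η * β * A) * (τ - 1) * ‖b‖ ^ 2
        + 24 * (ρ * η * β * A) * (τ ^ 2 * η ^ 2) * ‖h‖ ^ 2 := by
    have hτp : 0 < τ + 1 := by linarith
    rw [norm_smul, mul_pow, norm_inv, Real.norm_of_nonneg hτp.le]
    have h3 := norm_sub_sq_le_two_mul ((τ - 1) • b) ((2 * τ * η) • h)
    rw [norm_smul, norm_smul, mul_pow, mul_pow, Real.norm_of_nonneg hτ1.le,
      Real.norm_of_nonneg (by positivity)] at h3
    have hb : τ * (τ - 1) ^ 2 / (τ + 1) ^ 2 ≤ τ - 1 := by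
      rw [div_le_iff₀ (by positivity)]
      nlinarith [mul_pos hτ1 hτ0]
    have hh : τ * τ ^ 2 / (τ + 1) ^ 2 ≤ τ ^ 2 := by
      rw [div_le_iff₀ (by positivity)]
      have : τ ≤ (τ + 1) ^ 2 := by nlinarith
      nlinarith [sq_nonneg τ]
    calc K * ((τ + 1)⁻¹ ^ 2 * ‖(τ - 1) • b - (2 * τ * η) • h‖ ^ 2)
        ≤ 3 * ρ * τ * η * β * A * ((τ + 1)⁻¹ ^ 2 * ‖(τ - 1) • b - (2 * τ * η) • h‖ ^ 2) := by
          gcongr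
      _ ≤ 3 * ρ * τ * η * β * A * ((τ + 1)⁻¹ ^ 2
            * (2 * ((τ - 1) ^ 2 * ‖b‖ ^ 2) + 2 * ((2 * τ * η) ^ 2 * ‖h‖ ^ 2))) := by gcongr
      _ = 6 * (ρ * η * β * A) * (τ * (τ - 1) ^ 2 / (τ + 1) ^ 2) * ‖b‖ ^ 2
          + 24 * (ρ * η * β * A) * (τ * τ ^ 2 / (τ + 1) ^ 2 * η ^ 2) * ‖h‖ ^ 2 := by
          field_simp; ring
      _ ≤ _ := by gcongr
  have h2' : 24 * (ρ * η * β * A) = R / (1 + R) - η * β := by rw [← h2]; ring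
  have hsum : R / (1 + R) = 1 - 1 / (1 + R) := by field_simp; ring
  have h6 : 6 * (ρ * η * β * A) ≤ R / (1 + R) := by
    have : 0 < η * β := by positivity
    linarith
  have hb : (6 * (ρ * η * β * A)) * ((τ - 1) * ‖b‖ ^ 2) ≤ R / (1 + R) * ((τ - 1) * ‖b‖ ^ 2) := by
    gcongr
  have hh : 24 * (ρ * η * β * A) * (τ ^ 2 * η ^ 2) * ‖h‖ ^ 2
      = τ ^ 2 * η ^ 2 * (1 - η * β) * ‖h‖ ^ 2 - τ ^ 2 * η ^ 2 / (1 + R) * ‖h‖ ^ 2 := by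
    rw [h2', hsum]; ring
  rw [hsum] at hb
  have e3 : 3 * ρ * τ * η / α * ‖e‖ ^ 2 = 3 * (ρ * τ * η / α * ‖e‖ ^ 2) := by ring
  have e4 : (τ - 1) / (1 + R) * ‖b‖ ^ 2 = 1 / (1 + R) * ((τ - 1) * ‖b‖ ^ 2) := by ring
  rw [e4] at eb
  linarith

/-- One step of the accelerated method with the inexact gradient `g'` in place of `g`, in terms of
the function values at `ξ`, `λ`, `λ⁺` and at the reference point. -/
theorem accelerated_step_le {ξ l ξs g g' l' ξ' : E} {τ η α β ρ R A K Gξ Gl Gl' Gs : ℝ}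
    (hτ : 1 < τ) (hη : 0 < η) (hα : 0 < α) (hβ : 0 < β) (hR : 0 < R) (hA : 0 ≤ A) (hρ : ρ = 2 + R)
    (h1 : τ ^ 2 * η * α * (1 + R) = ρ) (h2 : η * β * (1 + 24 * A * ρ) = R / (1 + R))
    (hK : K ≤ 3 * ρ * τ * η * β * A)
    (hl' : l' = ξ - η • g') (hξ' : ξ' = l' + ((τ - 1) / (τ + 1)) • (l' - l))
    (hsmooth : Gl' ≤ Gξ + inner ℝ g (l' - ξ) + β / 2 * ‖l' - ξ‖ ^ 2)
    (hstrong : Gξ + inner ℝ g (ξs - ξ) + α / 2 * ‖ξs - ξ‖ ^ 2 ≤ Gs)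
    (hconv : Gξ + inner ℝ g (l - ξ) ≤ Gl) :
    2 * η * τ ^ 2 * (Gl' - Gs) + ‖(1 + τ) • ξ' - τ • l' - ξs‖ ^ 2 + K * ‖ξ' - ξ‖ ^ 2
      ≤ (1 - 1 / τ) * (2 * η * τ ^ 2 * (Gl - Gs) + ‖(1 + τ) • ξ - τ • l - ξs‖ ^ 2)
        + 3 * ρ * τ * η / α * ‖g' - g‖ ^ 2 := by
  have hτ0 : 0 < τ := by linarith
  have hτp : τ + 1 ≠ 0 := by positivity
  have hR1 : 0 < 1 + R := by linarith
  -- all vectors in terms of `a`, `b`, the inexact gradient and its error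
  obtain ⟨a, ha⟩ : ∃ a, a = ξ - ξs := ⟨_, rfl⟩
  obtain ⟨b, hb⟩ : ∃ b, b = ξ - l := ⟨_, rfl⟩
  obtain ⟨e, he⟩ : ∃ e, e = g' - g := ⟨_, rfl⟩
  have hmain := accelerated_error_le a b g' e hτ hη hα hβ hR hA (by linarith) h1 h2 hK
  have hv : (1 + τ) • ξ - τ • l - ξs = a + τ • b := by rw [ha, hb]; module
  have hdiff : ξ' - ξ = (τ + 1)⁻¹ • ((τ - 1) • b - (2 * τ * η) • g') := by
    rw [hξ', hl', hb]
    match_scalars <;> field_simp <;> ring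
  have hv' : (1 + τ) • ξ' - τ • l' - ξs = a + (τ - 1) • b - (τ * η) • g' := by
    rw [hξ', hl', ha, hb]
    match_scalars <;> field_simp <;> ring
  have hg : g = g' - e := by rw [he]; abel
  have d1 : l' - ξ = -(η • g') := by rw [hl']; abel
  have d2 : ξs - ξ = -a := by rw [ha]; abel
  have d3 : l - ξ = -b := by rw [hb]; abel
  rw [d1, hg, inner_neg_right, norm_neg, norm_smul, mul_pow, Real.norm_of_nonneg hη.le,
    real_inner_smul_right, inner_sub_left, real_inner_self_eq_norm_sq] at hsmooth
  rw [d2, hg, inner_neg_right, norm_neg, inner_sub_left] at hstrong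
  rw [d3, hg, inner_neg_right, inner_sub_left] at hconv
  rw [hv, hv', hdiff, ← he]
  have n1 : ‖a + τ • b‖ ^ 2 = ‖a‖ ^ 2 + 2 * τ * inner ℝ a b + τ ^ 2 * ‖b‖ ^ 2 := by
    rw [norm_add_sq_real, real_inner_smul_right, norm_smul, mul_pow, Real.norm_of_nonneg hτ0.le]
    ring
  have n2 : ‖a + (τ - 1) • b - (τ * η) • g'‖ ^ 2 = ‖a‖ ^ 2 + (τ - 1) ^ 2 * ‖b‖ ^ 2
      + τ ^ 2 * η ^ 2 * ‖g'‖ ^ 2 + 2 * (τ - 1) * inner ℝ a b - 2 * τ * η * inner ℝ g' a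
      - 2 * τ * η * (τ - 1) * inner ℝ g' b := by
    rw [norm_sub_sq_real, norm_add_sq_real, inner_add_left]
    simp only [real_inner_smul_right, real_inner_smul_left, norm_smul, mul_pow,
      Real.norm_eq_abs, sq_abs]
    rw [real_inner_comm g' a, real_inner_comm g' b]
    ring
  have n3 : (1 - 1 / τ) * ‖a + τ • b‖ ^ 2 = ‖a‖ ^ 2 - 1 / τ * ‖a‖ ^ 2
      + 2 * (τ - 1) * inner ℝ a b + τ * (τ - 1) * ‖b‖ ^ 2 := by
    rw [n1]; field_simp
  have n4 : (1 - 1 / τ) * (2 * η * τ ^ 2 * (Gl - Gs)) = 2 * η * τ * (τ - 1) * (Gl - Gs) := by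
    field_simp
  -- the choice of the parameters balances the terms in `‖a‖²`
  have n5 : 1 / (τ * (1 + R)) = η * τ * α - 1 / τ := by
    have h5 : η * τ * α = (2 + R) / (τ * (1 + R)) := by
      rw [← hρ, ← h1]; field_simp
    rw [h5]; field_simp; ring
  rw [n5] at hmain
  rw [mul_add, n3, n4, n2]
  have s1 := mul_le_mul_of_nonneg_left hsmooth (by positivity : 0 ≤ 2 * η * τ ^ 2)
  have s2 := mul_le_mul_of_nonneg_left hstrong (by positivity : 0 ≤ 2 * η * τ)
  have s3 := mul_le_mul_of_nonneg_left hconv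
    (mul_nonneg (by positivity) (by linarith) : 0 ≤ 2 * η * τ * (τ - 1))
  linarith

end Accelerated

/-! ### The iterates of DLAG -/

section Iterates

variable {n m d : ℕ} (Q : Problem n m d) (p : Params)

open Classical in
/-- The state at iteration `k + 1` in terms of the outcomes of the calls of Katyusha. -/
def nextOf (k : ℕ) (st : State n d) (x' : Blk n d) (out : Fin n → KState d) : State n d :=
  let send : Fin n → Prop := fun i =>
    ¬ LazyCond Q p (Function.update st.xs (k + 1) x') (k + 1) i (st.Θhat i) (out i).snap
      ∨ st.age i = p.D
  { Θ := WithLp.toLp 2 (fun i => (out i).snap)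
    Θhat := WithLp.toLp 2 (fun i => if send i then (out i).snap else st.Θhat i)
    age := fun i => if send i then 0 else st.age i + 1
    xs := Function.update st.xs (k + 1) x'
    y := st.xs k - p.η • rightMul st.Θhat Q.U
    evals := fun i => st.evals i + (out i).evals }

/-- The point `x^{k+1}` in terms of the state at iteration `k`. -/
def nextX (k : ℕ) (st : State n d) : Blk n d :=
  (st.xs k - p.η • rightMul st.Θhat Q.U)
    + momentum Q p • ((st.xs k - p.η • rightMul st.Θhat Q.U) - st.y)

theorem next_eq (k : ℕ) (idx : Fin n → ℕ → Fin m) (st : State n d) :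
    next Q p k idx st = nextOf Q p k st (nextX Q p k st) fun i =>
      Katyusha.run (Q.f i) (Q.L i) (Q.μ i) (nextX Q p k st i) (idx i) (st.Θ i) p.epochs := rfl

theorem next_congr {k : ℕ} {idx idx' : Fin n → ℕ → Fin m} {st : State n d}
    (h : ∀ i, ∀ t < 2 * m * p.epochs, idx i t = idx' i t) :
    next Q p k idx st = next Q p k idx' st := by
  rw [next_eq, next_eq]
  congr 1
  funext i
  exact Katyusha.run_congr (h i)

/-- The draws used up to iteration `k`. -/
def drawsUpTo (n T k : ℕ) : Finset (ℕ × Fin n × ℕ) :=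
  Finset.range (k + 1) ×ˢ Finset.univ ×ˢ Finset.range T

theorem mem_drawsUpTo {T k k' : ℕ} {i : Fin n} {t : ℕ} :
    (k', i, t) ∈ drawsUpTo n T k ↔ k' ≤ k ∧ t < T := by
  simp [drawsUpTo]

theorem drawsUpTo_mono {T k k' : ℕ} (h : k ≤ k') : drawsUpTo n T k ⊆ drawsUpTo n T k' := by
  rintro ⟨l, i, t⟩ hq
  rw [mem_drawsUpTo] at hq ⊢
  exact ⟨hq.1.trans h, hq.2⟩

theorem dependsOnDraws_state (k : ℕ) :
    DependsOnDraws (drawsUpTo n (2 * m * p.epochs) k) fun u => state Q p u k := by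
  induction k with
  | zero => intro u v _; rfl
  | succ k ih =>
    intro u v huv
    have h1 := ih u v fun q hq => huv q (drawsUpTo_mono (Nat.le_succ k) hq)
    simp only at h1
    simp only [state, h1]
    exact next_congr Q p fun i t ht => huv (k + 1, i, t) (mem_drawsUpTo.2 ⟨le_rfl, ht⟩)

theorem dependsOnDraws_dualPair (k : ℕ) :
    DependsOnDraws (drawsUpTo n (2 * m * p.epochs) (k - 1)) fun u => dualPair Q p u k := by
  induction k with
  | zero => intro u v _; rfl
  | succ k ih =>
    intro u v huv
    have h1 := ih u v fun q hq => huv q (drawsUpTo_mono (by omega) hq)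
    have h2 := dependsOnDraws_state Q p k u v huv
    simp only at h1 h2
    simp only [dualPair, h1, h2]

variable (u : ℕ → Fin n → ℕ → Fin m)

theorem xSeq_succ (k : ℕ) : xSeq Q p u (k + 1) = nextX Q p k (state Q p u k) := by
  simp [xSeq, state, next, nextX]

theorem ySeq_succ (k : ℕ) :
    ySeq Q p u (k + 1) = xSeq Q p u k - p.η • rightMul (state Q p u k).Θhat Q.U := rfl

theorem xSeq_succ_eq (k : ℕ) : xSeq Q p u (k + 1)
    = ySeq Q p u (k + 1) + momentum Q p • (ySeq Q p u (k + 1) - ySeq Q p u k) := by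
  rw [xSeq_succ]; rfl

theorem lamSeq_succ (k : ℕ) : lamSeq Q p u (k + 1)
    = xiSeq Q p u k - p.η • rightMul (state Q p u k).Θhat Q.sqrtU := rfl

theorem xiSeq_succ (k : ℕ) : xiSeq Q p u (k + 1)
    = lamSeq Q p u (k + 1) + momentum Q p • (lamSeq Q p u (k + 1) - lamSeq Q p u k) := rfl

theorem state_xs {j k : ℕ} (h : j ≤ k) : (state Q p u k).xs j = xSeq Q p u j := by
  induction k with
  | zero => rw [Nat.le_zero.1 h]; rfl
  | succ k ih =>
    rcases h.eq_or_lt with rfl | h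
    · rfl
    · rw [← ih (by omega)]
      change Function.update (state Q p u k).xs (k + 1) _ j = _
      rw [Function.update_of_ne (by omega)]

theorem meanZero_lift (k : ℕ) :
    MeanZero (xiSeq Q p u k) ∧ MeanZero (lamSeq Q p u k) ∧
      xSeq Q p u k = rightMul (xiSeq Q p u k) Q.sqrtU ∧
      ySeq Q p u k = rightMul (lamSeq Q p u k) Q.sqrtU := by
  induction k with
  | zero =>
    refine ⟨meanZero_zero, meanZero_zero, ?_, ?_⟩
    · exact (rightMul_zero _).symm
    · exact (rightMul_zero _).symm
  | succ k ih =>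
    obtain ⟨h1, h2, h3, h4⟩ := ih
    have hl : MeanZero (lamSeq Q p u (k + 1)) := by
      rw [lamSeq_succ]
      exact h1.sub ((Q.meanZero_rightMul_sqrtU _).smul _)
    have hy : ySeq Q p u (k + 1) = rightMul (lamSeq Q p u (k + 1)) Q.sqrtU := by
      rw [ySeq_succ, lamSeq_succ, rightMul_sub, rightMul_smul, rightMul_mul, Q.sqrtU_mul_self, h3]
    refine ⟨?_, hl, ?_, hy⟩
    · rw [xiSeq_succ]
      exact hl.add ((hl.sub h2).smul _)
    · rw [xSeq_succ_eq, xiSeq_succ, rightMul_add, rightMul_smul, rightMul_sub, hy, h4]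

theorem state_evals (k : ℕ) (i : Fin n) : (state Q p u k).evals i = 5 * m * p.epochs * k := by
  induction k with
  | zero => rfl
  | succ k ih =>
    have h : (state Q p u (k + 1)).evals i = (state Q p u k).evals i
        + (Katyusha.run (Q.f i) (Q.L i) (Q.μ i) (nextX Q p k (state Q p u k) i) (u (k + 1) i)
          ((state Q p u k).Θ i) p.epochs).evals := rfl
    rw [h, ih, Katyusha.run_evals]
    ring

theorem state_Θ_succ (k : ℕ) (i : Fin n) : (state Q p u (k + 1)).Θ i
    = (Katyusha.run (Q.f i) (Q.L i) (Q.μ i) (nextX Q p k (state Q p u k) i) (u (k + 1) i)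
          ((state Q p u k).Θ i) p.epochs).snap := rfl

/-- The coefficient in the lazy condition of the squared step made `e` iterations ago. -/
def lazyCoeff (e : ℕ) : ℝ :=
  (if e ≤ p.D then p.c + p.γ else p.c ^ (e - p.D)) + p.c ^ e

open Classical in
/-- The cached vector differs from the fresh one by at most the right-hand side of the lazy
condition: either the fresh one has just been sent, or the condition holds. -/
theorem norm_Θhat_sub_sq_le (hc : 0 < p.c) (hγ : 0 < p.γ) (k : ℕ) (i : Fin n) :
    ‖(state Q p u k).Θhat i - (state Q p u k).Θ i‖ ^ 2
      ≤ ∑ j ∈ Finset.range k, 3 / Q.μMin ^ 2 * lazyCoeff p (k - j)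
          * ‖xSeq Q p u j i - xSeq Q p u (j + 1) i‖ ^ 2 := by
  have hpos : ∀ e, 0 ≤ lazyCoeff p e := fun e => by
    rw [lazyCoeff]; split_ifs <;> positivity
  cases k with
  | zero => simp [state, init]
  | succ k =>
    by_cases hsend : ¬ LazyCond Q p (state Q p u (k + 1)).xs (k + 1) i ((state Q p u k).Θhat i)
        ((state Q p u (k + 1)).Θ i) ∨ (state Q p u k).age i = p.D
    · have h : (state Q p u (k + 1)).Θhat i = (state Q p u (k + 1)).Θ i := by
        change (if _ then _ else _) = _
        exact if_pos hsend
      rw [h, sub_self, norm_zero]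
      simp only [ne_eq, OfNat.ofNat_ne_zero, not_false_eq_true, zero_pow]
      exact Finset.sum_nonneg fun j _ => mul_nonneg
        (mul_nonneg (div_nonneg (by norm_num) (sq_nonneg _)) (hpos _)) (sq_nonneg _)
    · have h : (state Q p u (k + 1)).Θhat i = (state Q p u k).Θhat i := by
        change (if _ then _ else _) = _
        exact if_neg hsend
      rw [h]
      rw [not_or, not_not] at hsend
      refine hsend.1.trans (le_of_eq ?_)
      set δ : ℕ → ℝ := fun j => ‖xSeq Q p u j i - xSeq Q p u (j + 1) i‖ ^ 2 with hδ
      have hxs : ∀ j, j < k + 1 → ‖(state Q p u (k + 1)).xs j i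
          - (state Q p u (k + 1)).xs (j + 1) i‖ ^ 2 = δ j := fun j hj => by
        rw [state_xs Q p u hj.le, state_xs Q p u hj]
      have hsub : k + 1 - p.D ≤ k + 1 := Nat.sub_le _ _
      -- the four sums of the lazy condition in terms of the coefficients: the first one covers the
      -- steps older than `D`, the last two the `D` most recent ones
      have e1 : ∑ j ∈ Finset.range (k + 1 - p.D), p.c ^ (k + 1 - p.D - j) / Q.μMin ^ 2
            * ‖(state Q p u (k + 1)).xs j i - (state Q p u (k + 1)).xs (j + 1) i‖ ^ 2
          = ∑ j ∈ Finset.range (k + 1 - p.D), 1 / Q.μMin ^ 2 *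
            (if k + 1 - j ≤ p.D then p.c + p.γ else p.c ^ (k + 1 - j - p.D)) * δ j := by
        refine Finset.sum_congr rfl fun j hj => ?_
        rw [Finset.mem_range] at hj
        rw [hxs j (by omega), if_neg (by omega), Nat.sub_right_comm]
        ring
      have e2 : ∀ s : Finset ℕ, (∀ j ∈ s, k + 1 - p.D ≤ j ∧ j < k + 1) →
          ∑ j ∈ s, p.c / Q.μMin ^ 2
            * ‖(state Q p u (k + 1)).xs j i - (state Q p u (k + 1)).xs (j + 1) i‖ ^ 2
          + ∑ j ∈ s, p.γ / Q.μMin ^ 2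
            * ‖(state Q p u (k + 1)).xs j i - (state Q p u (k + 1)).xs (j + 1) i‖ ^ 2
          = ∑ j ∈ s, 1 / Q.μMin ^ 2 *
            (if k + 1 - j ≤ p.D then p.c + p.γ else p.c ^ (k + 1 - j - p.D)) * δ j := by
        intro s hs
        rw [← Finset.sum_add_distrib]
        refine Finset.sum_congr rfl fun j hj => ?_
        have := hs j hj
        rw [hxs j this.2, if_pos (by omega)]
        ring
      have e3 : ∑ j ∈ Finset.range (k + 1), p.c ^ (k + 1 - j) / Q.μMin ^ 2
            * ‖(state Q p u (k + 1)).xs j i - (state Q p u (k + 1)).xs (j + 1) i‖ ^ 2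
          = ∑ j ∈ Finset.range (k + 1), 1 / Q.μMin ^ 2 * p.c ^ (k + 1 - j) * δ j := by
        refine Finset.sum_congr rfl fun j hj => ?_
        rw [hxs j (Finset.mem_range.1 hj)]
        ring
      have e2' := e2 (Finset.Ico (k + 1 - p.D) (k + 1)) fun j hj => Finset.mem_Ico.1 hj
      have e4 := Finset.sum_range_add_sum_Ico (fun j => 1 / Q.μMin ^ 2 *
            (if k + 1 - j ≤ p.D then p.c + p.γ else p.c ^ (k + 1 - j - p.D)) * δ j) hsub
      rw [e1, e3]
      have e5 : ∀ x y z w : ℝ, 3 * x + 3 * y + 3 * z + 3 * w = 3 * (x + (z + w) + y) := by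
        intros; ring
      rw [e5, e2', e4, ← Finset.sum_add_distrib, Finset.mul_sum]
      refine Finset.sum_congr rfl fun j _ => ?_
      rw [lazyCoeff]
      ring

end Iterates

end DLAG

/-! ### Expected error of the cached dual gradients -/

namespace DLAG

variable {n m d : ℕ} {Q : Problem n m d} {p : Params}

/-- The requirements on the parameters under which the Lyapunov function contracts. With
`τ = √(sκ)`, the numbers `R` and `A` are those in `sηβ = (2 + R)/(1 + R)` and
`ηβ(1 + 24A(2 + R)) = R/(1 + R)`; the identity `strong_eq` is the former one since `κ = β/α`. By
`katyusha`, a call of Katyusha reduces the expected squared error at least by the factor `c/2`. -/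
structure Admissible (Q : Problem n m d) (p : Params) (R A : ℝ) : Prop where
  c_pos : 0 < p.c
  γ_pos : 0 < p.γ
  η_pos : 0 < p.η
  one_lt : 1 < Real.sqrt (p.s * Q.κ)
  R_pos : 0 < R
  A_nonneg : 0 ≤ A
  ρ_eq : p.ρ = 2 + R
  strong_eq : Real.sqrt (p.s * Q.κ) ^ 2 * p.η * Q.α * (1 + R) = p.ρ
  smooth_eq : p.η * Q.β * (1 + 24 * A * p.ρ) = R / (1 + R)
  c_lt : p.c < rate Q p
  weights : cWeight Q p 1 + cTilde Q p 1
    ≤ 3 * p.ρ * Real.sqrt (p.s * Q.κ) * p.η * Q.β * A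
  katyusha : ∀ i, 9 / 4 * (Q.L i / Q.μ i) * ((1 + Katyusha.τ₁ m (Q.L i) (Q.μ i)) ^ p.epochs)⁻¹
    ≤ p.c / 2

variable {Ω : Type*} [MeasurableSpace Ω] {P : Measure Ω} [IsProbabilityMeasure P]
  {J : ℕ → Fin n → ℕ → Ω → Fin m}

theorem dependsOnDraws_xSeq (Q : Problem n m d) (p : Params) (k : ℕ) :
    DependsOnDraws (drawsUpTo n (2 * m * p.epochs) k) fun u => xSeq Q p u k :=
  (dependsOnDraws_state Q p k).comp fun st => st.xs k

theorem dependsOnDraws_xiSeq (Q : Problem n m d) (p : Params) (k : ℕ) :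
    DependsOnDraws (drawsUpTo n (2 * m * p.epochs) k) fun u => xiSeq Q p u k :=
  ((dependsOnDraws_dualPair Q p k).comp fun q => q.2).mono (drawsUpTo_mono (Nat.sub_le _ _))

theorem dependsOnDraws_lamSeq (Q : Problem n m d) (p : Params) (k : ℕ) :
    DependsOnDraws (drawsUpTo n (2 * m * p.epochs) k) fun u => lamSeq Q p u k :=
  ((dependsOnDraws_dualPair Q p k).comp fun q => q.1).mono (drawsUpTo_mono (Nat.sub_le _ _))

theorem objective_eq_localObj (Q : Problem n m d) (i : Fin n) (x θ : Vec d) :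
    Katyusha.objective (Q.f i) x θ = Q.localObj i θ - inner ℝ θ x := rfl

theorem objective_dualPoint_lower (hm : 1 ≤ m) (i : Fin n) (x θ : Vec d) :
    Katyusha.objective (Q.f i) x (Q.dualPoint i x) + Q.μ i / 2 * ‖θ - Q.dualPoint i x‖ ^ 2
      ≤ Katyusha.objective (Q.f i) x θ := by
  have := Q.dualPoint_lower hm i x θ
  rw [inner_sub_right, real_inner_comm θ x, real_inner_comm (Q.dualPoint i x) x] at this
  rw [objective_eq_localObj, objective_eq_localObj]
  linarith

theorem objective_dualPoint_upper (hm : 1 ≤ m) (i : Fin n) (x θ : Vec d) :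
    Katyusha.objective (Q.f i) x θ ≤ Katyusha.objective (Q.f i) x (Q.dualPoint i x)
      + Q.L i / 2 * ‖θ - Q.dualPoint i x‖ ^ 2 := by
  have := Q.dualPoint_upper hm i x θ
  rw [inner_sub_right, real_inner_comm θ x, real_inner_comm (Q.dualPoint i x) x] at this
  rw [objective_eq_localObj, objective_eq_localObj]
  linarith

/-- Each call of Katyusha reduces the expected squared distance to the exact dual gradient by the
factor `c/2`. -/
theorem integral_Θ_succ_error_le {R A : ℝ} (h : Admissible Q p R A) (hJ : Sampling P J)
    (hm : 1 ≤ m) (hd : 1 ≤ d) (i : Fin n) (k : ℕ) :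
    ∫ ω, ‖(state Q p (path J ω) (k + 1)).Θ i
        - Q.dualPoint i (xSeq Q p (path J ω) (k + 1) i)‖ ^ 2 ∂P
      ≤ p.c / 2 * ∫ ω, ‖(state Q p (path J ω) k).Θ i
        - Q.dualPoint i (xSeq Q p (path J ω) (k + 1) i)‖ ^ 2 ∂P := by
  have hdep := dependsOnDraws_state Q p k
  have h1 := Katyusha.integral_run_snap_le (opt := Q.dualPoint i) (k := k + 1) (i := i) hJ hm
    ((Q.μ_pos i).trans_le (Q.μ_le_L hm hd i)) (Q.μ_pos i) (Q.smooth i) (Q.strong i)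
    (S := drawsUpTo n (2 * m * p.epochs) k) (fun t ht => by
      rw [mem_drawsUpTo] at ht; omega)
    (hdep.comp fun st => nextX Q p k st i) (hdep.comp fun st => st.Θ i)
    (objective_dualPoint_lower hm i) (objective_dualPoint_upper hm i) p.epochs
  simp only [state_Θ_succ, xSeq_succ]
  refine h1.trans (mul_le_mul_of_nonneg_right (h.katyusha i) ?_)
  exact integral_nonneg fun ω => sq_nonneg _

/-- The expected squared error of the approximate dual gradient of worker `i`. -/
theorem integral_Θ_error_le {R A : ℝ} (h : Admissible Q p R A) (hJ : Sampling P J)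
    (hn : 2 ≤ n) (hm : 1 ≤ m) (hd : 1 ≤ d) (i : Fin n) (k : ℕ) :
    ∫ ω, ‖(state Q p (path J ω) k).Θ i - Q.dualPoint i (xSeq Q p (path J ω) k i)‖ ^ 2 ∂P
      ≤ ∑ j ∈ Finset.range k, 1 / Q.μMin ^ 2 * p.c ^ (k - j)
        * ∫ ω, ‖xSeq Q p (path J ω) j i - xSeq Q p (path J ω) (j + 1) i‖ ^ 2 ∂P := by
  have hc := h.c_pos
  have hμ := Q.μMin_pos hn
  induction k with
  | zero =>
    -- the dual gradient at the start is exact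
    have h0 : ∀ u, (state Q p u 0).Θ i - Q.dualPoint i (xSeq Q p u 0 i) = 0 := fun u => by
      change ∇ (conjugate (Q.localObj i)) 0 - Q.dualPoint i 0 = 0
      rw [Q.gradient_conjugate hm, sub_self]
    simp [h0]
  | succ k ih =>
    refine (integral_Θ_succ_error_le h hJ hm hd i k).trans ?_
    have i1 : Integrable (fun ω => ‖(state Q p (path J ω) k).Θ i
        - Q.dualPoint i (xSeq Q p (path J ω) (k + 1) i)‖ ^ 2) P :=
      hJ.integrable hm (((dependsOnDraws_state Q p k).mono (drawsUpTo_mono (Nat.le_succ k))).comp₂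
        (dependsOnDraws_xSeq Q p (k + 1)) fun st x => ‖st.Θ i - Q.dualPoint i (x i)‖ ^ 2)
    have i2 : Integrable (fun ω => ‖(state Q p (path J ω) k).Θ i
        - Q.dualPoint i (xSeq Q p (path J ω) k i)‖ ^ 2) P :=
      hJ.integrable hm ((dependsOnDraws_state Q p k).comp₂
        (dependsOnDraws_xSeq Q p k) fun st x => ‖st.Θ i - Q.dualPoint i (x i)‖ ^ 2)
    have i3 : Integrable (fun ω => ‖xSeq Q p (path J ω) k i
        - xSeq Q p (path J ω) (k + 1) i‖ ^ 2) P :=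
      hJ.integrable hm (((dependsOnDraws_xSeq Q p k).mono (drawsUpTo_mono (Nat.le_succ k))).comp₂
        (dependsOnDraws_xSeq Q p (k + 1)) fun x y => ‖x i - y i‖ ^ 2)
    -- the warm start is off by the previous error and by the change of the exact dual gradient
    have h2 : ∫ ω, ‖(state Q p (path J ω) k).Θ i
        - Q.dualPoint i (xSeq Q p (path J ω) (k + 1) i)‖ ^ 2 ∂P
        ≤ 2 * ∫ ω, ‖(state Q p (path J ω) k).Θ i
            - Q.dualPoint i (xSeq Q p (path J ω) k i)‖ ^ 2 ∂P
          + 2 / Q.μMin ^ 2 * ∫ ω, ‖xSeq Q p (path J ω) k i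
            - xSeq Q p (path J ω) (k + 1) i‖ ^ 2 ∂P := by
      rw [← integral_const_mul, ← integral_const_mul,
        ← integral_add (i2.const_mul _) (i3.const_mul _)]
      refine integral_mono i1 ((i2.const_mul _).add (i3.const_mul _)) fun ω => ?_
      dsimp only
      set x := xSeq Q p (path J ω) k i
      set x' := xSeq Q p (path J ω) (k + 1) i
      set θ := (state Q p (path J ω) k).Θ i
      have e1 : θ - Q.dualPoint i x' = (θ - Q.dualPoint i x)
          - (Q.dualPoint i x' - Q.dualPoint i x) := by abel
      have e2 := norm_sub_sq_le_two_mul (θ - Q.dualPoint i x) (Q.dualPoint i x' - Q.dualPoint i x)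
      rw [← e1] at e2
      have e3 : Q.μMin * ‖Q.dualPoint i x' - Q.dualPoint i x‖ ≤ ‖x - x'‖ := by
        refine le_trans (mul_le_mul_of_nonneg_right (Q.μMin_le i) (norm_nonneg _)) ?_
        rw [norm_sub_rev x x']
        exact Q.norm_dualPoint_sub_le hm i x' x
      have e4 := pow_le_pow_left₀ (by positivity) e3 2
      have e5 : ‖Q.dualPoint i x' - Q.dualPoint i x‖ ^ 2 ≤ 1 / Q.μMin ^ 2 * ‖x - x'‖ ^ 2 := by
        rw [mul_pow] at e4
        rw [one_div, ← div_eq_inv_mul, le_div_iff₀ (by positivity)]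
        linarith
      calc _ ≤ _ := e2
        _ ≤ 2 * ‖θ - Q.dualPoint i x‖ ^ 2 + 2 * (1 / Q.μMin ^ 2 * ‖x - x'‖ ^ 2) := by gcongr
        _ = _ := by ring
    have h3 := mul_le_mul_of_nonneg_left h2 (by positivity : 0 ≤ p.c / 2)
    refine h3.trans ?_
    have h4 := mul_le_mul_of_nonneg_left ih hc.le
    rw [Finset.mul_sum] at h4
    rw [Finset.sum_range_succ]
    -- the previous error enters with the factor `2 · c/2 = c`, which raises the powers by one
    have h5 : ∀ j ∈ Finset.range k, p.c * (1 / Q.μMin ^ 2 * p.c ^ (k - j)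
        * ∫ ω, ‖xSeq Q p (path J ω) j i - xSeq Q p (path J ω) (j + 1) i‖ ^ 2 ∂P)
        = 1 / Q.μMin ^ 2 * p.c ^ (k + 1 - j)
        * ∫ ω, ‖xSeq Q p (path J ω) j i - xSeq Q p (path J ω) (j + 1) i‖ ^ 2 ∂P := by
      intro j hj
      rw [Finset.mem_range] at hj
      rw [show k + 1 - j = (k - j) + 1 by omega, pow_succ]
      ring
    rw [Finset.sum_congr rfl h5] at h4
    have h6 : k + 1 - k = 1 := by omega
    rw [h6, pow_one]
    have e6 : ∀ X Y : ℝ, p.c / 2 * (2 * X + 2 / Q.μMin ^ 2 * Y)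
        = p.c * X + 1 / Q.μMin ^ 2 * p.c * Y := by intros; ring
    rw [e6]
    linarith

/-- The coefficient of the squared step made `e` iterations ago in the bound on the expected squared
error of the cached dual gradients. -/
def errorCoeff (p : Params) (e : ℕ) : ℝ :=
  6 * (if e ≤ p.D then p.c else p.c ^ (e - p.D)) + 8 * p.c ^ e + if e ≤ p.D then 6 * p.γ else 0

theorem errorCoeff_nonneg (hc : 0 < p.c) (hγ : 0 < p.γ) (e : ℕ) : 0 ≤ errorCoeff p e := by
  rw [errorCoeff]
  split_ifs <;> positivity

theorem integral_Θhat_error_le {R A : ℝ} (h : Admissible Q p R A) (hJ : Sampling P J)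
    (hn : 2 ≤ n) (hm : 1 ≤ m) (hd : 1 ≤ d) (i : Fin n) (k : ℕ) :
    ∫ ω, ‖(state Q p (path J ω) k).Θhat i - Q.dualPoint i (xSeq Q p (path J ω) k i)‖ ^ 2 ∂P
      ≤ ∑ j ∈ Finset.range k, 1 / Q.μMin ^ 2 * errorCoeff p (k - j)
        * ∫ ω, ‖xSeq Q p (path J ω) j i - xSeq Q p (path J ω) (j + 1) i‖ ^ 2 ∂P := by
  have i1 : Integrable (fun ω => ‖(state Q p (path J ω) k).Θhat i
      - Q.dualPoint i (xSeq Q p (path J ω) k i)‖ ^ 2) P :=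
    hJ.integrable hm ((dependsOnDraws_state Q p k).comp₂
      (dependsOnDraws_xSeq Q p k) fun st x => ‖st.Θhat i - Q.dualPoint i (x i)‖ ^ 2)
  have i2 : Integrable (fun ω => ‖(state Q p (path J ω) k).Θ i
      - Q.dualPoint i (xSeq Q p (path J ω) k i)‖ ^ 2) P :=
    hJ.integrable hm ((dependsOnDraws_state Q p k).comp₂
      (dependsOnDraws_xSeq Q p k) fun st x => ‖st.Θ i - Q.dualPoint i (x i)‖ ^ 2)
  have i3 : ∀ j, Integrable (fun ω => ‖xSeq Q p (path J ω) j i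
      - xSeq Q p (path J ω) (j + 1) i‖ ^ 2) P := fun j =>
    hJ.integrable hm (((dependsOnDraws_xSeq Q p j).mono (drawsUpTo_mono (Nat.le_succ j))).comp₂
      (dependsOnDraws_xSeq Q p (j + 1)) fun x y => ‖x i - y i‖ ^ 2)
  have i4 : Integrable (fun ω => ∑ j ∈ Finset.range k, 3 / Q.μMin ^ 2 * lazyCoeff p (k - j)
      * ‖xSeq Q p (path J ω) j i - xSeq Q p (path J ω) (j + 1) i‖ ^ 2) P :=
    integrable_finsetSum _ fun j _ => (i3 j).const_mul _
  have h1 : ∫ ω, ‖(state Q p (path J ω) k).Θhat i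
      - Q.dualPoint i (xSeq Q p (path J ω) k i)‖ ^ 2 ∂P
      ≤ 2 * (∑ j ∈ Finset.range k, 3 / Q.μMin ^ 2 * lazyCoeff p (k - j)
          * ∫ ω, ‖xSeq Q p (path J ω) j i - xSeq Q p (path J ω) (j + 1) i‖ ^ 2 ∂P)
        + 2 * ∫ ω, ‖(state Q p (path J ω) k).Θ i
          - Q.dualPoint i (xSeq Q p (path J ω) k i)‖ ^ 2 ∂P := by
    simp only [← integral_const_mul]
    rw [← integral_finsetSum _ fun j _ => (i3 j).const_mul _, ← integral_const_mul,
      ← integral_add (i4.const_mul _) (i2.const_mul _)]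
    refine integral_mono i1 ((i4.const_mul _).add (i2.const_mul _)) fun ω => ?_
    dsimp only
    have e2 := norm_sub_sq_le_two_mul
      ((state Q p (path J ω) k).Θhat i - (state Q p (path J ω) k).Θ i)
      (Q.dualPoint i (xSeq Q p (path J ω) k i) - (state Q p (path J ω) k).Θ i)
    rw [sub_sub_sub_cancel_right, norm_sub_rev (Q.dualPoint i _)] at e2
    have e3 := norm_Θhat_sub_sq_le Q p (path J ω) h.c_pos h.γ_pos k i
    linarith
  refine h1.trans ?_
  have h2 := integral_Θ_error_le h hJ hn hm hd i k
  have h3 : 2 * (∑ j ∈ Finset.range k, 3 / Q.μMin ^ 2 * lazyCoeff p (k - j)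
        * ∫ ω, ‖xSeq Q p (path J ω) j i - xSeq Q p (path J ω) (j + 1) i‖ ^ 2 ∂P)
      + 2 * (∑ j ∈ Finset.range k, 1 / Q.μMin ^ 2 * p.c ^ (k - j)
        * ∫ ω, ‖xSeq Q p (path J ω) j i - xSeq Q p (path J ω) (j + 1) i‖ ^ 2 ∂P)
      = ∑ j ∈ Finset.range k, 1 / Q.μMin ^ 2 * errorCoeff p (k - j)
        * ∫ ω, ‖xSeq Q p (path J ω) j i - xSeq Q p (path J ω) (j + 1) i‖ ^ 2 ∂P := by
    rw [Finset.mul_sum, Finset.mul_sum, ← Finset.sum_add_distrib]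
    refine Finset.sum_congr rfl fun j _ => ?_
    rw [errorCoeff, lazyCoeff]
    split_ifs <;> ring
  linarith

/-- The expected squared error of the inexact gradient of the dual objective. -/
theorem integral_gradient_error_le {R A : ℝ} (h : Admissible Q p R A) (hJ : Sampling P J)
    (hn : 2 ≤ n) (hm : 1 ≤ m) (hd : 1 ≤ d) (k : ℕ) :
    ∫ ω, ‖rightMul (state Q p (path J ω) k).Θhat Q.sqrtU
        - Q.gradG (xiSeq Q p (path J ω) k)‖ ^ 2 ∂P
      ≤ ∑ j ∈ Finset.range k, frobNorm Q.sqrtU ^ 4 / Q.μMin ^ 2 * errorCoeff p (k - j)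
        * ∫ ω, ‖xiSeq Q p (path J ω) (j + 1) - xiSeq Q p (path J ω) j‖ ^ 2 ∂P := by
  have hμ := Q.μMin_pos hn
  have iΘ : ∀ i, Integrable (fun ω => ‖(state Q p (path J ω) k).Θhat i
      - Q.dualPoint i (xSeq Q p (path J ω) k i)‖ ^ 2) P := fun i =>
    hJ.integrable hm ((dependsOnDraws_state Q p k).comp₂
      (dependsOnDraws_xSeq Q p k) fun st x => ‖st.Θhat i - Q.dualPoint i (x i)‖ ^ 2)
  have ix : ∀ j i, Integrable (fun ω => ‖xSeq Q p (path J ω) j i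
      - xSeq Q p (path J ω) (j + 1) i‖ ^ 2) P := fun j i =>
    hJ.integrable hm (((dependsOnDraws_xSeq Q p j).mono (drawsUpTo_mono (Nat.le_succ j))).comp₂
      (dependsOnDraws_xSeq Q p (j + 1)) fun x y => ‖x i - y i‖ ^ 2)
  have iξ : ∀ j, Integrable (fun ω => ‖xiSeq Q p (path J ω) (j + 1)
      - xiSeq Q p (path J ω) j‖ ^ 2) P := fun j =>
    hJ.integrable hm ((dependsOnDraws_xiSeq Q p (j + 1)).comp₂
      ((dependsOnDraws_xiSeq Q p j).mono (drawsUpTo_mono (Nat.le_succ j))) fun x y => ‖x - y‖ ^ 2)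
  have ie : Integrable (fun ω => ‖rightMul (state Q p (path J ω) k).Θhat Q.sqrtU
        - Q.gradG (xiSeq Q p (path J ω) k)‖ ^ 2) P :=
    hJ.integrable hm ((dependsOnDraws_state Q p k).comp₂
      (dependsOnDraws_xiSeq Q p k) fun st x => ‖rightMul st.Θhat Q.sqrtU - Q.gradG x‖ ^ 2)
  -- both passages, from blocks to columns of `x` and back to `ξ`, cost a factor `‖√U‖²`
  have h1 : ∫ ω, ‖rightMul (state Q p (path J ω) k).Θhat Q.sqrtU
        - Q.gradG (xiSeq Q p (path J ω) k)‖ ^ 2 ∂P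
      ≤ frobNorm Q.sqrtU ^ 2 * ∑ i, ∫ ω, ‖(state Q p (path J ω) k).Θhat i
        - Q.dualPoint i (xSeq Q p (path J ω) k i)‖ ^ 2 ∂P := by
    rw [← integral_finsetSum _ fun i _ => iΘ i, ← integral_const_mul]
    refine integral_mono ie ((integrable_finsetSum _ fun i _ => iΘ i).const_mul _) fun ω => ?_
    dsimp only
    have e1 : rightMul (state Q p (path J ω) k).Θhat Q.sqrtU - Q.gradG (xiSeq Q p (path J ω) k)
        = rightMul ((state Q p (path J ω) k).Θhat - Q.dualBlk (xSeq Q p (path J ω) k))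
          Q.sqrtU := by
      rw [rightMul_sub, (meanZero_lift Q p (path J ω) k).2.2.1]; rfl
    rw [e1]
    have e2 := pow_le_pow_left₀ (norm_nonneg _) (norm_rightMul_le
      ((state Q p (path J ω) k).Θhat - Q.dualBlk (xSeq Q p (path J ω) k)) Q.sqrtU) 2
    rw [mul_pow, PiLp.norm_sq_eq_of_L2 (fun _ : Fin n => Vec d)
      ((state Q p (path J ω) k).Θhat - Q.dualBlk (xSeq Q p (path J ω) k))] at e2
    exact e2
  refine h1.trans ?_
  have h2 : ∑ i, ∫ ω, ‖(state Q p (path J ω) k).Θhat i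
        - Q.dualPoint i (xSeq Q p (path J ω) k i)‖ ^ 2 ∂P
      ≤ ∑ j ∈ Finset.range k, 1 / Q.μMin ^ 2 * errorCoeff p (k - j)
        * ∑ i, ∫ ω, ‖xSeq Q p (path J ω) j i - xSeq Q p (path J ω) (j + 1) i‖ ^ 2 ∂P := by
    refine (Finset.sum_le_sum fun i _ => integral_Θhat_error_le h hJ hn hm hd i k).trans
      (le_of_eq ?_)
    rw [Finset.sum_comm]
    exact Finset.sum_congr rfl fun j _ => (Finset.mul_sum _ _ _).symm
  have h3 : ∀ j, ∑ i, ∫ ω, ‖xSeq Q p (path J ω) j i - xSeq Q p (path J ω) (j + 1) i‖ ^ 2 ∂P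
      ≤ frobNorm Q.sqrtU ^ 2
        * ∫ ω, ‖xiSeq Q p (path J ω) (j + 1) - xiSeq Q p (path J ω) j‖ ^ 2 ∂P := by
    intro j
    rw [← integral_finsetSum _ fun i _ => ix j i, ← integral_const_mul]
    refine integral_mono (integrable_finsetSum _ fun i _ => ix j i) ((iξ j).const_mul _) fun ω => ?_
    dsimp only
    have e1 : xSeq Q p (path J ω) j - xSeq Q p (path J ω) (j + 1)
        = rightMul (xiSeq Q p (path J ω) j - xiSeq Q p (path J ω) (j + 1)) Q.sqrtU := by
      rw [rightMul_sub, (meanZero_lift Q p (path J ω) j).2.2.1,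
        (meanZero_lift Q p (path J ω) (j + 1)).2.2.1]
    have e2 := pow_le_pow_left₀ (norm_nonneg _) (norm_rightMul_le
      (xiSeq Q p (path J ω) j - xiSeq Q p (path J ω) (j + 1)) Q.sqrtU) 2
    rw [mul_pow, ← e1, PiLp.norm_sq_eq_of_L2 (fun _ : Fin n => Vec d)
      (xSeq Q p (path J ω) j - xSeq Q p (path J ω) (j + 1)), norm_sub_rev (xiSeq _ _ _ j)] at e2
    exact e2
  calc frobNorm Q.sqrtU ^ 2 * ∑ i, ∫ ω, ‖(state Q p (path J ω) k).Θhat i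
        - Q.dualPoint i (xSeq Q p (path J ω) k i)‖ ^ 2 ∂P
      ≤ frobNorm Q.sqrtU ^ 2 * ∑ j ∈ Finset.range k, 1 / Q.μMin ^ 2 * errorCoeff p (k - j)
        * (frobNorm Q.sqrtU ^ 2
        * ∫ ω, ‖xiSeq Q p (path J ω) (j + 1) - xiSeq Q p (path J ω) j‖ ^ 2 ∂P) := by
        refine mul_le_mul_of_nonneg_left (h2.trans (Finset.sum_le_sum fun j _ => ?_)) (sq_nonneg _)
        refine mul_le_mul_of_nonneg_left (h3 j) (mul_nonneg (by positivity) ?_)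
        exact errorCoeff_nonneg h.c_pos h.γ_pos _
    _ = _ := by
        rw [Finset.mul_sum]
        exact Finset.sum_congr rfl fun j _ => by ring

/-! ### Contraction of the Lyapunov function -/

theorem sum_Icc_one (f : ℕ → ℝ) (N : ℕ) :
    ∑ e ∈ Finset.Icc 1 N, f e = ∑ j ∈ Finset.range N, f (j + 1) := by
  induction N with
  | zero => simp
  | succ N ih => rw [Finset.sum_Icc_succ_top (by omega), ih, Finset.sum_range_succ]

theorem sum_Icc_one_eq_sub (f : ℕ → ℝ) (N : ℕ) :
    ∑ e ∈ Finset.Icc 1 N, f e = ∑ j ∈ Finset.range N, f (N - j) := by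
  rw [sum_Icc_one, ← Finset.sum_range_reflect]
  refine Finset.sum_congr rfl fun j hj => ?_
  rw [Finset.mem_range] at hj
  congr 1
  omega

section Weights

variable {R A : ℝ}

theorem Admissible.rate_pos (h : Admissible Q p R A) : 0 < rate Q p := h.c_pos.trans h.c_lt

theorem Admissible.ρ_pos (h : Admissible Q p R A) : 0 < p.ρ := by
  rw [h.ρ_eq]; linarith [h.R_pos]

theorem Admissible.sq_sqrt (h : Admissible Q p R A) :
    Real.sqrt (p.s * Q.κ) ^ 2 = p.s * Q.κ := by
  refine Real.sq_sqrt (le_of_lt ?_)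
  by_contra hle
  have := h.one_lt
  rw [Real.sqrt_eq_zero_of_nonpos (not_lt.1 hle)] at this
  linarith

theorem cWeight_rec (h : Admissible Q p R A) {e : ℕ} (he : e ≤ p.D) :
    cWeight Q p (e + 1) = rate Q p * cWeight Q p e - qConst Q p := by
  have hr := h.rate_pos.ne'
  rw [cWeight, cWeight, ← Finset.add_sum_Ioc_eq_sum_Icc he, mul_add, Finset.mul_sum]
  have h1 : Finset.Ioc e p.D = Finset.Icc (e + 1) p.D := by
    ext; simp only [Finset.mem_Ioc, Finset.mem_Icc]; omega
  have h2 : rate Q p * (rate Q p ^ ((e : ℤ) - (e : ℤ) - 1) * qConst Q p) = qConst Q p := by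
    rw [sub_self, zero_sub, zpow_neg_one, mul_inv_cancel_left₀ hr]
  rw [h1, h2, add_sub_cancel_left]
  refine Finset.sum_congr rfl fun j _ => ?_
  rw [← mul_assoc, ← zpow_one_add₀ hr]
  congr 2
  push_cast
  ring

theorem cWeight_succ_D : cWeight Q p (p.D + 1) = 0 := by
  rw [cWeight, Finset.Icc_eq_empty (by omega), Finset.sum_empty]

theorem summable_cTilde (h : Admissible Q p R A) (e : ℕ) :
    Summable fun l : ℕ => wWeight Q p (e + l) / rate Q p ^ (l + 1) := by
  have hr := h.rate_pos
  have hc := h.c_pos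
  have hgeo : Summable fun l : ℕ => (p.c / rate Q p) ^ l :=
    summable_geometric_of_lt_one (by positivity) ((div_lt_one hr).2 h.c_lt)
  -- past the delay `D` the general term is a multiple of a geometric one
  rw [← summable_nat_add_iff (p.D + 1)]
  refine (hgeo.mul_left (3 * p.ρ * Real.sqrt (p.s * Q.κ) * p.η / Q.α
    * (frobNorm Q.sqrtU ^ 4 / Q.μMin ^ 2)
    * (6 * p.c ^ (e + 1) + 8 * p.c ^ (e + p.D + 1)) / rate Q p ^ (p.D + 1 + 1))).congr fun l => ?_
  rw [wWeight, if_neg (by omega), show e + (l + (p.D + 1)) - p.D = l + (e + 1) by omega,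
    show e + (l + (p.D + 1)) = l + (e + p.D + 1) by omega,
    show l + (p.D + 1) + 1 = l + (p.D + 1 + 1) by omega, pow_add p.c l, pow_add p.c l,
    pow_add (rate Q p) l, div_pow]
  field_simp

theorem cTilde_rec (h : Admissible Q p R A) (e : ℕ) :
    cTilde Q p (e + 1) = rate Q p * cTilde Q p e - wWeight Q p e := by
  have hr := h.rate_pos.ne'
  rw [cTilde, cTilde, (summable_cTilde h e).tsum_eq_zero_add, mul_add, ← tsum_mul_left]
  have h2 : rate Q p * (wWeight Q p (e + 0) / rate Q p ^ (0 + 1)) = wWeight Q p e := by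
    rw [add_zero, zero_add, pow_one]; field_simp
  rw [h2, add_sub_cancel_left]
  refine tsum_congr fun l => ?_
  rw [show e + (l + 1) = e + 1 + l by ring, pow_succ _ (l + 1)]
  field_simp

theorem qConst_pos (h : Admissible Q p R A) (hn : 2 ≤ n) (hm : 1 ≤ m) (hd : 1 ≤ d) :
    0 < qConst Q p := by
  have := h.ρ_pos
  have := h.η_pos
  have := h.γ_pos
  have := Q.α_pos hn hm hd
  have := Q.μMin_pos hn
  have := Q.frobNorm_pos hn
  have := h.one_lt
  rw [qConst]; positivity

theorem wWeight_pos (h : Admissible Q p R A) (hn : 2 ≤ n) (hm : 1 ≤ m) (hd : 1 ≤ d) (e : ℕ) :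
    0 < wWeight Q p e := by
  have := h.ρ_pos
  have := h.η_pos
  have := h.c_pos
  have := Q.α_pos hn hm hd
  have := Q.μMin_pos hn
  have := Q.frobNorm_pos hn
  have := h.one_lt
  rw [wWeight]
  split_ifs <;> positivity

theorem cWeight_pos (h : Admissible Q p R A) (hn : 2 ≤ n) (hm : 1 ≤ m) (hd : 1 ≤ d) {e : ℕ}
    (he : e ≤ p.D) : 0 < cWeight Q p e := by
  have hr := h.rate_pos
  have hq := qConst_pos h hn hm hd
  exact Finset.sum_pos (fun j _ => by positivity) (Finset.nonempty_Icc.2 he)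

theorem cTilde_pos (h : Admissible Q p R A) (hn : 2 ≤ n) (hm : 1 ≤ m) (hd : 1 ≤ d) (e : ℕ) :
    0 < cTilde Q p e := by
  have hr := h.rate_pos
  have hw := wWeight_pos h hn hm hd
  exact (summable_cTilde h e).tsum_pos (fun l => by have := hw (e + l); positivity) 0
    (by have := hw (e + 0); positivity)

/-- The error coefficients are the defects in the recursions of the weights. -/
theorem errorCoeff_eq (Q : Problem n m d) (p : Params) (e : ℕ) :
    3 * p.ρ * Real.sqrt (p.s * Q.κ) * p.η / Q.α
      * (frobNorm Q.sqrtU ^ 4 / Q.μMin ^ 2 * errorCoeff p e)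
      = wWeight Q p e + if e ≤ p.D then qConst Q p else 0 := by
  rw [wWeight, errorCoeff, qConst]
  split_ifs <;> ring

end Weights

/-- The main part of the Lyapunov function. -/
def lyapunovCore (Q : Problem n m d) (p : Params) (ξstar : Blk n d)
    (u : ℕ → Fin n → ℕ → Fin m) (k : ℕ) : ℝ :=
  2 * p.η * p.s * Q.κ * (Q.G (lamSeq Q p u k) - Q.G ξstar) + ‖vSeq Q p u k - ξstar‖ ^ 2

/-- The pathwise descent of the main part of the Lyapunov function up to the gradient error. -/
theorem lyapunovCore_succ_le {R A : ℝ} (h : Admissible Q p R A) (hn : 2 ≤ n) (hm : 1 ≤ m)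
    (hd : 1 ≤ d) {ξstar : Blk n d} (hstar : Q.IsDualMin ξstar) (u : ℕ → Fin n → ℕ → Fin m)
    (k : ℕ) :
    lyapunovCore Q p ξstar u (k + 1)
        + (cWeight Q p 1 + cTilde Q p 1) * ‖xiSeq Q p u (k + 1) - xiSeq Q p u k‖ ^ 2
      ≤ rate Q p * lyapunovCore Q p ξstar u k
        + 3 * p.ρ * Real.sqrt (p.s * Q.κ) * p.η / Q.α
          * ‖rightMul (state Q p u k).Θhat Q.sqrtU - Q.gradG (xiSeq Q p u k)‖ ^ 2 := by
  have hlift := meanZero_lift Q p u k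
  have hmain := accelerated_step_le (K := cWeight Q p 1 + cTilde Q p 1)
    (τ := Real.sqrt (p.s * Q.κ)) (g := Q.gradG (xiSeq Q p u k)) (ξs := ξstar) h.one_lt h.η_pos
    (Q.α_pos hn hm hd) (Q.β_pos hn) h.R_pos h.A_nonneg h.ρ_eq h.strong_eq h.smooth_eq h.weights
    (lamSeq_succ Q p u k) (xiSeq_succ Q p u k) (Q.G_le hn hm _ _)
    (Q.G_ge_of_meanZero hn hm hd hlift.1 hstar.1) (Q.G_ge hn hm hd _ (lamSeq Q p u k))
  rw [h.sq_sqrt] at hmain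
  simp only [lyapunovCore, rate, vSeq]
  linarith

theorem dependsOnDraws_lyapunovCore (Q : Problem n m d) (p : Params) (ξstar : Blk n d) (k : ℕ) :
    DependsOnDraws (drawsUpTo n (2 * m * p.epochs) k) fun u => lyapunovCore Q p ξstar u k :=
  (dependsOnDraws_lamSeq Q p k).comp₂ (dependsOnDraws_xiSeq Q p k) fun l x =>
    2 * p.η * p.s * Q.κ * (Q.G l - Q.G ξstar) + ‖((1 + Real.sqrt (p.s * Q.κ)) • x
      - Real.sqrt (p.s * Q.κ) • l) - ξstar‖ ^ 2

theorem integrable_lyapunovCore (hJ : Sampling P J) (hm : 1 ≤ m) (ξstar : Blk n d) (k : ℕ) :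
    Integrable (fun ω => lyapunovCore Q p ξstar (path J ω) k) P :=
  hJ.integrable hm (dependsOnDraws_lyapunovCore Q p ξstar k)

theorem integrable_xi_sub (hJ : Sampling P J) (hm : 1 ≤ m) (j l : ℕ) :
    Integrable (fun ω => ‖xiSeq Q p (path J ω) j - xiSeq Q p (path J ω) l‖ ^ 2) P :=
  hJ.integrable hm (((dependsOnDraws_xiSeq Q p j).mono (drawsUpTo_mono (le_max_left j l))).comp₂
    ((dependsOnDraws_xiSeq Q p l).mono (drawsUpTo_mono (le_max_right j l))) fun x y => ‖x - y‖ ^ 2)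

theorem integrable_lyapunov (hJ : Sampling P J) (hm : 1 ≤ m) (ξstar : Blk n d) (k : ℕ) :
    Integrable (fun ω => lyapunov Q p ξstar (path J ω) k) P :=
  ((integrable_lyapunovCore hJ hm ξstar k).add
    (integrable_finsetSum _ fun _ _ => (integrable_xi_sub hJ hm _ _).const_mul _)).add
    (integrable_finsetSum _ fun _ _ => (integrable_xi_sub hJ hm _ _).const_mul _)

theorem integral_lyapunov (hJ : Sampling P J) (hm : 1 ≤ m) (ξstar : Blk n d) (k : ℕ) :
    ∫ ω, lyapunov Q p ξstar (path J ω) k ∂P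
      = ∫ ω, lyapunovCore Q p ξstar (path J ω) k ∂P
        + ∑ e ∈ Finset.Icc 1 p.D, cWeight Q p e
          * ∫ ω, ‖xiSeq Q p (path J ω) (k + 1 - e) - xiSeq Q p (path J ω) (k - e)‖ ^ 2 ∂P
        + ∑ e ∈ Finset.Icc 1 k, cTilde Q p e
          * ∫ ω, ‖xiSeq Q p (path J ω) (k + 1 - e) - xiSeq Q p (path J ω) (k - e)‖ ^ 2 ∂P := by
  have i1 := integrable_lyapunovCore (Q := Q) (p := p) hJ hm ξstar k
  have i2 : Integrable (fun ω => ∑ e ∈ Finset.Icc 1 p.D, cWeight Q p e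
      * ‖xiSeq Q p (path J ω) (k + 1 - e) - xiSeq Q p (path J ω) (k - e)‖ ^ 2) P :=
    integrable_finsetSum _ fun _ _ => (integrable_xi_sub hJ hm _ _).const_mul _
  have i3 : Integrable (fun ω => ∑ e ∈ Finset.Icc 1 k, cTilde Q p e
      * ‖xiSeq Q p (path J ω) (k + 1 - e) - xiSeq Q p (path J ω) (k - e)‖ ^ 2) P :=
    integrable_finsetSum _ fun _ _ => (integrable_xi_sub hJ hm _ _).const_mul _
  have i12 : Integrable (fun ω => lyapunovCore Q p ξstar (path J ω) k
      + ∑ e ∈ Finset.Icc 1 p.D, cWeight Q p e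
        * ‖xiSeq Q p (path J ω) (k + 1 - e) - xiSeq Q p (path J ω) (k - e)‖ ^ 2) P := i1.add i2
  refine (integral_add i12 i3).trans ?_
  rw [integral_add i1 i2,
    integral_finsetSum _ fun _ _ => (integrable_xi_sub hJ hm _ _).const_mul _,
    integral_finsetSum _ fun _ _ => (integrable_xi_sub hJ hm _ _).const_mul _]
  simp only [integral_const_mul]

/-- The Lyapunov function contracts in expectation. -/
theorem integral_lyapunov_succ_le {R A : ℝ} (h : Admissible Q p R A) (hJ : Sampling P J)
    (hn : 2 ≤ n) (hm : 1 ≤ m) (hd : 1 ≤ d) {ξstar : Blk n d} (hstar : Q.IsDualMin ξstar) (k : ℕ) :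
    ∫ ω, lyapunov Q p ξstar (path J ω) (k + 1) ∂P
      ≤ rate Q p * ∫ ω, lyapunov Q p ξstar (path J ω) k ∂P := by
  rw [integral_lyapunov hJ hm, integral_lyapunov hJ hm]
  set b : ℕ → ℝ := fun e => ∫ ω, ‖xiSeq Q p (path J ω) (k + 1 - e)
    - xiSeq Q p (path J ω) (k - e)‖ ^ 2 ∂P with hb
  have hb0 : ∀ e, 0 ≤ b e := fun e => integral_nonneg fun ω => sq_nonneg _
  set C : ℕ → ℝ := fun k => ∫ ω, lyapunovCore Q p ξstar (path J ω) k ∂P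
  have hshift : ∀ e, ∫ ω, ‖xiSeq Q p (path J ω) (k + 1 + 1 - (e + 1))
      - xiSeq Q p (path J ω) (k + 1 - (e + 1))‖ ^ 2 ∂P = b e := fun e => by
    simp only [hb, Nat.add_sub_add_right]
  have hρ := h.ρ_pos
  have hη := h.η_pos
  have hα := Q.α_pos hn hm hd
  have hτ := h.one_lt
  have ie : Integrable (fun ω => ‖rightMul (state Q p (path J ω) k).Θhat Q.sqrtU
        - Q.gradG (xiSeq Q p (path J ω) k)‖ ^ 2) P :=
    hJ.integrable hm ((dependsOnDraws_state Q p k).comp₂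
      (dependsOnDraws_xiSeq Q p k) fun st x => ‖rightMul st.Θhat Q.sqrtU - Q.gradG x‖ ^ 2)
  -- the descent in expectation
  have hdesc : C (k + 1) + (cWeight Q p 1 + cTilde Q p 1) * b 0
      ≤ rate Q p * C k + 3 * p.ρ * Real.sqrt (p.s * Q.κ) * p.η / Q.α
        * ∫ ω, ‖rightMul (state Q p (path J ω) k).Θhat Q.sqrtU
          - Q.gradG (xiSeq Q p (path J ω) k)‖ ^ 2 ∂P := by
    have ib := integrable_xi_sub (Q := Q) (p := p) hJ hm (k + 1) k
    have iC := fun k => integrable_lyapunovCore (Q := Q) (p := p) hJ hm ξstar k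
    simp only [hb, Nat.sub_zero, C, ← integral_const_mul]
    rw [← integral_add (iC (k + 1)) (ib.const_mul _),
      ← integral_add ((iC k).const_mul _) (ie.const_mul _)]
    exact integral_mono ((iC (k + 1)).add (ib.const_mul _))
      (((iC k).const_mul _).add (ie.const_mul _))
      fun ω => lyapunovCore_succ_le h hn hm hd hstar (path J ω) k
  -- the gradient error in terms of the weights
  have herr : 3 * p.ρ * Real.sqrt (p.s * Q.κ) * p.η / Q.α
        * ∫ ω, ‖rightMul (state Q p (path J ω) k).Θhat Q.sqrtU
          - Q.gradG (xiSeq Q p (path J ω) k)‖ ^ 2 ∂P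
      ≤ ∑ e ∈ Finset.Icc 1 k, wWeight Q p e * b e
        + ∑ e ∈ Finset.Icc 1 p.D, qConst Q p * b e := by
    have e1 := mul_le_mul_of_nonneg_left (integral_gradient_error_le h hJ hn hm hd k)
      (by positivity : 0 ≤ 3 * p.ρ * Real.sqrt (p.s * Q.κ) * p.η / Q.α)
    refine e1.trans ?_
    have e2 : ∑ j ∈ Finset.range k, frobNorm Q.sqrtU ^ 4 / Q.μMin ^ 2 * errorCoeff p (k - j)
        * ∫ ω, ‖xiSeq Q p (path J ω) (j + 1) - xiSeq Q p (path J ω) j‖ ^ 2 ∂P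
        = ∑ e ∈ Finset.Icc 1 k, frobNorm Q.sqrtU ^ 4 / Q.μMin ^ 2 * errorCoeff p e * b e := by
      rw [sum_Icc_one_eq_sub]
      refine Finset.sum_congr rfl fun j hj => ?_
      rw [Finset.mem_range] at hj
      simp only [hb]
      rw [show k + 1 - (k - j) = j + 1 by omega, show k - (k - j) = j by omega]
    rw [e2, Finset.mul_sum]
    have e3 : ∀ e, 3 * p.ρ * Real.sqrt (p.s * Q.κ) * p.η / Q.α
        * (frobNorm Q.sqrtU ^ 4 / Q.μMin ^ 2 * errorCoeff p e * b e)
        = wWeight Q p e * b e + if e ≤ p.D then qConst Q p * b e else 0 := fun e => by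
      rw [← mul_assoc, errorCoeff_eq, add_mul, ite_mul, zero_mul]
    simp only [e3]
    rw [Finset.sum_add_distrib]
    gcongr
    rw [← Finset.sum_filter]
    refine Finset.sum_le_sum_of_subset_of_nonneg (fun e he => ?_) fun e _ _ =>
      mul_nonneg (qConst_pos h hn hm hd).le (hb0 e)
    rw [Finset.mem_filter, Finset.mem_Icc] at he
    exact Finset.mem_Icc.2 ⟨he.1.1, he.2⟩
  -- the recursions of the weights
  have hsum1 : ∑ e ∈ Finset.Icc 1 p.D, cWeight Q p e
      * ∫ ω, ‖xiSeq Q p (path J ω) (k + 1 + 1 - e) - xiSeq Q p (path J ω) (k + 1 - e)‖ ^ 2 ∂P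
      = cWeight Q p 1 * b 0 + rate Q p * ∑ e ∈ Finset.Icc 1 p.D, cWeight Q p e * b e
        - ∑ e ∈ Finset.Icc 1 p.D, qConst Q p * b e := by
    have e1 : ∑ e ∈ Finset.Icc 1 p.D, cWeight Q p (e + 1) * b e
        = rate Q p * ∑ e ∈ Finset.Icc 1 p.D, cWeight Q p e * b e
          - ∑ e ∈ Finset.Icc 1 p.D, qConst Q p * b e := by
      rw [Finset.mul_sum, ← Finset.sum_sub_distrib]
      refine Finset.sum_congr rfl fun e he => ?_
      rw [cWeight_rec h (Finset.mem_Icc.1 he).2]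
      ring
    rw [add_sub_assoc, ← e1, sum_Icc_one, sum_Icc_one]
    simp only [hshift]
    have e2 := Finset.sum_range_succ (fun j => cWeight Q p (j + 1) * b j) p.D
    rw [cWeight_succ_D, zero_mul, add_zero] at e2
    rw [← e2, Finset.sum_range_succ', add_comm]
  have hsum2 : ∑ e ∈ Finset.Icc 1 (k + 1), cTilde Q p e
      * ∫ ω, ‖xiSeq Q p (path J ω) (k + 1 + 1 - e) - xiSeq Q p (path J ω) (k + 1 - e)‖ ^ 2 ∂P
      = cTilde Q p 1 * b 0 + rate Q p * ∑ e ∈ Finset.Icc 1 k, cTilde Q p e * b e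
        - ∑ e ∈ Finset.Icc 1 k, wWeight Q p e * b e := by
    have e1 : ∑ e ∈ Finset.Icc 1 k, cTilde Q p (e + 1) * b e
        = rate Q p * ∑ e ∈ Finset.Icc 1 k, cTilde Q p e * b e
          - ∑ e ∈ Finset.Icc 1 k, wWeight Q p e * b e := by
      rw [Finset.mul_sum, ← Finset.sum_sub_distrib]
      refine Finset.sum_congr rfl fun e _ => ?_
      rw [cTilde_rec h]
      ring
    rw [add_sub_assoc, ← e1, sum_Icc_one, sum_Icc_one]
    simp only [hshift]
    rw [Finset.sum_range_succ', add_comm]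
  rw [hsum1, hsum2]
  linarith

end DLAG

/-! ### From the contraction to the complexity bounds -/

namespace DLAG

variable {n m d : ℕ} {Q : Problem n m d} {p : Params}
variable {Ω : Type*} [MeasurableSpace Ω] {P : Measure Ω} [IsProbabilityMeasure P]
  {J : ℕ → Fin n → ℕ → Ω → Fin m}

theorem lyapunov_zero (Q : Problem n m d) (p : Params) (ξstar : Blk n d)
    (u : ℕ → Fin n → ℕ → Fin m) :
    lyapunov Q p ξstar u 0
      = 2 * p.η * p.s * Q.κ * (Q.G 0 - Q.G ξstar) + ‖ξstar‖ ^ 2 := by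
  have h0 : ∀ e ∈ Finset.Icc 1 p.D,
      cWeight Q p e * ‖xiSeq Q p u (0 + 1 - e) - xiSeq Q p u (0 - e)‖ ^ 2 = 0 := by
    intro e he
    rw [Finset.mem_Icc] at he
    rw [show 0 + 1 - e = 0 by omega, show 0 - e = 0 by omega, sub_self, norm_zero]
    ring
  have hl : lamSeq Q p u 0 = 0 := rfl
  have hx : xiSeq Q p u 0 = 0 := rfl
  rw [lyapunov, Finset.sum_eq_zero h0, Finset.Icc_eq_empty (by omega), Finset.sum_empty, vSeq, hl,
    hx, smul_zero, smul_zero, sub_zero, zero_sub, norm_neg, add_zero, add_zero]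

section Iterations

variable {R A : ℝ}

theorem integral_lyapunov_le_pow (h : Admissible Q p R A) (hJ : Sampling P J) (hn : 2 ≤ n)
    (hm : 1 ≤ m) (hd : 1 ≤ d) {ξstar : Blk n d} (hstar : Q.IsDualMin ξstar) (K : ℕ) :
    ∫ ω, lyapunov Q p ξstar (path J ω) K ∂P
      ≤ rate Q p ^ K * (2 * p.η * p.s * Q.κ * (Q.G 0 - Q.G ξstar) + ‖ξstar‖ ^ 2) := by
  induction K with
  | zero => simp [lyapunov_zero]
  | succ K ih =>
    refine (integral_lyapunov_succ_le h hJ hn hm hd hstar K).trans ?_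
    rw [pow_succ', mul_assoc]
    exact mul_le_mul_of_nonneg_left ih h.rate_pos.le

theorem integrable_G_lamSeq (hJ : Sampling P J) (hm : 1 ≤ m) (K : ℕ) :
    Integrable (fun ω => Q.G (lamSeq Q p (path J ω) K)) P :=
  hJ.integrable hm ((dependsOnDraws_lamSeq Q p K).comp Q.G)

/-- The expected dual suboptimality decays geometrically from twice its initial value: the
distance term of the initial Lyapunov function is dominated by its objective term, by strong
convexity of `G` on `S`. -/
theorem integral_G_sub_le (h : Admissible Q p R A) (hJ : Sampling P J) (hn : 2 ≤ n)
    (hm : 1 ≤ m) (hd : 1 ≤ d) {ξstar : Blk n d} (hstar : Q.IsDualMin ξstar) (K : ℕ) :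
    ∫ ω, Q.G (lamSeq Q p (path J ω) K) ∂P - Q.G ξstar
      ≤ rate Q p ^ K * (2 * (Q.G 0 - Q.G ξstar)) := by
  set S : ℝ := 2 * p.η * p.s * Q.κ with hS
  have hα := Q.α_pos hn hm hd
  have hR := h.R_pos
  have hr := h.rate_pos
  -- the parameters satisfy `sκηα = (2 + R)/(1 + R) ≥ 1`
  have hSα : 2 ≤ S * Q.α := by
    have e := h.strong_eq
    rw [h.sq_sqrt, h.ρ_eq] at e
    have e2 : S * Q.α * (1 + R) = 2 * (2 + R) := by rw [hS]; linarith
    by_contra hlt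
    push Not at hlt
    nlinarith
  have hS0 : 0 < S := by
    by_contra hle
    push Not at hle
    nlinarith
  have hΔ : 0 ≤ Q.G 0 - Q.G ξstar := by linarith [hstar.2 0]
  have hξ : ‖ξstar‖ ^ 2 ≤ S * (Q.G 0 - Q.G ξstar) := by
    have e := hstar.norm_sub_sq_le hn hm hd meanZero_zero
    rw [zero_sub, norm_neg] at e
    have e1 : ‖ξstar‖ ^ 2 ≤ S * (Q.α / 2 * ‖ξstar‖ ^ 2) := by
      nlinarith [sq_nonneg ‖ξstar‖]
    exact e1.trans (mul_le_mul_of_nonneg_left e hS0.le)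
  -- the remaining terms of the Lyapunov function are nonnegative
  have hlow : S * (∫ ω, Q.G (lamSeq Q p (path J ω) K) ∂P - Q.G ξstar)
      ≤ ∫ ω, lyapunov Q p ξstar (path J ω) K ∂P := by
    have i1 := integrable_G_lamSeq (Q := Q) (p := p) hJ hm K
    have e1 : S * (∫ ω, Q.G (lamSeq Q p (path J ω) K) ∂P - Q.G ξstar)
        = ∫ ω, S * (Q.G (lamSeq Q p (path J ω) K) - Q.G ξstar) ∂P := by
      rw [integral_const_mul, integral_sub i1 (integrable_const _)]
      simp
    rw [e1]
    refine integral_mono ((i1.sub (integrable_const _)).const_mul _)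
      (integrable_lyapunov hJ hm ξstar K) fun ω => ?_
    have s1 : 0 ≤ ∑ e ∈ Finset.Icc 1 p.D, cWeight Q p e
        * ‖xiSeq Q p (path J ω) (K + 1 - e) - xiSeq Q p (path J ω) (K - e)‖ ^ 2 :=
      Finset.sum_nonneg fun e he => mul_nonneg
        (cWeight_pos h hn hm hd (Finset.mem_Icc.1 he).2).le (sq_nonneg _)
    have s2 : 0 ≤ ∑ e ∈ Finset.Icc 1 K, cTilde Q p e
        * ‖xiSeq Q p (path J ω) (K + 1 - e) - xiSeq Q p (path J ω) (K - e)‖ ^ 2 :=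
      Finset.sum_nonneg fun e _ => mul_nonneg (cTilde_pos h hn hm hd e).le (sq_nonneg _)
    have s3 := sq_nonneg ‖vSeq Q p (path J ω) K - ξstar‖
    simp only [lyapunov]
    linarith
  have hup := integral_lyapunov_le_pow h hJ hn hm hd hstar K
  have hfin : S * (∫ ω, Q.G (lamSeq Q p (path J ω) K) ∂P - Q.G ξstar)
      ≤ S * (rate Q p ^ K * (2 * (Q.G 0 - Q.G ξstar))) := by
    refine hlow.trans (hup.trans ?_)
    have := mul_le_mul_of_nonneg_left (add_le_add_right hξ (S * (Q.G 0 - Q.G ξstar)))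
      (pow_nonneg hr.le K)
    linarith
  exact le_of_mul_le_mul_left hfin hS0

theorem rate_pow_mul_le (h : Admissible Q p R A) {Δ ε : ℝ} (hΔ : 0 ≤ Δ) (hε : 0 < ε) {K : ℕ}
    (hK : Real.sqrt (p.s * Q.κ) * max 0 (Real.log (Δ / ε)) ≤ K) : rate Q p ^ K * Δ ≤ ε := by
  rcases hΔ.eq_or_lt with rfl | hΔ
  · simpa using hε.le
  have hτ : 0 < Real.sqrt (p.s * Q.κ) := one_pos.trans h.one_lt
  set τ := Real.sqrt (p.s * Q.κ) with hτdef
  have hlog : Real.log (Δ / ε) ≤ K / τ := by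
    rw [le_div_iff₀ hτ, mul_comm]
    exact (mul_le_mul_of_nonneg_left (le_max_right _ _) hτ.le).trans hK
  have h1 : Δ / ε ≤ Real.exp (K / τ) := (Real.log_le_iff_le_exp (by positivity)).1 hlog
  have h2 : rate Q p ^ K ≤ Real.exp (-(K / τ)) := by
    have e : rate Q p ≤ Real.exp (-(1 / τ)) := Real.one_sub_le_exp_neg _
    calc rate Q p ^ K ≤ Real.exp (-(1 / τ)) ^ K := by
          gcongr
          exact h.rate_pos.le
      _ = Real.exp (-(K / τ)) := by rw [← Real.exp_nat_mul]; congr 1; ring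
  rw [div_le_iff₀ hε] at h1
  calc rate Q p ^ K * Δ ≤ Real.exp (-(K / τ)) * (Real.exp (K / τ) * ε) := by gcongr
    _ = ε := by rw [← mul_assoc, ← Real.exp_add]; simp

end Iterations

theorem katyushaBudget_nonneg {c : ℝ} (hc : 2 ≤ 2 * Q.κMax / c) : 0 ≤ katyushaBudget Q c :=
  mul_nonneg (by positivity) (Real.log_nonneg (by linarith))

/-- The number of stochastic gradients of a call of Katyusha; the rounding in the number of epochs
costs a factor `2`. -/
theorem epochCount_le (hm : 1 ≤ m) {c : ℝ} (hc : 2 ≤ 2 * Q.κMax / c) :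
    5 * m * (epochCount Q 12 c : ℝ) ≤ 120 * katyushaBudget Q c := by
  have hm0 : (0 : ℝ) < m := by exact_mod_cast hm
  have hlog : 1 / 2 ≤ Real.log (2 * Q.κMax / c) :=
    (by linarith [Real.log_two_gt_d9] : 1 / 2 ≤ Real.log 2).trans
      (Real.log_le_log (by norm_num) hc)
  have hs := Real.sqrt_nonneg (Q.κMax / m)
  set X : ℝ := 12 * (1 + Real.sqrt (Q.κMax / m)) * Real.log (2 * Q.κMax / c) with hX
  have hX1 : 1 ≤ X := by rw [hX]; nlinarith
  have hceil : (epochCount Q 12 c : ℝ) ≤ 2 * X := by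
    have := Nat.ceil_lt_add_one (by linarith : 0 ≤ X)
    rw [epochCount]
    linarith
  have hsq : (m : ℝ) * Real.sqrt (Q.κMax / m) = Real.sqrt (m * Q.κMax) := by
    have e : (m : ℝ) * Q.κMax = (m : ℝ) ^ 2 * (Q.κMax / m) := by field_simp
    rw [e, Real.sqrt_mul (by positivity), Real.sqrt_sq hm0.le]
  calc 5 * m * (epochCount Q 12 c : ℝ) ≤ 5 * m * (2 * X) := by gcongr
    _ = 120 * ((m + m * Real.sqrt (Q.κMax / m)) * Real.log (2 * Q.κMax / c)) := by rw [hX]; ring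
    _ = 120 * katyushaBudget Q c := by rw [hsq, katyushaBudget]

/-- Admissible parameters carry the performance guarantee. -/
theorem Admissible.guarantee {R A : ℝ} (h : Admissible Q p R A)
    (hep : p.epochs = epochCount Q 12 p.c) (hc : 2 ≤ 2 * Q.κMax / p.c) (hJ : Sampling P J)
    (hn : 2 ≤ n) (hm : 1 ≤ m) (hd : 1 ≤ d) {ξstar : Blk n d} (hstar : Q.IsDualMin ξstar) :
    Guarantee 120 Q p P J ξstar := by
  have hB := katyushaBudget_nonneg hc
  have hcall : 5 * m * (p.epochs : ℝ) ≤ 120 * katyushaBudget Q p.c := by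
    rw [hep]; exact epochCount_le hm hc
  have hworker : ∀ ε : ℝ, ∀ ω i,
      (workerEvals Q p (path J ω) ⌈iterBound Q p ξstar ε⌉₊ i : ℝ)
        ≤ 120 * katyushaBudget Q p.c * iterBound Q p ξstar ε := by
    intro ε ω i
    have hI : 0 ≤ iterBound Q p ξstar ε := mul_nonneg (Real.sqrt_nonneg _) (le_max_left _ _)
    -- the vector `y^K` uses the dual gradients up to iteration `K - 1` only
    have hK : ((⌈iterBound Q p ξstar ε⌉₊ - 1 : ℕ) : ℝ) ≤ iterBound Q p ξstar ε := by
      have e := Nat.ceil_lt_add_one hI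
      rcases Nat.eq_zero_or_pos ⌈iterBound Q p ξstar ε⌉₊ with h0 | h0
      · rw [h0]; simpa using hI
      · rw [Nat.cast_sub h0]; push_cast; linarith
    rw [workerEvals, state_evals]
    push_cast
    exact mul_le_mul hcall hK (Nat.cast_nonneg _) (by positivity)
  refine
    { lift := fun k ω => meanZero_lift Q p (path J ω) k
      weights_pos := ⟨fun e he => cWeight_pos h hn hm hd (Finset.mem_Icc.1 he).2,
        fun e _ => cTilde_pos h hn hm hd e⟩
      integrable := fun k => integrable_lyapunov hJ hm ξstar k
      contraction := fun k => integral_lyapunov_succ_le h hJ hn hm hd hstar k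
      iterations := fun ε hε K hK => ⟨integrable_G_lamSeq hJ hm K,
        (integral_G_sub_le h hJ hn hm hd hstar K).trans
          (rate_pow_mul_le h (by linarith [hstar.2 0]) hε hK)⟩
      per_call := fun k ω i => ?_
      gradients := fun ε _ ω => ⟨hworker ε ω, ?_⟩ }
  · rw [state_evals, state_evals]
    push_cast
    linarith
  · refine (Finset.sum_le_sum fun i _ => hworker ε ω i).trans (le_of_eq ?_)
    rw [Finset.sum_const, Finset.card_univ, Fintype.card_fin, nsmul_eq_mul]
    ring

end DLAG

/-! ### Accuracy of a call of Katyusha -/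

namespace DLAG

variable {n m d : ℕ} {Q : Problem n m d} {p : Params}

/-- The number of epochs makes the contraction factor of Katyusha at most `(c/(2κ_max))³`. -/
theorem katyusha_contraction_le (hn : 2 ≤ n) (hm : 1 ≤ m) (hd : 1 ≤ d) {c : ℝ} (hc0 : 0 < c)
    (hc : 2 ≤ 2 * Q.κMax / c) (i : Fin n) :
    9 / 4 * (Q.L i / Q.μ i)
        * ((1 + Katyusha.τ₁ m (Q.L i) (Q.μ i)) ^ epochCount Q 12 c)⁻¹ ≤ c / 2 := by
  have hm0 : (0 : ℝ) < m := by exact_mod_cast hm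
  have hμ := Q.μ_pos i
  have hL : 0 < Q.L i := hμ.trans_le (Q.μ_le_L hm hd i)
  have hτ := Katyusha.τ₁_pos hm hL hμ
  have hτ2 : Katyusha.τ₁ m (Q.L i) (Q.μ i) ≤ 1 / 2 := Katyusha.τ₁_le_half
  have hκi := Q.le_κMax i
  have hκ1 := Q.one_le_κMax hn hm hd
  have hκi0 : 0 < Q.L i / Q.μ i := by positivity
  set q := Real.sqrt (Q.κMax / m) with hq
  have hq0 : 0 ≤ q := Real.sqrt_nonneg _
  -- `1/τ₁` is at most `2(1 + √(κ_max/m))`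
  have hqτ : 1 / 2 ≤ (1 + q) * Katyusha.τ₁ m (Q.L i) (Q.μ i) := by
    rcases min_cases (Real.sqrt (2 * (m : ℝ) * Q.μ i / (3 * Q.L i))) (1 / 2) with ⟨e, _⟩ | ⟨e, _⟩
    · have h1 : 1 / 2 ≤ q * Real.sqrt (2 * (m : ℝ) * Q.μ i / (3 * Q.L i)) := by
        rw [hq, ← Real.sqrt_mul (by positivity)]
        refine Real.le_sqrt_of_sq_le ?_
        calc ((1 : ℝ) / 2) ^ 2 ≤ 2 / 3 := by norm_num
          _ = (Q.L i / Q.μ i / m) * (2 * (m : ℝ) * Q.μ i / (3 * Q.L i)) := by field_simp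
          _ ≤ (Q.κMax / m) * (2 * (m : ℝ) * Q.μ i / (3 * Q.L i)) := by gcongr
      rw [Katyusha.τ₁, e]
      nlinarith [Real.sqrt_nonneg (2 * (m : ℝ) * Q.μ i / (3 * Q.L i))]
    · rw [Katyusha.τ₁, e]; linarith
  set τ := Katyusha.τ₁ m (Q.L i) (Q.μ i)
  set ℓ := Real.log (2 * Q.κMax / c) with hℓ
  have hℓ0 : 0 ≤ ℓ := Real.log_nonneg (by linarith)
  set N := epochCount Q 12 c with hN
  have hNle : 12 * (1 + q) * ℓ ≤ N := Nat.le_ceil _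
  have hexp : Real.exp (τ / 2) ≤ 1 + τ := by
    have e := Real.one_sub_le_exp_neg (τ / 2)
    rw [Real.exp_neg] at e
    have e2 := Real.exp_pos (τ / 2)
    have e3 : (1 - τ / 2) * Real.exp (τ / 2) ≤ 1 := by
      have := mul_le_mul_of_nonneg_right e e2.le
      rwa [inv_mul_cancel₀ e2.ne'] at this
    nlinarith
  have hpow : (2 * Q.κMax / c) ^ 3 ≤ (1 + τ) ^ N := by
    have e1 : (2 * Q.κMax / c) ^ 3 = Real.exp ((3 : ℕ) * ℓ) := by
      rw [Real.exp_nat_mul, hℓ, Real.exp_log (by linarith)]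
    have e2 : Real.exp (N * (τ / 2)) ≤ (1 + τ) ^ N := by
      rw [Real.exp_nat_mul]; gcongr
    refine e1.le.trans (le_trans (Real.exp_le_exp.2 ?_) e2)
    push_cast
    nlinarith [mul_le_mul_of_nonneg_right hNle hτ.le, mul_le_mul_of_nonneg_right hqτ hℓ0]
  -- one factor `2κ_max/c` is what is needed, the other two are at least `2` each
  have hcube : 4 * (2 * Q.κMax / c) ≤ (2 * Q.κMax / c) ^ 3 := by
    nlinarith [mul_nonneg (by linarith : 0 ≤ 2 * Q.κMax / c)
      (by nlinarith : 0 ≤ (2 * Q.κMax / c) ^ 2 - 4)]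
  rw [← div_eq_mul_inv, div_le_iff₀ (by positivity)]
  have h4 := mul_le_mul_of_nonneg_left (hcube.trans hpow) hc0.le
  have h5 : c * (4 * (2 * Q.κMax / c)) = 8 * Q.κMax := by field_simp; ring
  linarith

/-! ### Size of the weights of the Lyapunov function -/

section Weights

theorem cWeight_one_le (hr : 0 < rate Q p) (hr1 : rate Q p ≤ 1) (hq : 0 ≤ qConst Q p) :
    cWeight Q p 1 ≤ p.D * (rate Q p)⁻¹ ^ p.D * qConst Q p := by
  have hu : 1 ≤ (rate Q p)⁻¹ := (one_le_inv₀ hr).2 hr1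
  rw [cWeight]
  calc _ ≤ ∑ _j ∈ Finset.Icc 1 p.D, (rate Q p)⁻¹ ^ p.D * qConst Q p := by
        refine Finset.sum_le_sum fun j hj => mul_le_mul_of_nonneg_right ?_ hq
        rw [show (((1 : ℕ) : ℤ) - (j : ℤ) - 1) = -(j : ℤ) by push_cast; ring, zpow_neg,
          zpow_natCast, ← inv_pow]
        exact pow_le_pow_right₀ hu (Finset.mem_Icc.1 hj).2
    _ = _ := by rw [Finset.sum_const, Nat.card_Icc, nsmul_eq_mul]; push_cast; ring

/-- The weights `w_e` are geometric up to the delay, which makes `c̃_1` a sum of geometric series. -/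
theorem cTilde_one_le (hr : 0 < rate Q p) (hr1 : rate Q p ≤ 1) (hc : 0 < p.c)
    (hlt : p.c < rate Q p)
    (hC : 0 ≤ 3 * p.ρ * Real.sqrt (p.s * Q.κ) * p.η / Q.α * (frobNorm Q.sqrtU ^ 4 / Q.μMin ^ 2)) :
    cTilde Q p 1 ≤ 3 * p.ρ * Real.sqrt (p.s * Q.κ) * p.η / Q.α
      * (frobNorm Q.sqrtU ^ 4 / Q.μMin ^ 2)
      * (p.c * (6 * p.D * (rate Q p)⁻¹ ^ p.D
        + (6 * (rate Q p)⁻¹ ^ (p.D + 1) + 8 * (rate Q p)⁻¹) / (1 - p.c * (rate Q p)⁻¹))) := by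
  set C := 3 * p.ρ * Real.sqrt (p.s * Q.κ) * p.η / Q.α * (frobNorm Q.sqrtU ^ 4 / Q.μMin ^ 2)
    with hCdef
  set u := (rate Q p)⁻¹ with hu
  have hu1 : 1 ≤ u := (one_le_inv₀ hr).2 hr1
  have hu0 : 0 < u := by linarith
  have hcu : p.c * u < 1 := by
    rw [hu, ← div_eq_mul_inv, div_lt_one hr]; exact hlt
  have hgeo : HasSum (fun l : ℕ => (p.c * u) ^ (l + 1)) (p.c * u * (1 - p.c * u)⁻¹) := by
    refine ((hasSum_geometric_of_lt_one (by positivity) hcu).mul_left (p.c * u)).congr_fun ?_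
    intro l; ring
  -- the part of the weights with `c` for `e ≤ D` and `c^{e-D}` for `e > D`
  have h1 : HasSum (fun l : ℕ => (if 1 + l ≤ p.D then p.c else p.c ^ (1 + l - p.D)) * u ^ (l + 1))
      (u ^ p.D * (p.c * u * (1 - p.c * u)⁻¹)
        + ∑ l ∈ Finset.range p.D,
          (if 1 + l ≤ p.D then p.c else p.c ^ (1 + l - p.D)) * u ^ (l + 1)) := by
    rw [← hasSum_nat_add_iff]
    refine (hgeo.mul_left (u ^ p.D)).congr_fun fun l => ?_
    rw [if_neg (by omega), show 1 + (l + p.D) - p.D = l + 1 by omega]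
    ring
  have hhead : ∑ l ∈ Finset.range p.D,
      (if 1 + l ≤ p.D then p.c else p.c ^ (1 + l - p.D)) * u ^ (l + 1)
      ≤ p.D * (p.c * u ^ p.D) := by
    calc _ ≤ ∑ _l ∈ Finset.range p.D, p.c * u ^ p.D := by
          refine Finset.sum_le_sum fun l hl => ?_
          rw [Finset.mem_range] at hl
          rw [if_pos (by omega)]
          exact mul_le_mul_of_nonneg_left (pow_le_pow_right₀ hu1 (by omega)) hc.le
      _ = _ := by rw [Finset.sum_const, Finset.card_range, nsmul_eq_mul]
  have htot : HasSum (fun l : ℕ => wWeight Q p (1 + l) / rate Q p ^ (l + 1)) _ :=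
    (((h1.mul_left 6).add (hgeo.mul_left 8)).mul_left C).congr_fun fun l => by
      rw [wWeight, ← hCdef, div_eq_mul_inv, ← inv_pow, ← hu]
      ring
  rw [cTilde, htot.tsum_eq]
  refine mul_le_mul_of_nonneg_left ?_ hC
  have e : p.c * (6 * p.D * u ^ p.D + (6 * u ^ (p.D + 1) + 8 * u) / (1 - p.c * u))
      = 6 * (u ^ p.D * (p.c * u * (1 - p.c * u)⁻¹) + p.D * (p.c * u ^ p.D))
        + 8 * (p.c * u * (1 - p.c * u)⁻¹) := by
    rw [div_eq_mul_inv]; ring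
  rw [e]
  linarith

theorem weights_le (hn : 2 ≤ n) (hm : 1 ≤ m) (hd : 1 ≤ d) (hr : 0 < rate Q p)
    (hr1 : rate Q p ≤ 1) (hc : 0 < p.c) (hlt : p.c < rate Q p) (hγ : 0 < p.γ) (hη : 0 < p.η)
    (hρ : 0 < p.ρ) {a b : ℝ}
    (ha : 6 * frobNorm Q.sqrtU ^ 4 / (Q.α * Q.β * Q.μMin ^ 2) * p.γ * p.D
      * (rate Q p)⁻¹ ^ p.D ≤ a)
    (hb : frobNorm Q.sqrtU ^ 4 / (Q.α * Q.β * Q.μMin ^ 2) * p.c * (6 * p.D * (rate Q p)⁻¹ ^ p.D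
        + (6 * (rate Q p)⁻¹ ^ (p.D + 1) + 8 * (rate Q p)⁻¹) / (1 - p.c * (rate Q p)⁻¹)) ≤ b) :
    cWeight Q p 1 + cTilde Q p 1
      ≤ 3 * p.ρ * Real.sqrt (p.s * Q.κ) * p.η * Q.β * (a + b) := by
  have hα := Q.α_pos hn hm hd
  have hβ := Q.β_pos hn
  have hμ := Q.μMin_pos hn
  have hF := Q.frobNorm_pos hn
  have hq : 0 ≤ qConst Q p := by rw [qConst]; positivity
  have h1 := cWeight_one_le hr hr1 hq
  have h2 := cTilde_one_le hr hr1 hc hlt (by positivity)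
  set B := 6 * p.D * (rate Q p)⁻¹ ^ p.D
        + (6 * (rate Q p)⁻¹ ^ (p.D + 1) + 8 * (rate Q p)⁻¹) / (1 - p.c * (rate Q p)⁻¹)
  have hk : 0 ≤ 3 * p.ρ * Real.sqrt (p.s * Q.κ) * p.η * Q.β := by positivity
  have e1 : p.D * (rate Q p)⁻¹ ^ p.D * qConst Q p
      = 3 * p.ρ * Real.sqrt (p.s * Q.κ) * p.η * Q.β
        * (6 * frobNorm Q.sqrtU ^ 4 / (Q.α * Q.β * Q.μMin ^ 2) * p.γ * p.D
          * (rate Q p)⁻¹ ^ p.D) := by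
    rw [qConst]; field_simp; ring
  have e2 : 3 * p.ρ * Real.sqrt (p.s * Q.κ) * p.η / Q.α
      * (frobNorm Q.sqrtU ^ 4 / Q.μMin ^ 2) * (p.c * B)
      = 3 * p.ρ * Real.sqrt (p.s * Q.κ) * p.η * Q.β
        * (frobNorm Q.sqrtU ^ 4 / (Q.α * Q.β * Q.μMin ^ 2) * p.c * B) := by
    field_simp
  rw [mul_add]
  rw [e1] at h1
  rw [e2] at h2
  exact add_le_add (h1.trans (mul_le_mul_of_nonneg_left ha hk))
    (h2.trans (mul_le_mul_of_nonneg_left hb hk))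

/-- `1/(1 - x) ≤ e^{2x}` for `0 ≤ x ≤ 1/√2`. -/
theorem inv_one_sub_le_exp {x : ℝ} (hx : 0 ≤ x) (hx2 : x ^ 2 ≤ 1 / 2) :
    (1 - x)⁻¹ ≤ Real.exp (2 * x) := by
  have hx1 : 0 < 1 - x := by nlinarith
  have h := Real.quadratic_le_exp_of_nonneg (by positivity : 0 ≤ 2 * x)
  rw [inv_le_iff_one_le_mul₀ hx1]
  nlinarith [mul_nonneg hx (by linarith : 0 ≤ 1 - 2 * x ^ 2)]

/-- The case of delay `2` of the bound on the weights, in which all the slack is used. -/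
theorem geometric_bound_two {x : ℝ} (hx : 0 ≤ x) (hx2 : x ^ 2 ≤ 1 / 2) :
    6 * (1 - x)⁻¹ ^ 2 + 6 * (1 - x)⁻¹ ^ 3 + 8 * (1 - x)⁻¹ ≤ 25 * Real.exp (2 * x) ^ 2 := by
  have hx1 : 0 < 1 - x := by nlinarith
  have hx3 : x ≤ 708 / 1000 := by nlinarith
  have h4 : 1 + 4 * x + 8 * x ^ 2 + 32 / 3 * x ^ 3 + 32 / 3 * x ^ 4 + 128 / 15 * x ^ 5
      ≤ Real.exp (2 * x) ^ 2 := by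
    have e : Real.exp (2 * x) ^ 2 = Real.exp (4 * x) := by
      rw [← Real.exp_nat_mul]; congr 1; push_cast; ring
    have := Real.sum_le_exp_of_nonneg (by positivity : 0 ≤ 4 * x) 6
    simp only [Finset.sum_range_succ, Finset.sum_range_zero, Nat.factorial] at this
    push_cast at this
    rw [e]
    linarith
  have hpoly : 6 * (1 - x) + 6 + 8 * (1 - x) ^ 2 ≤ 25 * (1 - x) ^ 3
      * (1 + 4 * x + 8 * x ^ 2 + 32 / 3 * x ^ 3 + 32 / 3 * x ^ 4 + 128 / 15 * x ^ 5) := by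
    -- the inequality is tightest near `x = 1/√2`: powers of `x` are lowered by tangents at `7/10`
    have a6 : 0 ≤ x ^ 6 * (708 / 1000 - x) := mul_nonneg (by positivity) (by linarith)
    have a4 := mul_nonneg (by positivity : 0 ≤ x ^ 4) (sq_nonneg (x - 7 / 10))
    have a3 := mul_nonneg (by positivity : 0 ≤ x ^ 3) (sq_nonneg (x - 7 / 10))
    have a2 := mul_nonneg (by positivity : 0 ≤ x ^ 2) (sq_nonneg (x - 7 / 10))
    have a1 := mul_nonneg hx (sq_nonneg (x - 7 / 10))
    have a5 := mul_nonneg (by positivity : 0 ≤ x ^ 5) (sq_nonneg (x - 7 / 10))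
    have a7 := mul_nonneg (by positivity : 0 ≤ x ^ 6) (sq_nonneg (x - 7 / 10))
    nlinarith
  have hfin : 6 * (1 - x) + 6 + 8 * (1 - x) ^ 2 ≤ 25 * (1 - x) ^ 3 * Real.exp (2 * x) ^ 2 :=
    hpoly.trans (mul_le_mul_of_nonneg_left h4 (by positivity))
  have e : 6 * (1 - x)⁻¹ ^ 2 + 6 * (1 - x)⁻¹ ^ 3 + 8 * (1 - x)⁻¹
      = (6 * (1 - x) + 6 + 8 * (1 - x) ^ 2) / (1 - x) ^ 3 := by field_simp
  rw [e, div_le_iff₀ (by positivity)]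
  linarith

theorem geometric_bound {x : ℝ} (hx : 0 ≤ x) (hx2 : x ^ 2 ≤ 1 / 2) {D : ℕ} (hD : 2 ≤ D) :
    6 * D * (1 - x)⁻¹ ^ D + 12 * (1 - x)⁻¹ ^ (D + 1) + 16 * (1 - x)⁻¹
      ≤ 25 * D * Real.exp (2 * x) ^ D := by
  have hx1 : 0 < 1 - x := by nlinarith
  have hu1 : 1 ≤ (1 - x)⁻¹ := (one_le_inv₀ hx1).2 (by linarith)
  have h2 := geometric_bound_two hx hx2
  have hE := inv_one_sub_le_exp hx hx2
  set u := (1 - x)⁻¹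
  obtain ⟨k, rfl⟩ := Nat.exists_eq_add_of_le hD
  have hk : (0 : ℝ) ≤ k := Nat.cast_nonneg k
  have hpow : 1 ≤ u ^ k := one_le_pow₀ hu1
  push_cast
  have e1 : 6 * (2 + (k : ℝ)) * u ^ (2 + k) + 12 * u ^ (2 + k + 1) + 16 * u
      ≤ (2 + k) * u ^ k * (6 * u ^ 2 + 6 * u ^ 3 + 8 * u) := by
    have e2 : 12 * u ^ (2 + k + 1) ≤ 6 * (2 + (k : ℝ)) * (u ^ k * u ^ 3) := by
      have : u ^ (2 + k + 1) = u ^ k * u ^ 3 := by ring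
      rw [this]
      nlinarith [mul_nonneg hk (by positivity : 0 ≤ u ^ k * u ^ 3)]
    have e3 : 16 * u ≤ 8 * (2 + (k : ℝ)) * (u ^ k * u) := by
      have : u ≤ u ^ k * u := le_mul_of_one_le_left (by linarith) hpow
      nlinarith [mul_nonneg hk (by positivity : 0 ≤ u ^ k * u)]
    have e4 : u ^ (2 + k) = u ^ k * u ^ 2 := by ring
    rw [e4]
    linarith
  calc _ ≤ _ := e1
    _ ≤ (2 + k) * Real.exp (2 * x) ^ k * (25 * Real.exp (2 * x) ^ 2) := by gcongr
    _ = _ := by ring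

end Weights

end DLAG

/-! ### Admissibility of the parameters -/

namespace DLAG

variable {n m d : ℕ} {Q : Problem n m d} {p : Params}

/-- Step sizes of the given form satisfy the identities required by the descent. -/
theorem admissible_of_eq (hn : 2 ≤ n) (hm : 1 ≤ m) (hd : 1 ≤ d) (hc : 0 < p.c)
    (hγ : 0 < p.γ) {R a b : ℝ} (hR : 0 < R) (hab : 0 ≤ a + b)
    (hη : p.η = R / (1 + R) * (1 / (1 + 24 * (a + b) * (2 + R))) * (1 / Q.β))
    (hs : p.s = (2 + R) / R * (1 + 24 * (a + b) * (2 + R))) (hρ : p.ρ = 2 + R)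
    (hτ : 1 < Real.sqrt (p.s * Q.κ)) (hlt : p.c < rate Q p)
    (ha : 6 * frobNorm Q.sqrtU ^ 4 / (Q.α * Q.β * Q.μMin ^ 2) * p.γ * p.D
      * (rate Q p)⁻¹ ^ p.D ≤ a)
    (hb : frobNorm Q.sqrtU ^ 4 / (Q.α * Q.β * Q.μMin ^ 2) * p.c * (6 * p.D * (rate Q p)⁻¹ ^ p.D
        + (6 * (rate Q p)⁻¹ ^ (p.D + 1) + 8 * (rate Q p)⁻¹) / (1 - p.c * (rate Q p)⁻¹)) ≤ b)
    (hcκ : 2 ≤ 2 * Q.κMax / p.c) (hep : p.epochs = epochCount Q 12 p.c) :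
    Admissible Q p R (a + b) := by
  have hα := Q.α_pos hn hm hd
  have hβ := Q.β_pos hn
  have hT : 0 < 1 + 24 * (a + b) * (2 + R) := by positivity
  have hη0 : 0 < p.η := by rw [hη]; positivity
  have hρ0 : 0 < p.ρ := by rw [hρ]; positivity
  have hr1 : rate Q p ≤ 1 := by
    have : 0 ≤ 1 / Real.sqrt (p.s * Q.κ) := by positivity
    rw [rate]; linarith
  have hs0 : 0 < p.s := by rw [hs]; positivity
  have hκ : 0 < Q.κ := by rw [Q.κ_eq hn hm hd]; positivity
  refine ⟨hc, hγ, hη0, hτ, hR, hab, hρ, ?_, ?_, hlt, ?_, fun i => ?_⟩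
  · rw [Real.sq_sqrt (by positivity), Q.κ_eq hn hm hd, hρ, hη, hs]
    field_simp
  · rw [hη, hρ]
    field_simp
  · exact weights_le hn hm hd (hc.trans hlt) hr1 hc hlt hγ hη0 hρ0 ha hb
  · rw [hep]
    exact katyusha_contraction_le hn hm hd hc hcκ i

/-- The inverse of the contraction factor is at most `e^{2/√κ}`. -/
theorem inv_rate_le_exp {κ s : ℝ} (hκ : 0 < κ) (hs : 1 ≤ s) (hsκ : 2 ≤ s * κ) :
    (1 / Real.sqrt (s * κ)) ^ 2 ≤ 1 / 2 ∧
      Real.exp (2 * (1 / Real.sqrt (s * κ))) ≤ Real.exp (2 / Real.sqrt κ) := by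
  constructor
  · rw [div_pow, Real.sq_sqrt (by linarith), one_pow]
    exact one_div_le_one_div_of_le (by norm_num) hsκ
  · refine Real.exp_le_exp.2 ?_
    rw [mul_one_div]
    exact div_le_div_of_nonneg_left (by norm_num) (Real.sqrt_pos.2 hκ)
      (Real.sqrt_le_sqrt (by nlinarith))

theorem admissible_generalParams (hn : 2 ≤ n) (hm : 1 ≤ m) (hd : 1 ≤ d) (Q : Problem n m d)
    {D : ℕ} {γ c a b : ℝ} (hD : 2 ≤ D) (hγ : 0 < γ) (hc : 0 < c) (hκ : 2 < Q.κ)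
    (ha : 6 * frobNorm Q.sqrtU ^ 4 / (Q.α * Q.β * Q.μMin ^ 2) * γ * D
      * Real.exp (2 * D / Real.sqrt Q.κ) ≤ a)
    (hb : 25 * frobNorm Q.sqrtU ^ 4 / (Q.α * Q.β * Q.μMin ^ 2) * c * D
      * Real.exp (2 * D / Real.sqrt Q.κ) ≤ b)
    (hc2 : c ≤ rate Q (generalParams Q 12 D γ c a b) / 2) :
    2 ≤ 2 * Q.κMax / c ∧
      Admissible Q (generalParams Q 12 D γ c a b) (rootConst a b) (a + b) := by
  have hα := Q.α_pos hn hm hd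
  have hβ := Q.β_pos hn
  have hμ := Q.μMin_pos hn
  have hF := Q.frobNorm_pos hn
  have ha0 : 0 ≤ a := le_trans (by positivity) ha
  have hb0 : 0 ≤ b := le_trans (by positivity) hb
  have hR : 0 < rootConst a b := Real.sqrt_pos.2 (by positivity)
  set p := generalParams Q 12 D γ c a b with hp
  have hs : p.s = (2 + rootConst a b) / rootConst a b
      * (1 + 24 * (a + b) * (2 + rootConst a b)) := rfl
  have hs1 : 1 ≤ p.s := by
    rw [hs]
    refine one_le_mul_of_one_le_of_one_le ((one_le_div hR).2 (by linarith)) ?_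
    have : 0 ≤ 24 * (a + b) * (2 + rootConst a b) := by positivity
    linarith
  have hsκ : 2 < p.s * Q.κ := by nlinarith
  have hτ : 1 < Real.sqrt (p.s * Q.κ) := Real.lt_sqrt_of_sq_lt (by linarith)
  obtain ⟨hx2, hE⟩ := inv_rate_le_exp (by linarith) hs1 hsκ.le
  have hx : 0 ≤ 1 / Real.sqrt (p.s * Q.κ) := by positivity
  have hr : 0 < rate Q p := by linarith
  have hr1 : rate Q p ≤ 1 := by rw [rate]; linarith
  have hpow : Real.exp (2 / Real.sqrt Q.κ) ^ D = Real.exp (2 * D / Real.sqrt Q.κ) := by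
    rw [← Real.exp_nat_mul]; congr 1; ring
  have hcκ : 2 ≤ 2 * Q.κMax / c := by
    rw [le_div_iff₀ hc]
    linarith [Q.one_le_κMax hn hm hd]
  refine ⟨hcκ, admissible_of_eq hn hm hd hc hγ hR (by positivity) rfl rfl rfl
    hτ (show c < rate Q p by linarith) (le_trans ?_ ha) (le_trans ?_ hb) hcκ rfl⟩
  · rw [← hpow]
    change _ * γ * D * (rate Q p)⁻¹ ^ D ≤ _
    gcongr
    exact (inv_one_sub_le_exp hx hx2).trans hE
  · have hgeo := geometric_bound hx hx2 hD
    change 6 * D * (rate Q p)⁻¹ ^ D + 12 * (rate Q p)⁻¹ ^ (D + 1) + 16 * (rate Q p)⁻¹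
      ≤ _ at hgeo
    change _ * c * (6 * D * (rate Q p)⁻¹ ^ D
      + (6 * (rate Q p)⁻¹ ^ (D + 1) + 8 * (rate Q p)⁻¹) / (1 - c * (rate Q p)⁻¹)) ≤ _
    set u := (rate Q p)⁻¹ with hu
    have hu0 : 0 < u := by positivity
    -- the geometric series with ratio `cu ≤ 1/2`
    have hcu : c * u ≤ 1 / 2 := by
      rw [hu, ← div_eq_mul_inv, div_le_iff₀ hr]; linarith
    have htail : (6 * u ^ (D + 1) + 8 * u) / (1 - c * u) ≤ 12 * u ^ (D + 1) + 16 * u := by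
      rw [div_le_iff₀ (by linarith)]
      have : 0 ≤ 6 * u ^ (D + 1) + 8 * u := by positivity
      nlinarith
    have hEpow : Real.exp (2 * (1 / Real.sqrt (p.s * Q.κ))) ^ D
        ≤ Real.exp (2 * D / Real.sqrt Q.κ) := by
      rw [← hpow]; gcongr
    calc _ ≤ frobNorm Q.sqrtU ^ 4 / (Q.α * Q.β * Q.μMin ^ 2) * c
          * (25 * D * Real.exp (2 * D / Real.sqrt Q.κ)) := by
          gcongr
          have : 25 * (D : ℝ) * Real.exp (2 * (1 / Real.sqrt (p.s * Q.κ))) ^ D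
              ≤ 25 * D * Real.exp (2 * D / Real.sqrt Q.κ) := by gcongr
          linarith
      _ = _ := by ring

theorem cChoice_pos (hn : 2 ≤ n) (hm : 1 ≤ m) (hd : 1 ≤ d) (Q : Problem n m d) {D : ℕ}
    (hD : 1 ≤ D) : 0 < cChoice Q D := by
  have hα := Q.α_pos hn hm hd
  have hβ := Q.β_pos hn
  have hμ := Q.μMin_pos hn
  have hF := Q.frobNorm_pos hn
  have hD0 : (0 : ℝ) < D := by exact_mod_cast hD
  rw [cChoice]; positivity

theorem γChoice_pos (hn : 2 ≤ n) (hm : 1 ≤ m) (hd : 1 ≤ d) (Q : Problem n m d) {D : ℕ}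
    (hD : 1 ≤ D) : 0 < γChoice Q D := by
  have hα := Q.α_pos hn hm hd
  have hβ := Q.β_pos hn
  have hμ := Q.μMin_pos hn
  have hF := Q.frobNorm_pos hn
  have hD0 : (0 : ℝ) < D := by exact_mod_cast hD
  rw [γChoice]; positivity

theorem cChoice_le (hn : 2 ≤ n) (hm : 1 ≤ m) (hd : 1 ≤ d) (Q : Problem n m d) {D : ℕ}
    (hD : 1 ≤ D) : cChoice Q D ≤ 1 / 1200 := by
  have hF := Q.frobNorm_pos hn
  have hD1 : (1 : ℝ) ≤ D := by exact_mod_cast hD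
  have h1 := Q.αβ_le_frobNorm hn hm hd
  have h2 : Real.exp (-(2 * (D + 1) / Real.sqrt Q.κ)) ≤ 1 :=
    Real.exp_le_one_iff.2 (neg_nonpos.2 (by positivity))
  have h3 : Q.α * Q.β * Q.μMin ^ 2 / (1200 * D * frobNorm Q.sqrtU ^ 4) ≤ 1 / 1200 := by
    rw [div_le_iff₀ (by positivity)]
    have : 0 < frobNorm Q.sqrtU ^ 4 := by positivity
    nlinarith
  rw [cChoice]
  calc _ ≤ 1 / 1200 * (1 : ℝ) := mul_le_mul h3 h2 (Real.exp_pos _).le (by norm_num)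
    _ = _ := mul_one _

theorem admissible_mainParams (hn : 2 ≤ n) (hm : 1 ≤ m) (hd : 1 ≤ d) (Q : Problem n m d)
    {D : ℕ} (hD : 1 ≤ D) :
    2 ≤ 2 * Q.κMax / cChoice Q D ∧ Admissible Q (mainParams Q 12 D) 2 (1 / 48 + 1 / 48) := by
  have hα := Q.α_pos hn hm hd
  have hβ := Q.β_pos hn
  have hμ := Q.μMin_pos hn
  have hF := Q.frobNorm_pos hn
  have hD1 : (1 : ℝ) ≤ D := by exact_mod_cast hD
  have hc := cChoice_pos hn hm hd Q hD
  have hc1 := cChoice_le hn hm hd Q hD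
  have hκ1 := Q.one_le_κ hn hm hd
  set p := mainParams Q 12 D with hp
  have hs : p.s = 10 := rfl
  obtain ⟨hx2, hE⟩ := inv_rate_le_exp (by linarith) (by rw [hs]; norm_num : 1 ≤ p.s)
    (by rw [hs]; linarith : 2 ≤ p.s * Q.κ)
  have hτ : 1 < Real.sqrt (p.s * Q.κ) := Real.lt_sqrt_of_sq_lt (by rw [hs]; linarith)
  have hx : 0 ≤ 1 / Real.sqrt (p.s * Q.κ) := by positivity
  have hx1 : 1 / Real.sqrt (p.s * Q.κ) ≤ 3 / 4 := by nlinarith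
  -- `1/√(10κ) ≤ 1/√10`, so that the rate stays away from zero
  have hr : 1 / 4 ≤ rate Q p := by rw [rate]; linarith
  have hr1 : rate Q p ≤ 1 := by rw [rate]; linarith
  have hcκ : 2 ≤ 2 * Q.κMax / cChoice Q D := by
    rw [le_div_iff₀ hc]
    linarith [Q.one_le_κMax hn hm hd]
  have hu : (rate Q p)⁻¹ ≤ Real.exp (2 / Real.sqrt Q.κ) := (inv_one_sub_le_exp hx hx2).trans hE
  have hu1 : 1 ≤ (rate Q p)⁻¹ := (one_le_inv₀ (by linarith)).2 hr1
  refine ⟨hcκ, admissible_of_eq hn hm hd hc (γChoice_pos hn hm hd Q hD) (by norm_num)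
    (by norm_num) ?_ ?_ ?_ hτ (show cChoice Q D < rate Q p by linarith) ?_ ?_ hcκ rfl⟩
  · change 2 / 15 * (1 / Q.β) = _
    norm_num
  · change (10 : ℝ) = _
    norm_num
  · change (4 : ℝ) = _
    norm_num
  · change _ * γChoice Q D * D * (rate Q p)⁻¹ ^ D ≤ _
    have hpow : Real.exp (-(2 * D / Real.sqrt Q.κ)) * Real.exp (2 / Real.sqrt Q.κ) ^ D = 1 := by
      rw [← Real.exp_nat_mul, ← Real.exp_add, Real.exp_eq_one_iff]; ring
    have hγ := γChoice_pos hn hm hd Q hD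
    calc _ ≤ 6 * frobNorm Q.sqrtU ^ 4 / (Q.α * Q.β * Q.μMin ^ 2) * γChoice Q D * D
          * Real.exp (2 / Real.sqrt Q.κ) ^ D := by gcongr
      _ = 1 / 48 * (Real.exp (-(2 * D / Real.sqrt Q.κ)) * Real.exp (2 / Real.sqrt Q.κ) ^ D) := by
          rw [γChoice]; field_simp; norm_num
      _ ≤ _ := by rw [hpow]; norm_num
  · change _ * cChoice Q D * (6 * D * (rate Q p)⁻¹ ^ D
      + (6 * (rate Q p)⁻¹ ^ (D + 1) + 8 * (rate Q p)⁻¹) / (1 - cChoice Q D * (rate Q p)⁻¹)) ≤ _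
    have hpow : Real.exp (-(2 * (D + 1) / Real.sqrt Q.κ))
        * Real.exp (2 / Real.sqrt Q.κ) ^ (D + 1) = 1 := by
      rw [← Real.exp_nat_mul, ← Real.exp_add, Real.exp_eq_one_iff]; push_cast; ring
    have hu4 : (rate Q p)⁻¹ ≤ 4 := inv_le_of_inv_le₀ (by linarith) (by linarith)
    set u := (rate Q p)⁻¹
    have hu0 : 0 < u := by linarith
    -- the geometric series with ratio `cu` is nearly `1`
    have hcu : cChoice Q D * u ≤ 1 / 300 := by nlinarith
    have hB : 6 * D * u ^ D + (6 * u ^ (D + 1) + 8 * u) / (1 - cChoice Q D * u)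
        ≤ 25 * D * Real.exp (2 / Real.sqrt Q.κ) ^ (D + 1) := by
      have e1 : u ^ D ≤ u ^ (D + 1) := pow_le_pow_right₀ hu1 (by omega)
      have e2 : u ≤ u ^ (D + 1) := le_self_pow₀ hu1 (by omega)
      have e3 : (6 * u ^ (D + 1) + 8 * u) / (1 - cChoice Q D * u) ≤ 19 * u ^ (D + 1) := by
        rw [div_le_iff₀ (by linarith)]
        have : 0 < u ^ (D + 1) := by positivity
        nlinarith
      have e4 : u ^ (D + 1) ≤ Real.exp (2 / Real.sqrt Q.κ) ^ (D + 1) := by gcongr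
      have e5 : 6 * D * u ^ D ≤ 6 * D * u ^ (D + 1) := by gcongr
      have e6 : 0 ≤ (D - 1) * u ^ (D + 1) := mul_nonneg (by linarith) (by positivity)
      calc _ ≤ 25 * D * u ^ (D + 1) := by linarith
        _ ≤ _ := by gcongr
    calc _ ≤ frobNorm Q.sqrtU ^ 4 / (Q.α * Q.β * Q.μMin ^ 2) * cChoice Q D
          * (25 * D * Real.exp (2 / Real.sqrt Q.κ) ^ (D + 1)) := by gcongr
      _ = 1 / 48 * (Real.exp (-(2 * (D + 1) / Real.sqrt Q.κ))
          * Real.exp (2 / Real.sqrt Q.κ) ^ (D + 1)) := by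
          rw [cChoice]; field_simp; norm_num
      _ ≤ _ := by rw [hpow]; norm_num

end DLAG

end

theorem mainTheorem1 :
    ∃ C₀ C₁ : ℝ, 0 < C₀ ∧ 0 < C₁ ∧
      ∀ (n m d : ℕ), 2 ≤ n → 1 ≤ m → 1 ≤ d → ∀ Q : DLAG.Problem n m d,
        (∃ ξstar, Q.IsDualMin ξstar) ∧
        ∀ (Ω : Type*) [MeasurableSpace Ω] (P : MeasureTheory.Measure Ω)
          [MeasureTheory.IsProbabilityMeasure P] (J : ℕ → Fin n → ℕ → Ω → Fin m),
          DLAG.Sampling P J → ∀ ξstar, Q.IsDualMin ξstar →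
            (∀ D : ℕ, 1 ≤ D →
              0 < DLAG.cChoice Q D ∧ DLAG.cChoice Q D < 1 ∧ 0 < DLAG.γChoice Q D ∧
              DLAG.Guarantee C₁ Q (DLAG.mainParams Q C₀ D) P J ξstar) ∧
            (∀ (D : ℕ) (γ c a b : ℝ), 2 ≤ D → 0 < γ → 0 < c → 2 < Q.κ →
              6 * DLAG.frobNorm Q.sqrtU ^ 4 / (Q.α * Q.β * Q.μMin ^ 2) * γ * D *
                Real.exp (2 * D / Real.sqrt Q.κ) ≤ a →
              25 * DLAG.frobNorm Q.sqrtU ^ 4 / (Q.α * Q.β * Q.μMin ^ 2) * c * D *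
                Real.exp (2 * D / Real.sqrt Q.κ) ≤ b →
              c ≤ DLAG.rate Q (DLAG.generalParams Q C₀ D γ c a b) / 2 →
              DLAG.Guarantee C₁ Q (DLAG.generalParams Q C₀ D γ c a b) P J ξstar) := by

  refine ⟨12, 120, by norm_num, by norm_num, fun n m d hn hm hd Q =>
    ⟨Q.exists_isDualMin hn hm hd, ?_⟩⟩
  intro Ω _ P _ J hJ ξstar hstar
  refine ⟨fun D hD => ?_, fun D γ c a b hD hγ hc hκ ha hb hc2 => ?_⟩
  · obtain ⟨hcκ, h⟩ := DLAG.admissible_mainParams hn hm hd Q hD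
    exact ⟨DLAG.cChoice_pos hn hm hd Q hD,
      (DLAG.cChoice_le hn hm hd Q hD).trans_lt (by norm_num), DLAG.γChoice_pos hn hm hd Q hD,
      h.guarantee rfl hcκ hJ hn hm hd hstar⟩
  · obtain ⟨hcκ, h⟩ := DLAG.admissible_generalParams hn hm hd Q hD hγ hc hκ ha hb hc2
    exact h.guarantee rfl hcκ hJ hn hm hd hstar
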